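/- **Notation.** Let $L^2(\mathbb R_+)$, $\mathbb R_+=\,]0,\infty[$, carry the scalar product $(f|g)=\int_0^\infty\overline{f(x)}\,g(x)\,\mathrm dx$ and the bilinear form $\langle f|g\rangle=\int_0^\infty f(x)\,g(x)\,\mathrm dx$. For a densely defined operator $A$ let $A^*$ be its adjoint and let $A^\#$ be its transpose: $f\in\mathcal D(A^\#)$ with $A^\# f=g$ iff $f,g\in L^2(\mathbb R_+)$ and $\langle f|Ah\rangle=\langle g|h\rangle$ for all $h\in\mathcal D(A)$. For $\beta,\alpha\in\mathbb C$ put $$L_{\beta,\alpha}=-\partial_x^2+\Big(\alpha-\frac14\Big)\frac1{x^2}-\frac{\beta}{x},$$ acting on distributions on $\mathbb R_+$. Let $L_{\beta,\alpha}^{\max}$ be its restriction to $\mathcal D(L^{\max}_{\beta,\alpha})=\{f\in L^2(\mathbb R_+)\mid L_{\beta,\alpha}f\in L^2(\mathbb R_+)\}$, and let $L_{\beta,\alpha}^{\min}$ be the closure of its restriction to $C_{\mathrm c}^\infty(\mathbb R_+)$. A function $f$ is in $\mathcal D(L_{\beta,\alpha}^{\min})$ *around $0$* if $\zeta f\in\mathcal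 D(L_{\beta,\alpha}^{\min})$ for some $\zeta\in C_{\mathrm c}^\infty([0,\infty[)$ with $\zeta=1$ near $0$. For $\beta,m\in\mathbb C$ with $\Re(m)>-1$, except for the case $m=-\frac12$, $\beta\ne0$, let $H_{\beta,m}$ be the restriction of $L^{\max}_{\beta,m^2}$ to $$\mathcal D(H_{\beta,m})=\Big\{f\in\mathcal D(L^{\max}_{\beta,m^2})\ \Big|\ \exists\,c\in\mathbb C:\ f(x)-c\,x^{\frac12+m}\Big(1-\frac{\beta}{1+2m}x\Big)\in\mathcal D(L^{\min}_{\beta,m^2})\text{ around }0\Big\},$$ where $\frac{\beta}{1+2m}$ is read as $0$ if $\beta=0$ (also when $m=-\frac12$). In the exceptional case put $H_{\beta,-\frac12}:=H_{\beta,\frac12}$ for $\beta\neq0$. **Theorem.** 1. For all $\beta,m\in\mathbb C$ with $\Re(m)>-1$ the operator $H_{\beta,m}$ is densely defined and $$(H_{\beta,m})^*=H_{\bar\beta,\bar m},\qquad (H_{\beta,m})^\#=H_{\beta,m}.$$ 2. For all real $\beta$ and all real $m>-1$ the operator $H_{\beta,m}$ is self-adjoint. 3. If $\beta, m\in\mathbb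 C$ and $\Re(m)\ge1$, then $L^{\min}_{\beta,m^2}=H_{\beta,m}=L^{\max}_{\beta,m^2}$. 4. If $\beta, m\in\mathbb C$ and $-1<\Re(m)<1$, then $L^{\min}_{\beta,m^2}\subsetneq H_{\beta,m}\subsetneq L^{\max}_{\beta,m^2}$, and $\mathcal D(L^{\min}_{\beta,m^2})$ has codimension $1$ in $\mathcal D(H_{\beta,m})$, and $\mathcal D(H_{\beta,m})$ has codimension $1$ in $\mathcal D(L^{\max}_{\beta,m^2})$. -/

import Mathlib

open MeasureTheory Set Filter Topology
open scoped ContDiff ComplexConjugate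

namespace Whittaker

/-- Lebesgue measure on the open half-line `]0,∞[`. -/
noncomputable abbrev halfLine : Measure ℝ := volume.restrict (Ioi (0 : ℝ))

/-- The Hilbert space `L²(]0,∞[)` of complex functions. -/
abbrev L2 : Type := Lp ℂ 2 halfLine

/-- `C_c^∞(]0,∞[)`: smooth complex functions with compact support contained in `]0,∞[`
(extended by zero to the real line). -/
structure IsTestFun (φ : ℝ → ℂ) : Prop where
  smooth : ContDiff ℝ ∞ φ
  compact : HasCompactSupport φ
  supp : tsupport φ ⊆ Ioi (0 : ℝ)

/-- The formal Whittaker operator `-∂ₓ² + (α - 1/4) x⁻² - β x⁻¹` applied to a smooth function. -/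
noncomputable def formalOp (β α : ℂ) (φ : ℝ → ℂ) (x : ℝ) : ℂ :=
  -deriv (deriv φ) x + ((α - 1 / 4) / (x : ℂ) ^ 2 - β / (x : ℂ)) * φ x

/-! ### Test functions -/

theorem IsTestFun.mul_contDiffOn {φ v : ℝ → ℂ} (hφ : IsTestFun φ)
    (hv : ContDiffOn ℝ ∞ v (Ioi 0)) : IsTestFun (fun x => v x * φ x) := by
  have hs : tsupport (fun x => v x * φ x) ⊆ tsupport φ := tsupport_mul_subset_right
  refine ⟨?_, hφ.compact.mul_left, hs.trans hφ.supp⟩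
  rw [contDiff_iff_contDiffAt]
  intro x
  by_cases hx : x ∈ tsupport φ
  · exact (hv.contDiffAt (Ioi_mem_nhds (hφ.supp hx))).mul hφ.smooth.contDiffAt
  · have h0 : φ =ᶠ[𝓝 x] 0 := notMem_tsupport_iff_eventuallyEq.mp hx
    refine (contDiffAt_const (c := (0 : ℂ))).congr_of_eventuallyEq ?_
    filter_upwards [h0] with y hy
    simp [hy]

theorem IsTestFun.mul_smooth {φ v : ℝ → ℂ} (hφ : IsTestFun φ) (hv : ContDiff ℝ ∞ v) :
    IsTestFun (fun x => v x * φ x) := hφ.mul_contDiffOn hv.contDiffOn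

theorem IsTestFun.mul {φ ψ : ℝ → ℂ} (hφ : IsTestFun φ) (hψ : IsTestFun ψ) :
    IsTestFun (fun x => φ x * ψ x) := hψ.mul_smooth hφ.smooth

theorem IsTestFun.zero : IsTestFun (fun _ => 0) :=
  ⟨contDiff_const, HasCompactSupport.zero, by
    have : tsupport (fun _ : ℝ => (0 : ℂ)) = ∅ := tsupport_eq_empty_iff.mpr rfl
    simp [this]⟩

theorem IsTestFun.add {φ ψ : ℝ → ℂ} (hφ : IsTestFun φ) (hψ : IsTestFun ψ) :
    IsTestFun (fun x => φ x + ψ x) :=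
  ⟨hφ.smooth.add hψ.smooth, hφ.compact.add hψ.compact,
    (tsupport_add φ ψ).trans (union_subset hφ.supp hψ.supp)⟩

theorem IsTestFun.const_mul {φ : ℝ → ℂ} (hφ : IsTestFun φ) (c : ℂ) :
    IsTestFun (fun x => c * φ x) := hφ.mul_smooth contDiff_const

theorem IsTestFun.conj {φ : ℝ → ℂ} (hφ : IsTestFun φ) : IsTestFun (fun x => conj (φ x)) := by
  have hs : tsupport (fun x => conj (φ x)) ⊆ tsupport φ :=
    tsupport_comp_subset (g := fun z : ℂ => conj z) (map_zero _) φ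
  refine ⟨?_, hφ.compact.comp_left (g := fun z : ℂ => conj z) (map_zero _), hs.trans hφ.supp⟩
  exact Complex.conjCLE.contDiff.comp hφ.smooth

theorem contDiff_deriv {φ : ℝ → ℂ} (hφ : ContDiff ℝ ∞ φ) : ContDiff ℝ ∞ (deriv φ) :=
  ((contDiff_succ_iff_deriv (n := ∞)).mp hφ).2.2

theorem IsTestFun.deriv {φ : ℝ → ℂ} (hφ : IsTestFun φ) : IsTestFun (deriv φ) :=
  ⟨contDiff_deriv hφ.smooth, hφ.compact.deriv, (tsupport_deriv_subset (f := φ)).trans hφ.supp⟩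

theorem IsTestFun.hasDerivAt {φ : ℝ → ℂ} (hφ : IsTestFun φ) (x : ℝ) :
    HasDerivAt φ (_root_.deriv φ x) x :=
  (hφ.smooth.differentiable (by simp)).differentiableAt.hasDerivAt

theorem contDiffOn_potential (β α : ℂ) :
    ContDiffOn ℝ ∞ (fun x : ℝ => (α - 1 / 4) / (x : ℂ) ^ 2 - β / (x : ℂ)) (Ioi 0) := by
  have hx : ContDiffOn ℝ ∞ (fun x : ℝ => (x : ℂ)) (Ioi 0) := Complex.ofRealCLM.contDiff.contDiffOn
  simp only [div_eq_mul_inv]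
  refine (contDiffOn_const.mul ((hx.pow 2).inv ?_)).sub (contDiffOn_const.mul (hx.inv ?_))
  · intro x hx
    have : x ≠ 0 := ne_of_gt hx
    simpa using this
  · intro x hx
    have : x ≠ 0 := ne_of_gt hx
    simpa using this

theorem IsTestFun.formalOp {φ : ℝ → ℂ} (hφ : IsTestFun φ) (β α : ℂ) :
    IsTestFun (formalOp β α φ) := by
  have h1 := (hφ.deriv.deriv.const_mul (-1)).add (hφ.mul_contDiffOn (contDiffOn_potential β α))
  have : (fun x => -1 * _root_.deriv (_root_.deriv φ) x +
      ((α - 1 / 4) / (x : ℂ) ^ 2 - β / (x : ℂ)) * φ x) = Whittaker.formalOp β α φ := by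
    funext x
    simp [Whittaker.formalOp]
  rwa [this] at h1

theorem formalOp_add {φ ψ : ℝ → ℂ} (hφ : IsTestFun φ) (hψ : IsTestFun ψ) (β α : ℂ) (x : ℝ) :
    formalOp β α (fun x => φ x + ψ x) x = formalOp β α φ x + formalOp β α ψ x := by
  have h1 : deriv (fun x => φ x + ψ x) = fun x => deriv φ x + deriv ψ x :=
    funext fun x => ((hφ.hasDerivAt x).add (hψ.hasDerivAt x)).deriv
  have h2 : deriv (fun x => deriv φ x + deriv ψ x) x = deriv (deriv φ) x + deriv (deriv ψ) x :=
    ((hφ.deriv.hasDerivAt x).add (hψ.deriv.hasDerivAt x)).deriv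
  simp only [formalOp, h1, h2]
  ring

theorem formalOp_const_mul {φ : ℝ → ℂ} (c β α : ℂ) (x : ℝ) :
    formalOp β α (fun x => c * φ x) x = c * formalOp β α φ x := by
  simp only [formalOp, deriv_const_mul_field']
  ring

theorem formalOp_zero (β α : ℂ) (x : ℝ) : formalOp β α (fun _ => 0) x = 0 := by
  simp [formalOp]

theorem IsTestFun.eq_zero {φ : ℝ → ℂ} (hφ : IsTestFun φ) {x : ℝ} (hx : x ∉ Ioi (0 : ℝ)) :
    φ x = 0 :=
  image_eq_zero_of_notMem_tsupport fun h => hx (hφ.supp h)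

theorem IsTestFun.integrable {φ : ℝ → ℂ} (hφ : IsTestFun φ) : Integrable φ :=
  hφ.smooth.continuous.integrable_of_hasCompactSupport hφ.compact

theorem IsTestFun.setIntegral {φ : ℝ → ℂ} (hφ : IsTestFun φ) :
    ∫ x, φ x ∂halfLine = ∫ x, φ x :=
  setIntegral_eq_integral_of_forall_compl_eq_zero fun _ hx => hφ.eq_zero hx

theorem IsTestFun.integral_deriv {φ : ℝ → ℂ} (hφ : IsTestFun φ) :
    ∫ x, _root_.deriv φ x ∂halfLine = 0 := by
  rw [hφ.deriv.setIntegral]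
  exact integral_eq_zero_of_hasDerivAt_of_integrable hφ.hasDerivAt hφ.deriv.integrable
    hφ.integrable

theorem IsTestFun.memLp {φ : ℝ → ℂ} (hφ : IsTestFun φ) : MemLp φ 2 halfLine :=
  (hφ.smooth.continuous.memLp_of_hasCompactSupport hφ.compact).restrict _

/-- A test function as an element of `L²(]0,∞[)`. -/
noncomputable def IsTestFun.toL2 {φ : ℝ → ℂ} (hφ : IsTestFun φ) : L2 := hφ.memLp.toLp φ

theorem IsTestFun.coeFn_toL2 {φ : ℝ → ℂ} (hφ : IsTestFun φ) : hφ.toL2 =ᵐ[halfLine] φ :=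
  hφ.memLp.coeFn_toLp

theorem integrable_mul (f g : L2) : Integrable (fun x => f x * g x) halfLine :=
  (Lp.memLp f).integrable_mul (Lp.memLp g)

theorem IsTestFun.integrable_mul {φ : ℝ → ℂ} (hφ : IsTestFun φ) (f : L2) :
    Integrable (fun x => f x * φ x) halfLine :=
  (Lp.memLp f).integrable_mul hφ.memLp

theorem IsTestFun.integral_mul_eq_inner {φ : ℝ → ℂ} (hφ : IsTestFun φ) (f : L2) :
    ∫ x, f x * φ x ∂halfLine = inner ℂ hφ.conj.toL2 f := by
  rw [MeasureTheory.L2.inner_def]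
  refine integral_congr_ae ?_
  filter_upwards [hφ.conj.coeFn_toL2] with x hx
  simp [hx]

theorem IsTestFun.continuous_integral_mul {φ : ℝ → ℂ} (hφ : IsTestFun φ) :
    Continuous fun f : L2 => ∫ x, f x * φ x ∂halfLine := by
  simp only [hφ.integral_mul_eq_inner]
  fun_prop

/-- An `L²` function that is orthogonal to all test functions vanishes. -/
theorem eq_zero_of_forall_test (f : L2)
    (h : ∀ φ, IsTestFun φ → ∫ x, f x * φ x ∂halfLine = 0) : f = 0 := by
  have hloc : LocallyIntegrableOn (f : ℝ → ℂ) (Ioi 0) halfLine :=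
    ((Lp.memLp f).locallyIntegrable (by norm_num)).locallyIntegrableOn _
  have h1 := isOpen_Ioi.ae_eq_zero_of_integral_contDiff_smul_eq_zero hloc (fun g hg hc hs => by
    have hg' : IsTestFun (fun x => (g x : ℂ)) := by
      refine ⟨Complex.ofRealCLM.contDiff.comp hg,
        hc.comp_left (g := fun r : ℝ => (r : ℂ)) Complex.ofReal_zero, ?_⟩
      exact (tsupport_comp_subset (g := fun r : ℝ => (r : ℂ)) Complex.ofReal_zero g).trans hs
    rw [← h _ hg']
    refine integral_congr_ae (Eventually.of_forall fun x => ?_)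
    simp [mul_comm])
  rw [Lp.eq_zero_iff_ae_eq_zero]
  filter_upwards [h1, ae_restrict_mem measurableSet_Ioi] with x hx hx0
  exact hx hx0

/-! ### Maximal and minimal operators -/

/-- The graph of the maximal operator: pairs `(f, g)` in `L² × L²` such that `L_{β,α} f = g` in the
sense of distributions on `]0,∞[`. -/
noncomputable def maxGraph (β α : ℂ) : Submodule ℂ (L2 × L2) where
  carrier := {p | ∀ φ, IsTestFun φ →
    ∫ x, p.1 x * formalOp β α φ x ∂halfLine = ∫ x, p.2 x * φ x ∂halfLine}
  zero_mem' := by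
    intro φ hφ
    rw [(hφ.formalOp β α).integral_mul_eq_inner, hφ.integral_mul_eq_inner]
    simp
  add_mem' := by
    intro p q hp hq φ hφ
    have hp := hp φ hφ
    have hq := hq φ hφ
    rw [(hφ.formalOp β α).integral_mul_eq_inner, hφ.integral_mul_eq_inner] at *
    simp [inner_add_right, hp, hq]
  smul_mem' := by
    intro c p hp φ hφ
    have hp := hp φ hφ
    rw [(hφ.formalOp β α).integral_mul_eq_inner, hφ.integral_mul_eq_inner] at *
    simp [inner_smul_right, hp]

theorem maxGraph_isGraph (β α : ℂ) (p : L2 × L2) (hp : p ∈ maxGraph β α) (h0 : p.1 = 0) :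
    p.2 = 0 := by
  refine eq_zero_of_forall_test _ fun φ hφ => ?_
  rw [← hp φ hφ, (hφ.formalOp β α).integral_mul_eq_inner, h0, inner_zero_right]

theorem isClosed_maxGraph (β α : ℂ) : IsClosed (maxGraph β α : Set (L2 × L2)) := by
  have : (maxGraph β α : Set (L2 × L2)) = ⋂ (φ : ℝ → ℂ) (_ : IsTestFun φ),
      {p : L2 × L2 | ∫ x, p.1 x * formalOp β α φ x ∂halfLine = ∫ x, p.2 x * φ x ∂halfLine} := by
    ext p
    simp [maxGraph]
  rw [this]
  refine isClosed_iInter fun φ => isClosed_iInter fun hφ => isClosed_eq ?_ ?_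
  · exact (hφ.formalOp β α).continuous_integral_mul.comp continuous_fst
  · exact hφ.continuous_integral_mul.comp continuous_snd

/-- The graph of the restriction of `L_{β,α}` to `C_c^∞(]0,∞[)`. -/
noncomputable def testGraph (β α : ℂ) : Submodule ℂ (L2 × L2) where
  carrier := {p | ∃ φ, IsTestFun φ ∧ p.1 =ᵐ[halfLine] φ ∧ p.2 =ᵐ[halfLine] formalOp β α φ}
  zero_mem' := by
    refine ⟨fun _ => 0, IsTestFun.zero, Lp.coeFn_zero _ _ _, ?_⟩
    filter_upwards [Lp.coeFn_zero ℂ 2 halfLine] with x hx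
    rw [formalOp_zero]
    exact hx
  add_mem' := by
    rintro p q ⟨φ, hφ, h1, h2⟩ ⟨ψ, hψ, h3, h4⟩
    refine ⟨fun x => φ x + ψ x, hφ.add hψ, ?_, ?_⟩
    · filter_upwards [Lp.coeFn_add p.1 q.1, h1, h3] with x hx hx1 hx3
      rw [Prod.fst_add, hx, Pi.add_apply, hx1, hx3]
    · filter_upwards [Lp.coeFn_add p.2 q.2, h2, h4] with x hx hx1 hx3
      rw [Prod.snd_add, hx, Pi.add_apply, hx1, hx3, formalOp_add hφ hψ]
  smul_mem' := by
    rintro c p ⟨φ, hφ, h1, h2⟩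
    refine ⟨fun x => c * φ x, hφ.const_mul c, ?_, ?_⟩
    · filter_upwards [Lp.coeFn_smul c p.1, h1] with x hx hx1
      rw [Prod.smul_fst, hx, Pi.smul_apply, hx1, smul_eq_mul]
    · filter_upwards [Lp.coeFn_smul c p.2, h2] with x hx hx1
      rw [Prod.smul_snd, hx, Pi.smul_apply, hx1, smul_eq_mul, formalOp_const_mul]

theorem testGraph_le_maxGraph (β α : ℂ) : testGraph β α ≤ maxGraph β α := by
  rintro p ⟨φ, hφ, h1, h2⟩ ψ hψ
  have e1 : ∫ x, p.1 x * formalOp β α ψ x ∂halfLine = ∫ x, φ x * formalOp β α ψ x ∂halfLine :=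
    integral_congr_ae (by filter_upwards [h1] with x hx; rw [hx])
  have e2 : ∫ x, p.2 x * ψ x ∂halfLine = ∫ x, formalOp β α φ x * ψ x ∂halfLine :=
    integral_congr_ae (by filter_upwards [h2] with x hx; rw [hx])
  rw [e1, e2, ← sub_eq_zero, ← integral_sub]
  · have hw : IsTestFun (fun x => deriv φ x * ψ x + -1 * (φ x * deriv ψ x)) :=
      (hφ.deriv.mul hψ).add ((hφ.mul hψ.deriv).const_mul (-1))
    rw [← hw.integral_deriv]
    refine integral_congr_ae (Eventually.of_forall fun x => ?_)
    have hd := ((hφ.deriv.hasDerivAt x).mul (hψ.hasDerivAt x)).add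
      (((hφ.hasDerivAt x).mul (hψ.deriv.hasDerivAt x)).const_mul (-1))
    have hd' := hd.deriv
    simp only [formalOp]
    refine Eq.trans ?_ hd'.symm
    ring
  · exact (hφ.mul (hψ.formalOp β α)).integrable.restrict
  · exact ((hφ.formalOp β α).mul hψ).integrable.restrict

theorem testGraph_isGraph (β α : ℂ) (p : L2 × L2) (hp : p ∈ testGraph β α) (h0 : p.1 = 0) :
    p.2 = 0 :=
  maxGraph_isGraph β α p (testGraph_le_maxGraph β α hp) h0

/-- The maximal operator, with domain `{f ∈ L² | L_{β,α} f ∈ L²}`. -/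
noncomputable def Lmax (β α : ℂ) : L2 →ₗ.[ℂ] L2 := (maxGraph β α).toLinearPMap

/-- The restriction of `L_{β,α}` to `C_c^∞(]0,∞[)`. -/
noncomputable def Ltest (β α : ℂ) : L2 →ₗ.[ℂ] L2 := (testGraph β α).toLinearPMap

/-- The minimal operator: the closure of the restriction of `L_{β,α}` to `C_c^∞(]0,∞[)`. -/
noncomputable def Lmin (β α : ℂ) : L2 →ₗ.[ℂ] L2 := (Ltest β α).closure

theorem graph_Lmax (β α : ℂ) : (Lmax β α).graph = maxGraph β α :=
  Submodule.toLinearPMap_graph_eq _ (maxGraph_isGraph β α)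

theorem graph_Ltest (β α : ℂ) : (Ltest β α).graph = testGraph β α :=
  Submodule.toLinearPMap_graph_eq _ (testGraph_isGraph β α)

theorem Ltest_isClosable (β α : ℂ) : (Ltest β α).IsClosable := by
  rw [LinearPMap.isClosable_iff_exists_closed_extension]
  refine ⟨Lmax β α, ?_, LinearPMap.le_of_le_graph ?_⟩
  · rw [LinearPMap.IsClosed, graph_Lmax]
    exact isClosed_maxGraph β α
  · rw [graph_Lmax, graph_Ltest]
    exact testGraph_le_maxGraph β α

theorem graph_Lmin (β α : ℂ) : (Lmin β α).graph = (testGraph β α).topologicalClosure := by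
  rw [Lmin, ← (Ltest_isClosable β α).graph_closure_eq_closure_graph, graph_Ltest]

/-! ### Cutoffs near zero -/

/-- A cutoff: the restriction to `[0,∞[` is in `C_c^∞([0,∞[)` and equals `1` near `0`. -/
structure IsCutoff (ζ : ℝ → ℂ) : Prop where
  smooth : ContDiff ℝ ∞ ζ
  compact : HasCompactSupport ζ
  eq_one : ∀ᶠ x in 𝓝[≥] (0 : ℝ), ζ x = 1

theorem IsCutoff.mul {ζ η : ℝ → ℂ} (hζ : IsCutoff ζ) (hη : IsCutoff η) :
    IsCutoff (fun x => ζ x * η x) := by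
  refine ⟨hζ.smooth.mul hη.smooth, hζ.compact.mul_right, ?_⟩
  filter_upwards [hζ.eq_one, hη.eq_one] with x h1 h2
  simp [h1, h2]

/-- The derivative of a cutoff, restricted to the half-line, is a test function. -/
theorem IsCutoff.exists_deriv {ζ : ℝ → ℂ} (hζ : IsCutoff ζ) :
    ∃ χ, IsTestFun χ ∧ ∀ x, 0 < x → deriv ζ x = χ x := by
  obtain ⟨ε, hε, hone⟩ := mem_nhdsGE_iff_exists_Ico_subset.mp hζ.eq_one
  have hε : 0 < ε := hε
  classical
  set χ : ℝ → ℂ := fun x => if 0 < x then deriv ζ x else 0 with hχ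
  have hzero : ∀ x, x < ε → χ x = 0 := by
    intro x hx
    by_cases h0 : 0 < x
    · have he : ζ =ᶠ[𝓝 x] fun _ => 1 := by
        filter_upwards [Ioo_mem_nhds h0 hx] with y hy
        exact hone ⟨hy.1.le, hy.2⟩
      simp [hχ, h0, he.deriv_eq]
    · simp [hχ, h0]
  have hsub : tsupport χ ⊆ Ici ε := by
    refine closure_minimal ?_ isClosed_Ici
    intro x hx
    by_contra hlt
    exact hx (hzero x (not_le.mp hlt))
  refine ⟨χ, ⟨?_, ?_, hsub.trans fun x hx => lt_of_lt_of_le hε hx⟩, fun x hx => by simp [hχ, hx]⟩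
  · rw [contDiff_iff_contDiffAt]
    intro x
    rcases lt_or_ge x ε with hx | hx
    · refine (contDiffAt_const (c := (0 : ℂ))).congr_of_eventuallyEq ?_
      filter_upwards [Iio_mem_nhds hx] with y hy
      exact hzero y hy
    · refine (contDiff_deriv hζ.smooth).contDiffAt.congr_of_eventuallyEq ?_
      filter_upwards [Ioi_mem_nhds (lt_of_lt_of_le hε hx)] with y hy
      simp only [hχ]
      exact if_pos hy
  · refine hζ.compact.deriv.mono fun x hx => ?_
    simp only [Function.mem_support, hχ] at hx ⊢
    intro h
    simp [h] at hx

theorem IsTestFun.exists_bound {φ : ℝ → ℂ} (hφ : IsTestFun φ) : ∃ C, 0 ≤ C ∧ ∀ x, ‖φ x‖ ≤ C := by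
  obtain ⟨C, hC⟩ := hφ.compact.exists_bound_of_continuous hφ.smooth.continuous
  exact ⟨C, (norm_nonneg _).trans (hC 0), hC⟩

theorem IsTestFun.integrable_sq {φ : ℝ → ℂ} (hφ : IsTestFun φ) :
    Integrable (fun x => ‖φ x‖ ^ 2) halfLine :=
  (memLp_two_iff_integrable_sq_norm hφ.memLp.1).mp hφ.memLp

theorem norm_sq_eq_integral (f : L2) : ‖f‖ ^ 2 = ∫ x, ‖f x‖ ^ 2 ∂halfLine := by
  rw [@norm_sq_eq_re_inner ℂ, MeasureTheory.L2.inner_def, ← integral_re]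
  · refine integral_congr_ae (Eventually.of_forall fun x => ?_)
    simp only
    rw [inner_self_eq_norm_sq]
  · exact MeasureTheory.L2.integrable_inner f f

/-- Interior estimate for the first derivative. -/
theorem deriv_estimate (β α : ℂ) {χ : ℝ → ℂ} (hχ : IsTestFun χ) :
    ∃ K, 0 ≤ K ∧ ∀ φ, IsTestFun φ →
      ∫ x, ‖χ x * deriv φ x‖ ^ 2 ∂halfLine ≤
        K * ∫ x, (‖φ x‖ ^ 2 + ‖formalOp β α φ x‖ ^ 2) ∂halfLine := by
  have hw : IsTestFun (fun x => χ x * conj (χ x)) := hχ.mul hχ.conj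
  have hwV := hw.mul_contDiffOn (contDiffOn_potential β α)
  obtain ⟨M1, hM1, hb1⟩ := hχ.deriv.exists_bound
  obtain ⟨M2, hM2, hb2⟩ := hwV.exists_bound
  obtain ⟨M3, hM3, hb3⟩ := hw.exists_bound
  refine ⟨4 * M1 ^ 2 + 2 * M2 + M3, by positivity, fun φ hφ => ?_⟩
  set w : ℝ → ℂ := fun x => χ x * conj (χ x) with hwdef
  set V : ℝ → ℂ := fun x => (α - 1 / 4) / (x : ℂ) ^ 2 - β / (x : ℂ) with hV
  have hG : IsTestFun (fun x => w x * (deriv φ x * conj (φ x))) := hw.mul (hφ.deriv.mul hφ.conj)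
  have hGint : ∫ x, (deriv (fun x => w x * (deriv φ x * conj (φ x))) x).re ∂halfLine = 0 := by
    have := integral_re (𝕜 := ℂ) (μ := halfLine) hG.deriv.integrable.restrict
    simp only [RCLike.re_to_complex] at this
    rw [this, hG.integral_deriv, Complex.zero_re]
  have hderivconj : ∀ (ψ : ℝ → ℂ), IsTestFun ψ → ∀ x,
      HasDerivAt (fun x => conj (ψ x)) (conj (deriv ψ x)) x := fun ψ hψ x =>
    (hψ.hasDerivAt x).star
  have hpt : ∀ x, ‖χ x * deriv φ x‖ ^ 2 ≤
      2 * (deriv (fun x => w x * (deriv φ x * conj (φ x))) x).re +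
        (4 * M1 ^ 2 + 2 * M2 + M3) * (‖φ x‖ ^ 2 + ‖formalOp β α φ x‖ ^ 2) := by
    intro x
    have hd := (((hχ.hasDerivAt x).mul (hderivconj χ hχ x)).mul
      ((hφ.deriv.hasDerivAt x).mul (hderivconj φ hφ x))).deriv
    have hd' : deriv (fun x => w x * (deriv φ x * conj (φ x))) x =
        (deriv χ x * conj (χ x) + χ x * conj (deriv χ x)) * (deriv φ x * conj (φ x)) +
        w x * (deriv (deriv φ) x * conj (φ x) + deriv φ x * conj (deriv φ x)) := hd
    have hsecond : deriv (deriv φ) x = V x * φ x - formalOp β α φ x := by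
      simp only [formalOp, hV]
      ring
    rw [hsecond] at hd'
    set A : ℂ := (deriv χ x * conj (χ x) + χ x * conj (deriv χ x)) * (deriv φ x * conj (φ x))
      with hA
    set B : ℂ := V x * w x * φ x * conj (φ x) with hB
    set D : ℂ := w x * formalOp β α φ x * conj (φ x) with hD
    have hF : w x * (deriv φ x * conj (deriv φ x)) = ((‖χ x * deriv φ x‖ ^ 2 : ℝ) : ℂ) := by
      rw [Complex.ofReal_pow, ← Complex.mul_conj']
      simp only [hwdef, map_mul]
      ring
    have hsum : deriv (fun x => w x * (deriv φ x * conj (φ x))) x =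
        A + B - D + ((‖χ x * deriv φ x‖ ^ 2 : ℝ) : ℂ) := by
      rw [hd', ← hF, hA, hB, hD]
      ring
    rw [hsum]
    simp only [Complex.add_re, Complex.sub_re, Complex.ofReal_re]
    have nA : ‖A‖ ≤ 2 * M1 * ‖φ x‖ * ‖χ x * deriv φ x‖ := by
      have h1 : ‖deriv χ x * conj (χ x) + χ x * conj (deriv χ x)‖ ≤ 2 * M1 * ‖χ x‖ := by
        refine (norm_add_le _ _).trans ?_
        simp only [norm_mul, RCLike.norm_conj]
        nlinarith [mul_le_mul_of_nonneg_right (hb1 x) (norm_nonneg (χ x))]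
      rw [hA, norm_mul]
      refine (mul_le_mul_of_nonneg_right h1 (norm_nonneg _)).trans (le_of_eq ?_)
      simp only [norm_mul, RCLike.norm_conj]
      ring
    have nB : ‖B‖ ≤ M2 * ‖φ x‖ ^ 2 := by
      have := mul_le_mul_of_nonneg_right (hb2 x) (sq_nonneg ‖φ x‖)
      refine le_trans (le_of_eq ?_) this
      rw [hB]
      simp only [norm_mul, RCLike.norm_conj, hV, hwdef]
      ring
    have nD : ‖D‖ ≤ M3 * (‖formalOp β α φ x‖ * ‖φ x‖) := by
      have := mul_le_mul_of_nonneg_right (hb3 x)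
        (mul_nonneg (norm_nonneg (formalOp β α φ x)) (norm_nonneg (φ x)))
      refine le_trans (le_of_eq ?_) this
      rw [hD]
      simp only [norm_mul, RCLike.norm_conj, hwdef]
      ring
    have rA := (abs_le.mp (Complex.abs_re_le_norm A)).1
    have rB := (abs_le.mp (Complex.abs_re_le_norm B)).1
    have rD := (abs_le.mp (Complex.abs_re_le_norm D)).2
    have q1 := two_mul_le_add_sq (2 * (M1 * ‖φ x‖)) ‖χ x * deriv φ x‖
    have q2 := mul_le_mul_of_nonneg_left (two_mul_le_add_sq ‖formalOp β α φ x‖ ‖φ x‖) hM3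
    have q3 : 0 ≤ (4 * M1 ^ 2 + 2 * M2) * ‖formalOp β α φ x‖ ^ 2 := by positivity
    nlinarith
  have hiR : Integrable (fun x => ‖φ x‖ ^ 2 + ‖formalOp β α φ x‖ ^ 2) halfLine :=
    hφ.integrable_sq.add (hφ.formalOp β α).integrable_sq
  have hiG : Integrable
      (fun x => (deriv (fun x => w x * (deriv φ x * conj (φ x))) x).re) halfLine :=
    hG.deriv.integrable.restrict.re
  calc ∫ x, ‖χ x * deriv φ x‖ ^ 2 ∂halfLine
      ≤ ∫ x, (2 * (deriv (fun x => w x * (deriv φ x * conj (φ x))) x).re +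
        (4 * M1 ^ 2 + 2 * M2 + M3) * (‖φ x‖ ^ 2 + ‖formalOp β α φ x‖ ^ 2)) ∂halfLine :=
        integral_mono (hχ.mul hφ.deriv).integrable_sq
          ((hiG.const_mul 2).add (hiR.const_mul _)) hpt
    _ = _ := by
        rw [integral_add (hiG.const_mul 2) (hiR.const_mul _), integral_const_mul,
          integral_const_mul, hGint]
        ring

theorem formalOp_cutoff_mul {ζ φ : ℝ → ℂ} (hζ : ContDiff ℝ ∞ ζ) (hφ : IsTestFun φ) (β α : ℂ)
    (x : ℝ) : formalOp β α (fun x => ζ x * φ x) x =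
      ζ x * formalOp β α φ x - 2 * (deriv ζ x * deriv φ x) - deriv (deriv ζ) x * φ x := by
  have hz : ∀ x, HasDerivAt ζ (deriv ζ x) x := fun x =>
    (hζ.differentiable (by simp)).differentiableAt.hasDerivAt
  have hz' : ∀ x, HasDerivAt (deriv ζ) (deriv (deriv ζ) x) x := fun x =>
    ((contDiff_deriv hζ).differentiable (by simp)).differentiableAt.hasDerivAt
  have h1 : deriv (fun x => ζ x * φ x) = fun x => deriv ζ x * φ x + ζ x * deriv φ x :=
    funext fun x => ((hz x).mul (hφ.hasDerivAt x)).deriv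
  have h2 : deriv (fun x => deriv ζ x * φ x + ζ x * deriv φ x) x =
      (deriv (deriv ζ) x * φ x + deriv ζ x * deriv φ x) +
        (deriv ζ x * deriv φ x + ζ x * deriv (deriv φ) x) :=
    (((hz' x).mul (hφ.hasDerivAt x)).add ((hz x).mul (hφ.deriv.hasDerivAt x))).deriv
  simp only [formalOp, h1, h2]
  ring

theorem cutoff_estimate (β α : ℂ) {ζ : ℝ → ℂ} (hζ : IsCutoff ζ) :
    ∃ C, 0 ≤ C ∧ ∀ φ (hφ : IsTestFun φ),
      ‖((hφ.mul_smooth hζ.smooth).formalOp β α).toL2‖ ≤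
        C * (‖hφ.toL2‖ + ‖(hφ.formalOp β α).toL2‖) := by
  obtain ⟨χ, hχ, hχζ⟩ := hζ.exists_deriv
  obtain ⟨K, hK, hest⟩ := deriv_estimate β α hχ
  obtain ⟨M, hM⟩ := hζ.compact.exists_bound_of_continuous hζ.smooth.continuous
  obtain ⟨N, hN⟩ := hζ.compact.deriv.deriv.exists_bound_of_continuous
    (contDiff_deriv (contDiff_deriv hζ.smooth)).continuous
  have hM0 : 0 ≤ M := (norm_nonneg _).trans (hM 0)
  have hN0 : 0 ≤ N := (norm_nonneg _).trans (hN 0)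
  refine ⟨M + N + 2 * Real.sqrt K, by positivity, fun φ hφ => ?_⟩
  have hX := hχ.mul hφ.deriv
  have hXn : ‖hX.toL2‖ ≤ Real.sqrt K * (‖hφ.toL2‖ + ‖(hφ.formalOp β α).toL2‖) := by
    have hsq : ∀ {ψ : ℝ → ℂ} (hψ : IsTestFun ψ),
        ‖hψ.toL2‖ ^ 2 = ∫ x, ‖ψ x‖ ^ 2 ∂halfLine := fun hψ => by
      rw [norm_sq_eq_integral]
      refine integral_congr_ae ?_
      filter_upwards [hψ.coeFn_toL2] with x hx
      rw [hx]
    have h := hest φ hφ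
    rw [integral_add hφ.integrable_sq (hφ.formalOp β α).integrable_sq, ← hsq hX, ← hsq hφ,
      ← hsq (hφ.formalOp β α)] at h
    refine le_of_sq_le_sq ?_ (by positivity)
    rw [mul_pow, Real.sq_sqrt hK]
    refine h.trans (mul_le_mul_of_nonneg_left ?_ hK)
    nlinarith [norm_nonneg hφ.toL2, norm_nonneg (hφ.formalOp β α).toL2]
  have hz : IsTestFun (fun x => ζ x * formalOp β α φ x) :=
    (hφ.formalOp β α).mul_smooth hζ.smooth
  have hz2 : IsTestFun (fun x => deriv (deriv ζ) x * φ x) :=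
    hφ.mul_smooth (contDiff_deriv (contDiff_deriv hζ.smooth))
  have hdec : ((hφ.mul_smooth hζ.smooth).formalOp β α).toL2 =
      hz.toL2 - (2 : ℂ) • hX.toL2 - hz2.toL2 := by
    refine Lp.ext ?_
    filter_upwards [((hφ.mul_smooth hζ.smooth).formalOp β α).coeFn_toL2, hz.coeFn_toL2,
      hX.coeFn_toL2, hz2.coeFn_toL2, Lp.coeFn_sub (hz.toL2 - (2 : ℂ) • hX.toL2) hz2.toL2,
      Lp.coeFn_sub hz.toL2 ((2 : ℂ) • hX.toL2), Lp.coeFn_smul (2 : ℂ) hX.toL2,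
      ae_restrict_mem measurableSet_Ioi] with x h1 h2 h3 h4 h5 h6 h7 h8
    rw [h1, h5, Pi.sub_apply, h6, Pi.sub_apply, h7, Pi.smul_apply, h2, h3, h4,
      formalOp_cutoff_mul hζ.smooth hφ, hχζ x h8, smul_eq_mul]
  have b1 : ‖hz.toL2‖ ≤ M * ‖(hφ.formalOp β α).toL2‖ := by
    refine Lp.norm_le_mul_norm_of_ae_le_mul ?_
    filter_upwards [hz.coeFn_toL2, (hφ.formalOp β α).coeFn_toL2] with x h1 h2
    rw [h1, h2, norm_mul]
    exact mul_le_mul_of_nonneg_right (hM x) (norm_nonneg _)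
  have b2 : ‖hz2.toL2‖ ≤ N * ‖hφ.toL2‖ := by
    refine Lp.norm_le_mul_norm_of_ae_le_mul ?_
    filter_upwards [hz2.coeFn_toL2, hφ.coeFn_toL2] with x h1 h2
    rw [h1, h2, norm_mul]
    exact mul_le_mul_of_nonneg_right (hN x) (norm_nonneg _)
  rw [hdec]
  have t1 := norm_sub_le (hz.toL2 - (2 : ℂ) • hX.toL2) hz2.toL2
  have t2 := norm_sub_le hz.toL2 ((2 : ℂ) • hX.toL2)
  have t3 : ‖(2 : ℂ) • hX.toL2‖ = 2 * ‖hX.toL2‖ := by rw [norm_smul]; norm_num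
  nlinarith [mul_nonneg hM0 (norm_nonneg hφ.toL2),
    mul_nonneg hN0 (norm_nonneg (hφ.formalOp β α).toL2)]

theorem IsCutoff.memLp_mul {ζ : ℝ → ℂ} (hζ : IsCutoff ζ) (f : L2) :
    MemLp (fun x => ζ x * f x) 2 halfLine := by
  obtain ⟨M, hM⟩ := hζ.compact.exists_bound_of_continuous hζ.smooth.continuous
  refine (Lp.memLp f).of_le_mul (c := M)
    (hζ.smooth.continuous.aestronglyMeasurable.mul (Lp.aestronglyMeasurable f))
    (Eventually.of_forall fun x => ?_)
  rw [norm_mul]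
  exact mul_le_mul_of_nonneg_right (hM x) (norm_nonneg _)

/-- The domain of the minimal operator is stable under multiplication by cutoffs. -/
theorem IsCutoff.mul_mem_Lmin {ζ : ℝ → ℂ} (hζ : IsCutoff ζ) {β α : ℂ} {f : L2}
    (hf : f ∈ (Lmin β α).domain) :
    ∃ h ∈ (Lmin β α).domain, h =ᵐ[halfLine] fun x => ζ x * f x := by
  obtain ⟨g, hg⟩ := LinearPMap.mem_domain_iff.mp hf
  rw [graph_Lmin, ← SetLike.mem_coe, Submodule.topologicalClosure_coe,
    mem_closure_iff_seq_limit] at hg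
  obtain ⟨p, hp, hlim⟩ := hg
  choose φ hφ hp1 hp2 using hp
  have e1 : ∀ n, (p n).1 = (hφ n).toL2 := fun n =>
    Lp.ext ((hp1 n).trans (hφ n).coeFn_toL2.symm)
  have e2 : ∀ n, (p n).2 = ((hφ n).formalOp β α).toL2 := fun n =>
    Lp.ext ((hp2 n).trans ((hφ n).formalOp β α).coeFn_toL2.symm)
  have hl1 : Tendsto (fun n => (hφ n).toL2) atTop (𝓝 f) := by
    simp only [← e1]
    exact (continuous_fst.tendsto _).comp hlim
  have hl2 : Tendsto (fun n => ((hφ n).formalOp β α).toL2) atTop (𝓝 g) := by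
    simp only [← e2]
    exact (continuous_snd.tendsto _).comp hlim
  obtain ⟨M, hM⟩ := hζ.compact.exists_bound_of_continuous hζ.smooth.continuous
  obtain ⟨C, hC0, hC⟩ := cutoff_estimate β α hζ
  set F : L2 := (hζ.memLp_mul f).toLp _ with hF
  have hFc : F =ᵐ[halfLine] fun x => ζ x * f x := (hζ.memLp_mul f).coeFn_toLp
  set q : ℕ → L2 := fun n => ((hφ n).mul_smooth hζ.smooth).toL2 with hq
  set r : ℕ → L2 := fun n => (((hφ n).mul_smooth hζ.smooth).formalOp β α).toL2 with hr
  have hq1 : Tendsto q atTop (𝓝 F) := by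
    rw [tendsto_iff_norm_sub_tendsto_zero] at hl1 ⊢
    refine squeeze_zero (fun n => norm_nonneg _) (fun n => ?_)
      (by simpa using hl1.const_mul M)
    refine Lp.norm_le_mul_norm_of_ae_le_mul ?_
    filter_upwards [hFc, ((hφ n).mul_smooth hζ.smooth).coeFn_toL2, (hφ n).coeFn_toL2,
      Lp.coeFn_sub (q n) F, Lp.coeFn_sub (hφ n).toL2 f] with x h1 h2 h3 h4 h5
    rw [h4, h5, Pi.sub_apply, Pi.sub_apply, h1, h3]
    simp only [hq]
    rw [h2, ← mul_sub, norm_mul]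
    exact mul_le_mul_of_nonneg_right (hM x) (norm_nonneg _)
  have hdiff : ∀ n k, ‖r n - r k‖ ≤ C * (‖(hφ n).toL2 - (hφ k).toL2‖ +
      ‖((hφ n).formalOp β α).toL2 - ((hφ k).formalOp β α).toL2‖) := by
    intro n k
    have hd : IsTestFun (fun x => φ n x + -1 * φ k x) := (hφ n).add ((hφ k).const_mul (-1))
    have hop : ∀ {ψ η : ℝ → ℂ}, IsTestFun ψ → IsTestFun η → ∀ x,
        formalOp β α (fun x => ψ x + -1 * η x) x = formalOp β α ψ x - formalOp β α η x := by
      intro ψ η hψ hη x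
      rw [formalOp_add hψ (hη.const_mul (-1)), formalOp_const_mul]
      ring
    have d1 : hd.toL2 = (hφ n).toL2 - (hφ k).toL2 := by
      refine Lp.ext ?_
      filter_upwards [hd.coeFn_toL2, (hφ n).coeFn_toL2, (hφ k).coeFn_toL2,
        Lp.coeFn_sub (hφ n).toL2 (hφ k).toL2] with x h1 h2 h3 h4
      rw [h1, h4, Pi.sub_apply, h2, h3]
      ring
    have d2 : (hd.formalOp β α).toL2 =
        ((hφ n).formalOp β α).toL2 - ((hφ k).formalOp β α).toL2 := by
      refine Lp.ext ?_
      filter_upwards [(hd.formalOp β α).coeFn_toL2, ((hφ n).formalOp β α).coeFn_toL2,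
        ((hφ k).formalOp β α).coeFn_toL2,
        Lp.coeFn_sub ((hφ n).formalOp β α).toL2 ((hφ k).formalOp β α).toL2] with x h1 h2 h3 h4
      rw [h1, h4, Pi.sub_apply, h2, h3, hop (hφ n) (hφ k)]
    have d3 : ((hd.mul_smooth hζ.smooth).formalOp β α).toL2 = r n - r k := by
      refine Lp.ext ?_
      filter_upwards [((hd.mul_smooth hζ.smooth).formalOp β α).coeFn_toL2,
        (((hφ n).mul_smooth hζ.smooth).formalOp β α).coeFn_toL2,
        (((hφ k).mul_smooth hζ.smooth).formalOp β α).coeFn_toL2,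
        Lp.coeFn_sub (r n) (r k)] with x h1 h2 h3 h4
      rw [h1, h4, Pi.sub_apply]
      simp only [hr]
      rw [h2, h3, ← hop ((hφ n).mul_smooth hζ.smooth) ((hφ k).mul_smooth hζ.smooth)]
      congr 1
      funext y
      ring
    have := hC _ hd
    rwa [d1, d2, d3] at this
  have hcauchy : CauchySeq r := by
    rw [Metric.cauchySeq_iff]
    intro ε hε
    obtain ⟨N1, hN1⟩ := Metric.cauchySeq_iff.mp hl1.cauchySeq (ε / (2 * (C + 1))) (by positivity)
    obtain ⟨N2, hN2⟩ := Metric.cauchySeq_iff.mp hl2.cauchySeq (ε / (2 * (C + 1))) (by positivity)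
    refine ⟨max N1 N2, fun n hn k hk => ?_⟩
    have a1 := hN1 n (le_of_max_le_left hn) k (le_of_max_le_left hk)
    have a2 := hN2 n (le_of_max_le_right hn) k (le_of_max_le_right hk)
    rw [dist_eq_norm] at a1 a2 ⊢
    have hsum : ‖(hφ n).toL2 - (hφ k).toL2‖ +
        ‖((hφ n).formalOp β α).toL2 - ((hφ k).formalOp β α).toL2‖ < ε / (C + 1) := by
      have : ε / (2 * (C + 1)) + ε / (2 * (C + 1)) = ε / (C + 1) := by
        field_simp
        ring
      linarith
    have hlast : (C + 1) * (ε / (C + 1)) = ε := by field_simp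
    have hnn : 0 ≤ ‖(hφ n).toL2 - (hφ k).toL2‖ +
        ‖((hφ n).formalOp β α).toL2 - ((hφ k).formalOp β α).toL2‖ := by positivity
    nlinarith [hdiff n k]
  obtain ⟨G, hG⟩ := cauchySeq_tendsto_of_complete hcauchy
  refine ⟨F, LinearPMap.mem_domain_iff.mpr ⟨G, ?_⟩, hFc⟩
  rw [graph_Lmin, ← SetLike.mem_coe, Submodule.topologicalClosure_coe,
    mem_closure_iff_seq_limit]
  refine ⟨fun n => (q n, r n), fun n => ⟨_, (hφ n).mul_smooth hζ.smooth, ?_, ?_⟩,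
    hq1.prodMk_nhds hG⟩
  · exact ((hφ n).mul_smooth hζ.smooth).coeFn_toL2
  · exact (((hφ n).mul_smooth hζ.smooth).formalOp β α).coeFn_toL2

/-- `f ∈ D(L_{β,α}^min)` around `0`: some cutoff `ζ` satisfies `f ζ ∈ D(L_{β,α}^min)`. -/
def MemLminNearZero (β α : ℂ) (f : ℝ → ℂ) : Prop :=
  ∃ ζ, IsCutoff ζ ∧ ∃ h ∈ (Lmin β α).domain, h =ᵐ[halfLine] fun x => ζ x * f x

theorem MemLminNearZero.add {β α : ℂ} {f g : ℝ → ℂ} (hf : MemLminNearZero β α f)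
    (hg : MemLminNearZero β α g) : MemLminNearZero β α (fun x => f x + g x) := by
  obtain ⟨ζ, hζ, u, hu, hu'⟩ := hf
  obtain ⟨η, hη, v, hv, hv'⟩ := hg
  obtain ⟨u1, hu1, hu1'⟩ := hη.mul_mem_Lmin hu
  obtain ⟨v1, hv1, hv1'⟩ := hζ.mul_mem_Lmin hv
  refine ⟨_, hζ.mul hη, u1 + v1, Submodule.add_mem _ hu1 hv1, ?_⟩
  filter_upwards [hu', hv', hu1', hv1', Lp.coeFn_add u1 v1] with x h1 h2 h3 h4 h5
  rw [h5, Pi.add_apply, h3, h4, h1, h2]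
  ring

theorem MemLminNearZero.const_mul {β α : ℂ} {f : ℝ → ℂ} (hf : MemLminNearZero β α f) (c : ℂ) :
    MemLminNearZero β α (fun x => c * f x) := by
  obtain ⟨ζ, hζ, u, hu, hu'⟩ := hf
  refine ⟨ζ, hζ, c • u, Submodule.smul_mem _ c hu, ?_⟩
  filter_upwards [hu', Lp.coeFn_smul c u] with x h1 h2
  rw [h2, Pi.smul_apply, h1, smul_eq_mul]
  ring

theorem MemLminNearZero.congr {β α : ℂ} {f g : ℝ → ℂ} (hf : MemLminNearZero β α f)
    (hfg : f =ᵐ[halfLine] g) : MemLminNearZero β α g := by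
  obtain ⟨ζ, hζ, u, hu, hu'⟩ := hf
  refine ⟨ζ, hζ, u, hu, ?_⟩
  filter_upwards [hu', hfg] with x h1 h2
  rw [h1, h2]

theorem exists_cutoff : ∃ ζ, IsCutoff ζ := by
  obtain ⟨f, hf⟩ : ∃ f : ContDiffBump (0 : ℝ), f.rIn = 1 := ⟨⟨1, 2, by norm_num, by norm_num⟩, rfl⟩
  refine ⟨fun x => (f x : ℂ), Complex.ofRealCLM.contDiff.comp f.contDiff,
    f.hasCompactSupport.comp_left (g := fun r : ℝ => (r : ℂ)) Complex.ofReal_zero, ?_⟩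
  filter_upwards [nhdsWithin_le_nhds f.eventuallyEq_one] with x hx
  simp [hx]

/-! ### The operators `H_{β,m}` -/

/-- The boundary behaviour `x^{1/2+m} (1 - β x / (1+2m))`. For `β = 0` the quotient `β / (1+2m)`
is `0`, also when `m = -1/2`. -/
noncomputable def boundaryFun (β m : ℂ) (x : ℝ) : ℂ :=
  (x : ℂ) ^ (1 / 2 + m) * (1 - β / (1 + 2 * m) * (x : ℂ))

/-- The `f ∈ D(L_{β,m²}^max)` such that, for some `c`, the function `f - c x^{1/2+m}(1 - βx/(1+2m))`
is in `D(L_{β,m²}^min)` around `0`. -/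
noncomputable def boundaryDomain (β m : ℂ) : Submodule ℂ L2 where
  carrier := {f | f ∈ (Lmax β (m ^ 2)).domain ∧
    ∃ c : ℂ, MemLminNearZero β (m ^ 2) (fun x => f x - c * boundaryFun β m x)}
  zero_mem' := by
    obtain ⟨ζ, hζ⟩ := exists_cutoff
    refine ⟨Submodule.zero_mem _, 0, ζ, hζ, 0, Submodule.zero_mem _, ?_⟩
    filter_upwards [Lp.coeFn_zero ℂ 2 halfLine] with x hx
    have h0 : (0 : L2) x = 0 := hx
    simp only [h0, zero_mul, sub_zero, mul_zero]
  add_mem' := by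
    rintro f g ⟨hf, c, hc⟩ ⟨hg, d, hd⟩
    refine ⟨Submodule.add_mem _ hf hg, c + d, (hc.add hd).congr ?_⟩
    filter_upwards [Lp.coeFn_add f g] with x hx
    rw [hx, Pi.add_apply]
    ring
  smul_mem' := by
    rintro a f ⟨hf, c, hc⟩
    refine ⟨Submodule.smul_mem _ a hf, a * c, (hc.const_mul a).congr ?_⟩
    filter_upwards [Lp.coeFn_smul a f] with x hx
    rw [hx, Pi.smul_apply, smul_eq_mul]
    ring

/-- The restriction of `L_{β,m²}^max` to `boundaryDomain β m`. -/
noncomputable def Hreg (β m : ℂ) : L2 →ₗ.[ℂ] L2 :=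
  (Lmax β (m ^ 2)).domRestrict (boundaryDomain β m)

open Classical in
/-- The Whittaker operator `H_{β,m}`, `Re m > -1`; in the exceptional case `m = -1/2`, `β ≠ 0` it is
`H_{β,1/2}` by definition. -/
noncomputable def H (β m : ℂ) : L2 →ₗ.[ℂ] L2 :=
  if m = -1 / 2 ∧ β ≠ 0 then Hreg β (1 / 2) else Hreg β m

/-! ### Transposes -/

/-- The bilinear form `⟨f|g⟩ = ∫ f g`. -/
noncomputable def bilin (f g : L2) : ℂ := ∫ x, f x * g x ∂halfLine

theorem bilin_eq_inner (f g : L2) : bilin f g = inner ℂ (star g) f := by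
  rw [MeasureTheory.L2.inner_def]
  refine integral_congr_ae ?_
  filter_upwards [Lp.coeFn_star g] with x hx
  simp [hx]

/-- The graph of the transpose: pairs `(f, g)` with `⟨f|A h⟩ = ⟨g|h⟩` for all `h ∈ D(A)`. -/
noncomputable def transposeGraph (A : L2 →ₗ.[ℂ] L2) : Submodule ℂ (L2 × L2) where
  carrier := {p | ∀ h : A.domain, bilin p.1 (A h) = bilin p.2 (h : L2)}
  zero_mem' := by
    intro h
    simp [bilin_eq_inner]
  add_mem' := by
    intro p q hp hq h
    have hp := hp h
    have hq := hq h
    simp only [bilin_eq_inner, Prod.fst_add, Prod.snd_add, inner_add_right] at *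
    rw [hp, hq]
  smul_mem' := by
    intro c p hp h
    have hp := hp h
    simp only [bilin_eq_inner, Prod.smul_fst, Prod.smul_snd, inner_smul_right] at *
    rw [hp]

theorem transposeGraph_isGraph {A : L2 →ₗ.[ℂ] L2} (hA : Dense (A.domain : Set L2)) (p : L2 × L2)
    (hp : p ∈ transposeGraph A) (h0 : p.1 = 0) : p.2 = 0 := by
  have hcomm : ∀ f g : L2, bilin f g = bilin g f := fun f g => by simp only [bilin, mul_comm]
  have h1 : star p.2 = 0 := by
    refine hA.eq_zero_of_inner_left (𝕜 := ℂ) fun h hh => ?_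
    have := hp ⟨h, hh⟩
    rw [h0, hcomm p.2, bilin_eq_inner, inner_zero_right, bilin_eq_inner] at this
    exact this.symm
  rw [Lp.eq_zero_iff_ae_eq_zero] at h1 ⊢
  filter_upwards [h1, Lp.coeFn_star p.2] with x hx hx'
  rw [hx'] at hx
  simpa using hx

/-- The transpose `A^#` of a densely defined operator. -/
noncomputable def transpose (A : L2 →ₗ.[ℂ] L2) : L2 →ₗ.[ℂ] L2 :=
  (transposeGraph A).toLinearPMap

theorem graph_transpose {A : L2 →ₗ.[ℂ] L2} (hA : Dense (A.domain : Set L2)) :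
    (transpose A).graph = transposeGraph A :=
  Submodule.toLinearPMap_graph_eq _ (transposeGraph_isGraph hA)

end Whittaker

/-!
For `p = (f, L f)` and `q = (h, L h)` in the graph of the maximal operator let
`bform p q = ∫ (L f) h - f (L h)`. This antisymmetric form controls everything.

* Elements of the maximal domain have continuously differentiable representatives with locally
  absolutely continuous derivative (`exists_isRep`), so Lagrange's identity holds. The Wronskian
  `f h' - f' h` vanishes at infinity, and hence its limit at `0` exists and equals `-bform p q`
  (`IsRep.tendsto_wronskian`).
* The Wronskian is a determinant in `ℂ²`; the Plücker relation for determinants passes to the limit,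
  so the form has rank at most two (`bform_pluecker`).
* By a double orthogonal complement, the graph of the minimal operator is the radical of the form
  (`mem_minGraph_iff`).

It remains to compute the form near `0`. With `κ = β / (1 + 2m)`, the function
`u = x^{1/2+m} e^{-κx}` satisfies `L u = -κ² u` exactly and has no zeros. It differs from the
boundary function `x^{1/2+m} (1 - κx)` by an element of the minimal domain
(`exists_sub_sol_mem`).

* If `-1 < Re m < 1`, reduction of order gives a second solution `v` of `L v = -κ² v` that is
  square-integrable near `0` and has Wronskian `-1` with `u` (`exists_bform_sol_eq_one`). So the rank
  is two, and the domain of `H_{β,m}` is the annihilator of `u`, a maximal isotropic subspace.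
* If `Re m ≥ 1`, then `u` is in the minimal domain, so that the Wronskian of `u` with any element
  of the maximal domain is `O(x^{1 + Re m})`. By Cramer's rule, a nonzero boundary value of the
  Wronskian of `f` and `h` would force `|f| + |h| ≥ c x^{-1/2}` near `0`, which contradicts
  square-integrability. So the form vanishes (`bform_eq_zero_of_one_le_re`).

The graph of the transpose consists of the elements that annihilate the graph of the operator, hence
`H_{β,m}` is its own transpose; the adjoint is the complex conjugate of the transpose.
-/

namespace Whittaker

/-! ### Primitives of integrable functions -/

theorem absolutelyContinuousOnInterval_congr {f g : ℝ → ℂ} {a b : ℝ}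
    (hf : AbsolutelyContinuousOnInterval f a b) (h : ∀ x ∈ uIcc a b, g x = f x) :
    AbsolutelyContinuousOnInterval g a b := by
  unfold AbsolutelyContinuousOnInterval at hf ⊢
  refine Tendsto.congr' ?_ hf
  filter_upwards [mem_inf_of_right (mem_principal_self _)] with E hE
  refine Finset.sum_congr rfl fun i hi => ?_
  rw [h _ (hE.1 i hi).1, h _ (hE.1 i hi).2]

/-- The complex-valued version of
`IntervalIntegrable.absolutelyContinuousOnInterval_intervalIntegral`. -/
theorem absolutelyContinuousOnInterval_primitive {f : ℝ → ℂ} {a b : ℝ}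
    (hf : IntervalIntegrable f volume a b) :
    AbsolutelyContinuousOnInterval (fun x => ∫ t in a..x, f t) a b := by
  have hconst : ∀ c : ℂ, AbsolutelyContinuousOnInterval (fun _ : ℝ => c) a b := fun c =>
    (contDiff_const (n := 1)).contDiffOn.absolutelyContinuousOnInterval
  have hre : IntervalIntegrable (fun t => (f t).re) volume a b :=
    ⟨hf.1.re, hf.2.re⟩
  have him : IntervalIntegrable (fun t => (f t).im) volume a b :=
    ⟨hf.1.im, hf.2.im⟩
  have h1 := (hre.absolutelyContinuousOnInterval_intervalIntegral (c := a) (by simp)).fun_smul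
    (hconst 1)
  have h2 := (him.absolutelyContinuousOnInterval_intervalIntegral (c := a) (by simp)).fun_smul
    (hconst Complex.I)
  refine absolutelyContinuousOnInterval_congr (h1.add h2) fun x hx => ?_
  have hfx : IntervalIntegrable f volume a x := hf.mono_set (uIcc_subset_uIcc (by simp) hx)
  have e1 := Complex.reCLM.intervalIntegral_comp_comm hfx
  have e2 := Complex.imCLM.intervalIntegral_comp_comm hfx
  simp only [Complex.reCLM_apply, Complex.imCLM_apply] at e1 e2
  simp only [Pi.add_apply, e1, e2, Complex.real_smul, mul_one, Complex.re_add_im]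

/-- The product rule, in integrated form, for primitives of integrable functions. -/
theorem integral_mul_add_mul_of_primitive {F K f k : ℝ → ℂ} {a b : ℝ}
    (hf : IntervalIntegrable f volume a b) (hk : IntervalIntegrable k volume a b)
    (hF : ∀ x ∈ uIcc a b, F x = F a + ∫ t in a..x, f t)
    (hK : ∀ x ∈ uIcc a b, K x = K a + ∫ t in a..x, k t) :
    F b * K b - F a * K a = ∫ x in a..b, (f x * K x + F x * k x) := by
  have hconst : ∀ c : ℂ, AbsolutelyContinuousOnInterval (fun _ : ℝ => c) a b := fun c =>
    (contDiff_const (n := 1)).contDiffOn.absolutelyContinuousOnInterval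
  have aF : AbsolutelyContinuousOnInterval F a b :=
    absolutelyContinuousOnInterval_congr
      ((hconst (F a)).add (absolutelyContinuousOnInterval_primitive hf)) hF
  have aK : AbsolutelyContinuousOnInterval K a b :=
    absolutelyContinuousOnInterval_congr
      ((hconst (K a)).add (absolutelyContinuousOnInterval_primitive hk)) hK
  have hint : IntervalIntegrable (fun x => f x * K x + F x * k x) volume a b :=
    (hf.mul_continuousOn aK.continuousOn).add (hk.continuousOn_mul aF.continuousOn)
  have aP := (aF.fun_smul aK).sub (absolutelyContinuousOnInterval_primitive hint)
  -- `F K - ∫ (f K + F k)` is absolutely continuous with derivative zero almost everywhere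
  have hne : ∀ c : ℝ, ∀ᵐ x : ℝ, x ≠ c := fun c => by simp [ae_iff, measure_singleton]
  obtain ⟨C, hC⟩ := aP.const_of_ae_hasDerivAt_zero (by
    filter_upwards [hf.ae_hasDerivAt_integral, hk.ae_hasDerivAt_integral,
      hint.ae_hasDerivAt_integral, hne a, hne b] with x h1 h2 h3 ha hb hx
    have hmem : uIcc a b ∈ 𝓝 x := by
      rw [uIcc, mem_Icc] at hx
      refine Icc_mem_nhds (lt_of_le_of_ne hx.1 ?_) (lt_of_le_of_ne hx.2 ?_)
      · rcases min_choice a b with h | h <;> rw [h] <;> [exact ha.symm; exact hb.symm]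
      · rcases max_choice a b with h | h <;> rw [h] <;> assumption
    have dF : HasDerivAt F (f x) x :=
      ((h1 hx a (by simp)).const_add (F a)).congr_of_eventuallyEq (by
        filter_upwards [hmem] with y hy using hF y hy)
    have dK : HasDerivAt K (k x) x :=
      ((h2 hx a (by simp)).const_add (K a)).congr_of_eventuallyEq (by
        filter_upwards [hmem] with y hy using hK y hy)
    have := (dF.mul dK).sub (h3 hx a (by simp))
    rw [sub_self] at this
    exact this)
  have e1 := hC a (by simp)
  have e2 := hC b (by simp)
  simp only [Pi.sub_apply, smul_eq_mul, intervalIntegral.integral_same, sub_zero] at e1 e2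
  rw [e1, ← e2]
  ring

/-! ### Regularity of the elements of the maximal domain -/

/-- The potential `(α - 1/4) x⁻² - β x⁻¹` of the Whittaker operator. -/
noncomputable def pot (β α : ℂ) (x : ℝ) : ℂ := (α - 1 / 4) / (x : ℂ) ^ 2 - β / (x : ℂ)

theorem continuousOn_pot (β α : ℂ) : ContinuousOn (pot β α) (Ioi 0) :=
  (contDiffOn_potential β α).continuousOn

theorem exists_testFun_integral_eq_one : ∃ φ, IsTestFun φ ∧ ∫ x, φ x ∂halfLine = 1 := by
  obtain ⟨f, hf⟩ : ∃ f : ContDiffBump (2 : ℝ), f.rOut = 1 :=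
    ⟨⟨1 / 2, 1, by norm_num, by norm_num⟩, rfl⟩
  have hφ : IsTestFun (fun x => ((f.normed volume x : ℝ) : ℂ)) := by
    refine ⟨Complex.ofRealCLM.contDiff.comp f.contDiff_normed,
      f.hasCompactSupport_normed.comp_left (g := fun r : ℝ => (r : ℂ)) Complex.ofReal_zero, ?_⟩
    refine (tsupport_comp_subset (g := fun r : ℝ => (r : ℂ)) Complex.ofReal_zero _).trans ?_
    rw [f.tsupport_normed_eq, hf]
    intro x hx
    rw [Metric.mem_closedBall, Real.dist_eq, abs_le] at hx
    exact mem_Ioi.mpr (by linarith [hx.1])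
  refine ⟨_, hφ, ?_⟩
  rw [hφ.setIntegral]
  have h := integral_ofReal (𝕜 := ℂ) (μ := volume) (f := f.normed volume)
  exact h.trans (by rw [f.integral_normed]; simp)

/-- A test function of integral zero is the derivative of a test function. -/
theorem IsTestFun.exists_deriv_eq {ψ : ℝ → ℂ} (hψ : IsTestFun ψ)
    (h0 : ∫ x, ψ x ∂halfLine = 0) : ∃ φ, IsTestFun φ ∧ _root_.deriv φ = ψ := by
  rw [hψ.setIntegral] at h0
  have hcont := hψ.smooth.continuous
  have hii : ∀ a b, IntervalIntegrable ψ volume a b := fun a b => hcont.intervalIntegrable a b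
  set φ : ℝ → ℂ := fun x => ∫ t in (0 : ℝ)..x, ψ t with hφ
  have hd : ∀ x, HasDerivAt φ (ψ x) x := fun x =>
    intervalIntegral.integral_hasDerivAt_right (hii 0 x)
      hcont.aestronglyMeasurable.stronglyMeasurableAtFilter hcont.continuousAt
  have hderiv : _root_.deriv φ = ψ := funext fun x => (hd x).deriv
  have hsm : ContDiff ℝ ∞ φ := by
    rw [contDiff_infty_iff_deriv]
    exact ⟨fun x => (hd x).differentiableAt, hderiv ▸ hψ.smooth⟩
  obtain ⟨a, b, hab⟩ : ∃ a b : ℝ, 0 < a ∧ tsupport ψ ⊆ Icc a b := by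
    rcases (tsupport ψ).eq_empty_or_nonempty with he | hne
    · exact ⟨1, 1, one_pos, by simp [he]⟩
    · obtain ⟨a, ha, ha'⟩ := hψ.compact.isCompact.exists_isLeast hne
      obtain ⟨b, hb, hb'⟩ := hψ.compact.isCompact.exists_isGreatest hne
      exact ⟨a, b, hψ.supp ha, fun x hx => ⟨ha' hx, hb' hx⟩⟩
  have hz : ∀ x, x ∉ Icc a b → ψ x = 0 := fun x hx =>
    image_eq_zero_of_notMem_tsupport fun h => hx (hab.2 h)
  have hl : ∀ x, x < a → φ x = 0 := by
    intro x hx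
    refine (intervalIntegral.integral_congr (g := fun _ => (0 : ℂ)) fun t ht => ?_).trans (by simp)
    refine hz t fun h => ?_
    rcases le_total 0 x with h0 | h0
    · rw [uIcc_of_le h0] at ht
      linarith [ht.2, h.1]
    · rw [uIcc_of_ge h0] at ht
      linarith [ht.2, h.1, hab.1]
  have hr : ∀ x, b < x → φ x = 0 := by
    intro x hx
    have h1 : ∫ t in (0 : ℝ)..x, ψ t = ∫ t, ψ t := by
      refine intervalIntegral.integral_eq_integral_of_support_subset fun t ht => ?_
      have := hab.2 (subset_tsupport _ ht)
      exact ⟨lt_of_lt_of_le hab.1 this.1, this.2.trans hx.le⟩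
    simp only [hφ, h1, h0]
  have hsub : tsupport φ ⊆ Icc a b := by
    refine closure_minimal (fun x hx => ?_) isClosed_Icc
    by_contra hn
    rw [mem_Icc, not_and_or, not_le, not_le] at hn
    exact hx (hn.elim (hl x) (hr x))
  exact ⟨φ, ⟨hsm, isCompact_Icc.of_isClosed_subset (isClosed_tsupport φ) hsub,
    hsub.trans fun x hx => lt_of_lt_of_le hab.1 hx.1⟩, hderiv⟩

/-- Local integrability on the open half-line. -/
def LocInt (f : ℝ → ℂ) : Prop :=
  ∀ a b : ℝ, 0 < a → 0 < b → IntervalIntegrable f volume a b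

theorem uIcc_subset_Ioi {a b : ℝ} (ha : 0 < a) (hb : 0 < b) : uIcc a b ⊆ Ioi (0 : ℝ) :=
  fun _ hx => lt_of_lt_of_le (lt_min ha hb) hx.1

theorem LocInt.of_continuousOn {f : ℝ → ℂ} (hf : ContinuousOn f (Ioi 0)) : LocInt f :=
  fun _ _ ha hb => (hf.mono (uIcc_subset_Ioi ha hb)).intervalIntegrable

theorem LocInt.add {f g : ℝ → ℂ} (hf : LocInt f) (hg : LocInt g) :
    LocInt (fun x => f x + g x) := fun a b ha hb => (hf a b ha hb).add (hg a b ha hb)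

theorem LocInt.sub {f g : ℝ → ℂ} (hf : LocInt f) (hg : LocInt g) :
    LocInt (fun x => f x - g x) := fun a b ha hb => (hf a b ha hb).sub (hg a b ha hb)

theorem LocInt.continuousOn_mul {f v : ℝ → ℂ} (hf : LocInt f) (hv : ContinuousOn v (Ioi 0)) :
    LocInt (fun x => v x * f x) := fun a b ha hb =>
  (hf a b ha hb).continuousOn_mul (hv.mono (uIcc_subset_Ioi ha hb))

theorem LocInt.of_L2 (f : L2) : LocInt f := by
  intro a b ha hb
  have h1 := ((Lp.memLp f).locallyIntegrable (by norm_num)).integrableOn_isCompact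
    (isCompact_uIcc (a := a) (b := b))
  rw [IntegrableOn, Measure.restrict_restrict measurableSet_uIcc,
    inter_eq_left.mpr (uIcc_subset_Ioi ha hb)] at h1
  exact IntegrableOn.intervalIntegrable h1

theorem LocInt.locallyIntegrableOn {f : ℝ → ℂ} (hf : LocInt f) :
    LocallyIntegrableOn f (Ioi 0) halfLine := by
  intro x hx
  have hx : 0 < x := hx
  refine ⟨Ioc (x / 2) (2 * x), mem_nhdsWithin_of_mem_nhds
    (Ioc_mem_nhds (by linarith) (by linarith)), ?_⟩
  have h := (hf (x / 2) (2 * x) (by linarith) (by linarith)).1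
  exact h.mono_measure Measure.restrict_le_self

/-- The support of a test function lies in a compact interval of the open half-line. -/
theorem IsTestFun.exists_Icc {ψ : ℝ → ℂ} (hψ : IsTestFun ψ) :
    ∃ a b : ℝ, 0 < a ∧ a < b ∧ ∀ x, x ∉ Ioo a b → ψ x = 0 := by
  rcases (tsupport ψ).eq_empty_or_nonempty with he | hne
  · refine ⟨1, 2, one_pos, one_lt_two, fun x _ => image_eq_zero_of_notMem_tsupport ?_⟩
    simp [he]
  · obtain ⟨a, ha, ha'⟩ := hψ.compact.isCompact.exists_isLeast hne
    obtain ⟨b, hb, hb'⟩ := hψ.compact.isCompact.exists_isGreatest hne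
    have ha0 : 0 < a := hψ.supp ha
    have hab : a ≤ b := ha' hb
    refine ⟨a / 2, b + 1, by linarith, by linarith, fun x hx =>
      image_eq_zero_of_notMem_tsupport fun h => hx ⟨?_, ?_⟩⟩
    · linarith [ha' h]
    · linarith [hb' h]

theorem setIntegral_eq_intervalIntegral_of_eq_zero {f : ℝ → ℂ} {a b : ℝ} (ha : 0 < a)
    (hab : a < b) (h : ∀ x, x ∉ Ioo a b → f x = 0) :
    ∫ x, f x ∂halfLine = ∫ x in a..b, f x := by
  rw [intervalIntegral.integral_of_le hab.le, setIntegral_eq_integral_of_forall_compl_eq_zero,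
    setIntegral_eq_integral_of_forall_compl_eq_zero]
  · exact fun x hx => h x fun hx' => hx ⟨hx'.1, hx'.2.le⟩
  · exact fun x hx => h x fun hx' => hx (ha.trans hx'.1)

theorem LocInt.integrable_mul {f φ : ℝ → ℂ} (hf : LocInt f) (hφ : IsTestFun φ) :
    Integrable (fun x => f x * φ x) halfLine := by
  obtain ⟨a, b, ha, hab, hz⟩ := hφ.exists_Icc
  have h1 : IntegrableOn (fun x => f x * φ x) (Ioc a b) :=
    ((hf a b ha (ha.trans hab)).mul_continuousOn hφ.smooth.continuous.continuousOn).1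
  have h2 : Integrable (fun x => f x * φ x) := by
    rw [← integrableOn_univ]
    exact h1.of_forall_sdiff_eq_zero MeasurableSet.univ fun x hx => by
      rw [hz x fun hx' => hx.2 ⟨hx'.1, hx'.2.le⟩, mul_zero]
  exact h2.restrict

/-- Two functions that are locally integrable on the half-line and define the same distribution
coincide almost everywhere. -/
theorem ae_eq_of_forall_test {f g : ℝ → ℂ} (hf : LocInt f) (hg : LocInt g)
    (h : ∀ φ, IsTestFun φ → ∫ x, f x * φ x ∂halfLine = ∫ x, g x * φ x ∂halfLine) :
    f =ᵐ[halfLine] g := by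
  have h1 := isOpen_Ioi.ae_eq_zero_of_integral_contDiff_smul_eq_zero
    (hf.sub hg).locallyIntegrableOn (fun g' hg' hc hs => by
    have hφ : IsTestFun (fun x => (g' x : ℂ)) := by
      refine ⟨Complex.ofRealCLM.contDiff.comp hg',
        hc.comp_left (g := fun r : ℝ => (r : ℂ)) Complex.ofReal_zero, ?_⟩
      exact (tsupport_comp_subset (g := fun r : ℝ => (r : ℂ)) Complex.ofReal_zero g').trans hs
    have := h _ hφ
    rw [← sub_eq_zero, ← integral_sub (hf.integrable_mul hφ) (hg.integrable_mul hφ)] at this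
    rw [← this]
    refine integral_congr_ae (Eventually.of_forall fun x => ?_)
    simp only [Complex.real_smul]
    ring)
  filter_upwards [h1, ae_restrict_mem measurableSet_Ioi] with x hx hx0
  exact sub_eq_zero.mp (hx hx0)

theorem primitive_sub {F f : ℝ → ℂ} (hf : LocInt f)
    (hF : ∀ x, 0 < x → F x = F 1 + ∫ t in (1 : ℝ)..x, f t) {a b : ℝ} (ha : 0 < a) (hb : 0 < b) :
    F b = F a + ∫ t in a..b, f t := by
  rw [hF a ha, hF b hb, add_assoc, intervalIntegral.integral_add_adjacent_intervals
    (hf 1 a one_pos ha) (hf a b ha hb)]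

/-- A locally integrable function is the distributional derivative of its primitive. -/
theorem integral_primitive_mul_deriv {F f φ : ℝ → ℂ} (hf : LocInt f)
    (hF : ∀ x, 0 < x → F x = F 1 + ∫ t in (1 : ℝ)..x, f t) (hφ : IsTestFun φ) :
    ∫ x, F x * deriv φ x ∂halfLine = -∫ x, f x * φ x ∂halfLine := by
  obtain ⟨a, b, ha, hab, hz⟩ := hφ.exists_Icc
  obtain ⟨a', b', ha', hab', hz'⟩ := hφ.deriv.exists_Icc
  have hz1 : ∀ x, x ∉ Ioo (min a a') (max b b') → φ x = 0 := fun x hx =>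
    hz x fun h => hx ⟨(min_le_left _ _).trans_lt h.1, h.2.trans_le (le_max_left _ _)⟩
  have hz2 : ∀ x, x ∉ Ioo (min a a') (max b b') → deriv φ x = 0 := fun x hx =>
    hz' x fun h => hx ⟨(min_le_right _ _).trans_lt h.1, h.2.trans_le (le_max_right _ _)⟩
  have hA : 0 < min a a' := lt_min ha ha'
  have hAB : min a a' < max b b' := (min_le_left _ _).trans_lt (hab.trans_le (le_max_left _ _))
  have hB := hA.trans hAB
  set A := min a a'
  set B := max b b'
  rw [setIntegral_eq_intervalIntegral_of_eq_zero hA hAB fun x hx => by rw [hz2 x hx, mul_zero],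
    setIntegral_eq_intervalIntegral_of_eq_zero hA hAB fun x hx => by rw [hz1 x hx, mul_zero]]
  have hdc := hφ.deriv.smooth.continuous
  have hFc : ContinuousOn F (uIcc A B) := by
    refine ContinuousOn.congr (f := fun x => F A + ∫ t in A..x, f t) ?_ fun x hx =>
      primitive_sub hf hF hA (uIcc_subset_Ioi hA hB hx)
    exact continuousOn_const.add
      (intervalIntegral.continuousOn_primitive_interval' (hf A B hA hB) (by simp))
  have h := integral_mul_add_mul_of_primitive (F := F) (K := φ) (hf A B hA hB)
    (hdc.intervalIntegrable A B)
    (fun x hx => primitive_sub hf hF hA (uIcc_subset_Ioi hA hB hx))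
    (fun x _ => by
      rw [intervalIntegral.integral_eq_sub_of_hasDerivAt (fun y _ => hφ.hasDerivAt y)
        (hdc.intervalIntegrable A x)]
      ring)
  rw [hz1 A (by simp), hz1 B (by simp), intervalIntegral.integral_add
    ((hf A B hA hB).mul_continuousOn hφ.smooth.continuous.continuousOn)
    ((hdc.intervalIntegrable A B).continuousOn_mul hFc)] at h
  rw [eq_neg_iff_add_eq_zero, add_comm, ← h]
  ring

/-- A locally integrable function with vanishing distributional derivative is constant. -/
theorem exists_ae_eq_const {D : ℝ → ℂ} (hD : LocInt D)
    (h : ∀ φ, IsTestFun φ → ∫ x, D x * deriv φ x ∂halfLine = 0) :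
    ∃ c : ℂ, D =ᵐ[halfLine] fun _ => c := by
  obtain ⟨φ₀, hφ₀, h1⟩ := exists_testFun_integral_eq_one
  refine ⟨∫ x, D x * φ₀ x ∂halfLine,
    ae_eq_of_forall_test hD (LocInt.of_continuousOn continuousOn_const) fun ψ hψ => ?_⟩
  -- `ψ - (∫ ψ) φ₀` has integral zero, so it is the derivative of a test function
  have hχ := hψ.add (hφ₀.const_mul (-∫ x, ψ x ∂halfLine))
  obtain ⟨φ, hφ, hd⟩ := hχ.exists_deriv_eq (by
    rw [integral_add hψ.integrable.restrict (hφ₀.const_mul _).integrable.restrict,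
      integral_const_mul, h1]
    ring)
  have := h φ hφ
  rw [hd] at this
  have e : ∀ x, D x * (ψ x + (-∫ x, ψ x ∂halfLine) * φ₀ x) =
      D x * ψ x + (-∫ x, ψ x ∂halfLine) * (D x * φ₀ x) := fun x => by ring
  simp only [e] at this
  rw [integral_add (hD.integrable_mul hψ) ((hD.integrable_mul hφ₀).const_mul _),
    integral_const_mul] at this
  rw [integral_const_mul]
  linear_combination this

section

/-- `F` is a continuously differentiable representative, with derivative `F₁`, of the first
component of `p`, and `F₁` is a primitive of `V F - p.2`, where `V` is the potential: this says
that `L_{β,α} p.1 = p.2` in the classical (Carathéodory) sense. -/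
structure IsRep (β α : ℂ) (p : L2 × L2) (F F₁ : ℝ → ℂ) : Prop where
  ae_eq : p.1 =ᵐ[halfLine] F
  hasDerivAt : ∀ x, 0 < x → HasDerivAt F (F₁ x) x
  primitive : ∀ x, 0 < x → F₁ x = F₁ 1 + ∫ t in (1 : ℝ)..x, (pot β α t * F t - p.2 t)

theorem continuousOn_primitive {F f : ℝ → ℂ} (hf : LocInt f)
    (hF : ∀ x, 0 < x → F x = F 1 + ∫ t in (1 : ℝ)..x, f t) : ContinuousOn F (Ioi 0) := by
  intro x hx
  have hx : 0 < x := hx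
  have h1 : ContinuousOn F (uIcc (x / 2) (2 * x)) := by
    refine ContinuousOn.congr (f := fun y => F (x / 2) + ∫ t in (x / 2)..y, f t) ?_ fun y hy =>
      primitive_sub hf hF (by linarith) (uIcc_subset_Ioi (by linarith) (by linarith) hy)
    exact continuousOn_const.add (intervalIntegral.continuousOn_primitive_interval'
      (hf (x / 2) (2 * x) (by linarith) (by linarith)) (by simp))
  refine (h1.continuousAt ?_).continuousWithinAt
  rw [uIcc_of_le (by linarith)]
  exact Icc_mem_nhds (by linarith) (by linarith)

/-- Every element of the graph of the maximal operator has a continuously differentiable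
representative whose derivative is locally absolutely continuous. -/
theorem exists_isRep {β α : ℂ} {p : L2 × L2} (hp : p ∈ maxGraph β α) :
    ∃ F F₁, IsRep β α p F F₁ := by
  have hp1 := LocInt.of_L2 p.1
  have hp2 := LocInt.of_L2 p.2
  have hk : LocInt (fun t => pot β α t * p.1 t - p.2 t) :=
    (hp1.continuousOn_mul (continuousOn_pot β α)).sub hp2
  -- `G` is a second primitive of `k`, the second distributional derivative of `p.1`
  set k : ℝ → ℂ := fun t => pot β α t * p.1 t - p.2 t with hkdef
  set K : ℝ → ℂ := fun x => ∫ t in (1 : ℝ)..x, k t with hK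
  have hKp : ∀ x, 0 < x → K x = K 1 + ∫ t in (1 : ℝ)..x, k t := fun x _ => by simp [hK]
  have hKc : ContinuousOn K (Ioi 0) := continuousOn_primitive hk hKp
  have hKl : LocInt K := LocInt.of_continuousOn hKc
  set G : ℝ → ℂ := fun x => ∫ t in (1 : ℝ)..x, K t with hG
  have hGp : ∀ x, 0 < x → G x = G 1 + ∫ t in (1 : ℝ)..x, K t := fun x _ => by simp [hG]
  have hGc : ContinuousOn G (Ioi 0) := continuousOn_primitive hKl hGp
  have hGl : LocInt G := LocInt.of_continuousOn hGc
  have hD : LocInt (fun x => p.1 x - G x) := hp1.sub hGl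
  -- the second distributional derivative of `p.1 - G` vanishes
  have h2 : ∀ φ, IsTestFun φ → ∫ x, (p.1 x - G x) * deriv (deriv φ) x ∂halfLine = 0 := by
    intro φ hφ
    have e1 := integral_primitive_mul_deriv hKl hGp hφ.deriv
    have e2 := integral_primitive_mul_deriv hk hKp hφ
    have e3 := hp φ hφ
    have i1 := hp1.integrable_mul hφ.deriv.deriv
    have i2 := hGl.integrable_mul hφ.deriv.deriv
    have i3 : Integrable (fun x => pot β α x * p.1 x * φ x) halfLine :=
      (hp1.continuousOn_mul (continuousOn_pot β α)).integrable_mul hφ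
    have i4 := hp2.integrable_mul hφ
    have e4 : ∫ x, k x * φ x ∂halfLine =
        ∫ x, pot β α x * p.1 x * φ x ∂halfLine - ∫ x, p.2 x * φ x ∂halfLine := by
      rw [← integral_sub i3 i4]
      exact integral_congr_ae (Eventually.of_forall fun x => by simp only [hkdef]; ring)
    have e5 : ∫ x, p.1 x * formalOp β α φ x ∂halfLine =
        ∫ x, pot β α x * p.1 x * φ x ∂halfLine - ∫ x, p.1 x * deriv (deriv φ) x ∂halfLine := by
      rw [← integral_sub i3 i1]
      exact integral_congr_ae (Eventually.of_forall fun x => by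
        simp only [formalOp, pot]; ring)
    simp only [sub_mul]
    rw [integral_sub i1 i2, e1, e2, e4]
    linear_combination -e3 + e5
  obtain ⟨φ₀, hφ₀, hφ1⟩ := exists_testFun_integral_eq_one
  set b : ℂ := ∫ x, (p.1 x - G x) * deriv φ₀ x ∂halfLine with hb
  have hxc : ContinuousOn (fun x : ℝ => b * (x : ℂ)) (Ioi 0) := by fun_prop
  have hxl : LocInt (fun x : ℝ => b * (x : ℂ)) := LocInt.of_continuousOn hxc
  have hbp : ∀ x : ℝ, 0 < x → b * (x : ℂ) = b * ((1 : ℝ) : ℂ) + ∫ t in (1 : ℝ)..x, b := by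
    intro x _
    rw [intervalIntegral.integral_const, Complex.real_smul]
    push_cast
    ring
  -- hence `p.1 - G + b x` has distributional derivative zero
  obtain ⟨c, hc⟩ := exists_ae_eq_const (hD.add hxl) (by
    intro ψ hψ
    have hχ := hψ.add (hφ₀.const_mul (-∫ x, ψ x ∂halfLine))
    obtain ⟨φ, hφ, hd⟩ := hχ.exists_deriv_eq (by
      rw [integral_add hψ.integrable.restrict (hφ₀.const_mul _).integrable.restrict,
        integral_const_mul, hφ1]
      ring)
    have h3 := h2 φ hφ
    have e6 : deriv (deriv φ) = fun x => deriv ψ x + (-∫ x, ψ x ∂halfLine) * deriv φ₀ x := by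
      rw [hd]
      exact funext fun x => ((hψ.hasDerivAt x).add ((hφ₀.hasDerivAt x).const_mul _)).deriv
    have e7 : ∀ x, (p.1 x - G x) * (deriv ψ x + (-∫ x, ψ x ∂halfLine) * deriv φ₀ x) =
        (p.1 x - G x) * deriv ψ x +
          (-∫ x, ψ x ∂halfLine) * ((p.1 x - G x) * deriv φ₀ x) := fun x => by ring
    simp only [e6, e7] at h3
    rw [integral_add (hD.integrable_mul hψ.deriv) ((hD.integrable_mul hφ₀.deriv).const_mul _),
      integral_const_mul, ← hb] at h3
    have e8 := integral_primitive_mul_deriv (F := fun x : ℝ => b * (x : ℂ))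
      (LocInt.of_continuousOn continuousOn_const) hbp hψ
    rw [integral_const_mul] at e8
    simp only [add_mul]
    rw [integral_add (hD.integrable_mul hψ.deriv) (hxl.integrable_mul hψ.deriv), e8]
    linear_combination h3)
  have hae : p.1 =ᵐ[halfLine] fun x => G x - b * x + c := by
    filter_upwards [hc] with x hx
    linear_combination hx
  refine ⟨fun x => G x - b * x + c, fun x => K x - b, hae, fun x hx => ?_, fun x hx => ?_⟩
  · have d1 : HasDerivAt G (K x) x :=
      intervalIntegral.integral_hasDerivAt_right (hKl 1 x one_pos hx)
        (hKc.stronglyMeasurableAtFilter isOpen_Ioi x hx)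
        (hKc.continuousAt (Ioi_mem_nhds hx))
    have d2 : HasDerivAt (fun x : ℝ => b * (x : ℂ)) b x := by
      simpa using (Complex.ofRealCLM.hasDerivAt (x := x)).const_mul b
    exact (d1.sub d2).add_const c
  · rw [hKp x hx]
    have : ∫ t in (1 : ℝ)..x, k t =
        ∫ t in (1 : ℝ)..x, (pot β α t * (G t - b * t + c) - p.2 t) := by
      refine intervalIntegral.integral_congr_ae ?_
      have h := (ae_restrict_iff' measurableSet_Ioi).mp hae
      filter_upwards [h] with t ht ht'
      have ht0 : 0 < t := uIcc_subset_Ioi one_pos hx (uIoc_subset_uIcc ht')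
      rw [hkdef]
      simp only
      rw [ht ht0]
    rw [this]
    ring

variable {β α : ℂ} {p q : L2 × L2} {F F₁ H H₁ : ℝ → ℂ}

theorem IsRep.continuousOn (h : IsRep β α p F F₁) : ContinuousOn F (Ioi 0) :=
  fun x hx => (h.hasDerivAt x hx).continuousAt.continuousWithinAt

theorem IsRep.locInt (h : IsRep β α p F F₁) : LocInt (fun t => pot β α t * F t - p.2 t) :=
  LocInt.of_continuousOn ((continuousOn_pot β α).mul h.continuousOn) |>.sub (LocInt.of_L2 p.2)

theorem IsRep.continuousOn_deriv (h : IsRep β α p F F₁) : ContinuousOn F₁ (Ioi 0) :=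
  continuousOn_primitive h.locInt h.primitive

theorem IsRep.eq_add_integral (h : IsRep β α p F F₁) {a b : ℝ} (ha : 0 < a) (hb : 0 < b) :
    F b = F a + ∫ t in a..b, F₁ t := by
  rw [intervalIntegral.integral_eq_sub_of_hasDerivAt
    (fun x hx => h.hasDerivAt x (uIcc_subset_Ioi ha hb hx))
    ((h.continuousOn_deriv.mono (uIcc_subset_Ioi ha hb)).intervalIntegrable)]
  ring

/-- Lagrange's identity. -/
theorem IsRep.wronskian_sub (h : IsRep β α p F F₁) (h' : IsRep β α q H H₁) {a b : ℝ} (ha : 0 < a)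
    (hb : 0 < b) :
    (F b * H₁ b - F₁ b * H b) - (F a * H₁ a - F₁ a * H a) =
      ∫ x in a..b, (p.2 x * q.1 x - p.1 x * q.2 x) := by
  have hs := uIcc_subset_Ioi ha hb
  have i1 := (h.continuousOn_deriv.mono hs).intervalIntegrable (μ := volume)
  have i2 := (h'.continuousOn_deriv.mono hs).intervalIntegrable (μ := volume)
  have j1 := h.locInt a b ha hb
  have j2 := h'.locInt a b ha hb
  have e1 := integral_mul_add_mul_of_primitive i1 j2
    (fun x hx => h.eq_add_integral ha (hs hx))
    (fun x hx => primitive_sub h'.locInt h'.primitive ha (hs hx))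
  have e2 := integral_mul_add_mul_of_primitive j1 i2
    (fun x hx => primitive_sub h.locInt h.primitive ha (hs hx))
    (fun x hx => h'.eq_add_integral ha (hs hx))
  have cF := h.continuousOn.mono hs
  have cH := h'.continuousOn.mono hs
  have cF1 := h.continuousOn_deriv.mono hs
  have cH1 := h'.continuousOn_deriv.mono hs
  have e3 : (F b * H₁ b - F₁ b * H b) - (F a * H₁ a - F₁ a * H a) =
      (F b * H₁ b - F a * H₁ a) - (F₁ b * H b - F₁ a * H a) := by ring
  rw [e3, e1, e2, ← intervalIntegral.integral_sub
    ((i1.mul_continuousOn cH1).add (j2.continuousOn_mul cF))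
    ((j1.mul_continuousOn cH).add (i2.continuousOn_mul cF1))]
  refine intervalIntegral.integral_congr_ae ?_
  filter_upwards [(ae_restrict_iff' measurableSet_Ioi).mp h.ae_eq,
    (ae_restrict_iff' measurableSet_Ioi).mp h'.ae_eq] with t h1 h2 ht
  have ht0 := hs (uIoc_subset_uIcc ht)
  rw [h1 ht0, h2 ht0]
  ring

end

section

variable {β α : ℂ} {p q : L2 × L2} {F F₁ H H₁ : ℝ → ℂ}

/-! ### The boundary form -/

/-- The boundary form `⟨p.2|q.1⟩ - ⟨p.1|q.2⟩` on pairs of elements of `L² × L²`. -/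
noncomputable def bform (p q : L2 × L2) : ℂ := ∫ x, (p.2 x * q.1 x - p.1 x * q.2 x) ∂halfLine

theorem integrable_bform (p q : L2 × L2) :
    Integrable (fun x => p.2 x * q.1 x - p.1 x * q.2 x) halfLine :=
  (integrable_mul p.2 q.1).sub (integrable_mul p.1 q.2)

theorem integrable_norm_sq (f : L2) : Integrable (fun x => ‖f x‖ ^ 2) halfLine :=
  (memLp_two_iff_integrable_sq_norm (Lp.memLp f).1).mp (Lp.memLp f)

theorem IsRep.integrable_norm_sq (h : IsRep β α p F F₁) :
    Integrable (fun x => ‖F x‖ ^ 2) halfLine := by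
  refine (Whittaker.integrable_norm_sq p.1).congr ?_
  filter_upwards [h.ae_eq] with x hx
  rw [hx]

theorem IsRep.integrable_norm_sq_shift (h : IsRep β α p F F₁) :
    Integrable (fun x => ‖F (x + 1)‖ ^ 2) halfLine := by
  have h1 := (integrable_indicator_iff measurableSet_Ioi).mpr h.integrable_norm_sq
  refine (h1.comp_add_right 1).restrict.congr ?_
  filter_upwards [ae_restrict_mem measurableSet_Ioi] with x hx
  have hx : 0 < x := hx
  rw [indicator_of_mem (mem_Ioi.mpr (by linarith))]

theorem norm_pot_le (β α : ℂ) {x : ℝ} (hx : 1 ≤ x) : ‖pot β α x‖ ≤ ‖α - 1 / 4‖ + ‖β‖ := by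
  refine (norm_sub_le _ _).trans (add_le_add ?_ ?_)
  · rw [norm_div, norm_pow, Complex.norm_real, Real.norm_of_nonneg (by linarith)]
    exact div_le_self (norm_nonneg _) (one_le_pow₀ hx)
  · rw [norm_div, Complex.norm_real, Real.norm_of_nonneg (by linarith)]
    exact div_le_self (norm_nonneg _) hx

/-- Away from `0` the derivative is controlled by the values of the function. -/
theorem IsRep.exists_norm_deriv_le (h : IsRep β α p F F₁) :
    ∃ K : ℝ, 0 ≤ K ∧ ∀ x, 1 ≤ x → ‖F₁ x‖ ≤ ‖F x‖ + ‖F (x + 1)‖ + K := by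
  set M : ℝ := ‖α - 1 / 4‖ + ‖β‖ with hM
  have hM0 : 0 ≤ M := by positivity
  set N : ℝ → ℝ := fun x => M ^ 2 * (2 * ‖F x‖ ^ 2) + 2 * ‖p.2 x‖ ^ 2 with hN
  have hNi : Integrable N halfLine :=
    ((h.integrable_norm_sq.const_mul 2).const_mul _).add
      ((Whittaker.integrable_norm_sq p.2).const_mul 2)
  have hN0 : ∀ x, 0 ≤ N x := fun x => by positivity
  have hI0 : 0 ≤ ∫ x, N x ∂halfLine := integral_nonneg hN0
  refine ⟨1 + ∫ x, N x ∂halfLine, by positivity, fun x hx => ?_⟩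
  have hx0 : 0 < x := by linarith
  have hbound : ∀ t ∈ Icc x (x + 1), ‖F₁ t - F₁ x‖ ≤ 1 + ∫ x, N x ∂halfLine := by
    intro t ht
    have ht0 : 0 < t := by linarith [ht.1]
    rw [primitive_sub h.locInt h.primitive hx0 ht0, add_sub_cancel_left]
    have hsub : Ioc x t ⊆ Ioi 0 := fun y hy => hx0.trans hy.1
    have hNii : IntervalIntegrable N volume x t := by
      rw [intervalIntegrable_iff_integrableOn_Ioc_of_le ht.1]
      exact IntegrableOn.mono_set hNi hsub
    have hle : ∫ s in x..t, N s ≤ ∫ x, N x ∂halfLine := by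
      rw [intervalIntegral.integral_of_le ht.1]
      exact setIntegral_mono_set hNi (Eventually.of_forall hN0) hsub.eventuallyLE
    have h1 : ‖∫ s in x..t, (pot β α s * F s - p.2 s)‖ ≤ ∫ s in x..t, (1 + N s) := by
      refine intervalIntegral.norm_integral_le_of_norm_le ht.1 (Eventually.of_forall fun s hs => ?_)
        (intervalIntegrable_const.add hNii)
      have hp := norm_pot_le β α (hx.trans hs.1.le)
      have h2 : ‖pot β α s * F s - p.2 s‖ ≤ M * ‖F s‖ + ‖p.2 s‖ := by
        refine (norm_sub_le _ _).trans ?_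
        rw [norm_mul]
        exact add_le_add (mul_le_mul_of_nonneg_right hp (norm_nonneg _)) le_rfl
      simp only [hN]
      nlinarith [sq_nonneg (M * ‖F s‖ - 1 / 2), sq_nonneg (‖p.2 s‖ - 1 / 2)]
    rw [intervalIntegral.integral_add intervalIntegrable_const hNii,
      intervalIntegral.integral_const, smul_eq_mul, mul_one] at h1
    linarith [ht.2]
  have hx1 : 0 < x + 1 := by linarith
  have hii := (h.continuousOn_deriv.mono (uIcc_subset_Ioi hx0 hx1)).intervalIntegrable
    (μ := volume)
  have e1 := h.eq_add_integral hx0 hx1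
  have e2 : F₁ x = F (x + 1) - F x - ∫ t in x..(x + 1), (F₁ t - F₁ x) := by
    rw [intervalIntegral.integral_sub hii intervalIntegrable_const,
      intervalIntegral.integral_const, e1]
    simp
  have e3 : ‖∫ t in x..(x + 1), (F₁ t - F₁ x)‖ ≤ 1 + ∫ x, N x ∂halfLine := by
    have := intervalIntegral.norm_integral_le_of_norm_le_const (a := x) (b := x + 1)
      (f := fun t => F₁ t - F₁ x) (C := 1 + ∫ x, N x ∂halfLine) (fun t ht => by
        rw [uIoc_of_le (by linarith)] at ht
        exact hbound t ⟨ht.1.le, ht.2⟩)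
    simpa using this
  have e4 := norm_sub_le (F (x + 1) - F x) (∫ t in x..(x + 1), (F₁ t - F₁ x))
  have e5 := norm_sub_le (F (x + 1)) (F x)
  rw [← e2] at e4
  linarith

/-- An integrable function on the half-line is not bounded below by a positive constant at
infinity. -/
theorem not_integrable_of_eventually_ge {g : ℝ → ℝ} (hg : Integrable g halfLine) {c : ℝ}
    (hc : 0 < c) (h : ∀ᶠ x in atTop, c ≤ g x) : False := by
  obtain ⟨X, hX⟩ := eventually_atTop.mp h
  have h1 : IntegrableOn g (Ioi (max X 0)) :=
    IntegrableOn.mono_set (s := Ioi (max X 0)) hg fun x hx => (le_max_right X 0).trans_lt hx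
  have h2 : IntegrableOn (fun _ : ℝ => c) (Ioi (max X 0)) := by
    refine Integrable.mono' h1 aestronglyMeasurable_const ?_
    filter_upwards [ae_restrict_mem measurableSet_Ioi] with x hx
    rw [Real.norm_of_nonneg hc.le]
    exact hX x ((le_max_left X 0).trans (le_of_lt hx))
  rw [integrableOn_const_iff (by simp)] at h2
  simp [hc.ne'] at h2

/-- The Wronskian of two elements of the maximal domain vanishes at infinity. -/
theorem IsRep.tendsto_wronskian_atTop (h : IsRep β α p F F₁) (h' : IsRep β α q H H₁) :
    Tendsto (fun x => F x * H₁ x - F₁ x * H x) atTop (𝓝 0) := by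
  set ℓ : ℂ := (F 1 * H₁ 1 - F₁ 1 * H 1) + ∫ x in Ioi (1 : ℝ), (p.2 x * q.1 x - p.1 x * q.2 x)
    with hℓ
  have hlim : Tendsto (fun x => F x * H₁ x - F₁ x * H x) atTop (𝓝 ℓ) := by
    have h1 : IntegrableOn (fun x => p.2 x * q.1 x - p.1 x * q.2 x) (Ioi (1 : ℝ)) :=
      IntegrableOn.mono_set (s := Ioi (1 : ℝ)) (integrable_bform p q)
        (Ioi_subset_Ioi zero_le_one)
    refine ((intervalIntegral_tendsto_integral_Ioi 1 h1 tendsto_id).const_add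
      (F 1 * H₁ 1 - F₁ 1 * H 1)).congr' ?_
    filter_upwards [eventually_gt_atTop 0] with x hx
    rw [id, ← h.wronskian_sub h' one_pos hx]
    ring
  rcases eq_or_ne ℓ 0 with h0 | h0
  · rwa [h0] at hlim
  -- otherwise a combination of squares of the functions and their shifts, which is integrable,
  -- would be bounded below near infinity
  exfalso
  set c : ℝ := ‖ℓ‖ / 2 with hc
  have hc0 : 0 < c := by positivity
  obtain ⟨K, hK, hb⟩ := h.exists_norm_deriv_le
  obtain ⟨K', hK', hb'⟩ := h'.exists_norm_deriv_le
  have hev : ∀ᶠ x in atTop, c ≤ ‖F x * H₁ x - F₁ x * H x‖ :=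
    (hlim.norm.eventually_const_lt (by rw [hc]; linarith [norm_pos_iff.mpr h0])).mono
      fun _ hx => hx.le
  refine not_integrable_of_eventually_ge (c := c / 2) (g := fun x =>
    (2 + K' ^ 2 / c) * ‖F x‖ ^ 2 + (2 + K ^ 2 / c) * ‖H x‖ ^ 2 +
      (‖F (x + 1)‖ ^ 2 + ‖H (x + 1)‖ ^ 2)) ?_ (by positivity) ?_
  · exact ((h.integrable_norm_sq.const_mul _).add (h'.integrable_norm_sq.const_mul _)).add
      (h.integrable_norm_sq_shift.add h'.integrable_norm_sq_shift)
  · filter_upwards [hev, eventually_ge_atTop 1] with x hx hx1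
    have n1 := hb x hx1
    have n2 := hb' x hx1
    have n3 := norm_sub_le (F x * H₁ x) (F₁ x * H x)
    rw [norm_mul, norm_mul] at n3
    have n4 := mul_le_mul_of_nonneg_left n2 (norm_nonneg (F x))
    have n5 := mul_le_mul_of_nonneg_right n1 (norm_nonneg (H x))
    have am : ∀ K t : ℝ, K * t ≤ c / 4 + K ^ 2 / c * t ^ 2 := by
      intro K t
      have : c / 4 + K ^ 2 / c * t ^ 2 - K * t = (c / 2 - K * t) ^ 2 / c := by
        field_simp
        ring
      have := div_nonneg (sq_nonneg (c / 2 - K * t)) hc0.le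
      linarith
    have a1 := am K' ‖F x‖
    have a2 := am K ‖H x‖
    nlinarith [sq_nonneg (‖F x‖ - ‖H x‖), sq_nonneg (‖F x‖ - ‖H (x + 1)‖),
      sq_nonneg (‖F (x + 1)‖ - ‖H x‖), sq_nonneg ‖F (x + 1)‖, sq_nonneg ‖H (x + 1)‖]

/-- The boundary form is, up to sign, the boundary value at `0` of the Wronskian. -/
theorem IsRep.tendsto_wronskian (h : IsRep β α p F F₁) (h' : IsRep β α q H H₁) :
    Tendsto (fun x => F x * H₁ x - F₁ x * H x) (𝓝[>] 0) (𝓝 (-bform p q)) := by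
  have hw := integrable_bform p q
  set w : ℝ → ℂ := fun x => p.2 x * q.1 x - p.1 x * q.2 x with hwdef
  have hinf : F 1 * H₁ 1 - F₁ 1 * H 1 = -∫ x in Ioi (1 : ℝ), w x := by
    have h1 : IntegrableOn w (Ioi (1 : ℝ)) :=
      IntegrableOn.mono_set (s := Ioi (1 : ℝ)) hw (Ioi_subset_Ioi zero_le_one)
    have h2 := (intervalIntegral_tendsto_integral_Ioi 1 h1 tendsto_id).const_add
      (F 1 * H₁ 1 - F₁ 1 * H 1)
    have h3 := tendsto_nhds_unique (h2.congr' (by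
      filter_upwards [eventually_gt_atTop 0] with x hx
      rw [id, ← h.wronskian_sub h' one_pos hx]
      ring)) (h.tendsto_wronskian_atTop h')
    linear_combination h3
  have hIoc : IntegrableOn w (Ioc 0 1) := IntegrableOn.mono_set hw fun x hx => hx.1
  have hIcc : IntegrableOn w (uIcc 0 1) := by
    rw [uIcc_of_le zero_le_one]
    exact (integrableOn_Icc_iff_integrableOn_Ioc).mpr hIoc
  have hcont := intervalIntegral.continuousOn_primitive_interval_left hIcc
  have h0 : Tendsto (fun x => ∫ t in x..(1 : ℝ), w t) (𝓝[>] 0) (𝓝 (∫ t in (0 : ℝ)..1, w t)) := by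
    refine (hcont 0 (by simp)).mono_left ?_
    rw [uIcc_of_le zero_le_one, ← nhdsWithin_Ioo_eq_nhdsGT one_pos]
    exact nhdsWithin_mono _ Ioo_subset_Icc_self
  have hsplit : bform p q = (∫ t in (0 : ℝ)..1, w t) + ∫ x in Ioi (1 : ℝ), w x := by
    rw [bform, intervalIntegral.integral_of_le zero_le_one, ← setIntegral_union
      (Ioc_disjoint_Ioi le_rfl) measurableSet_Ioi hIoc
      (IntegrableOn.mono_set hw (Ioi_subset_Ioi zero_le_one)),
      Ioc_union_Ioi_eq_Ioi zero_le_one]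
  have e : -bform p q = (F 1 * H₁ 1 - F₁ 1 * H 1) - ∫ t in (0 : ℝ)..1, w t := by
    rw [hsplit, hinf]
    ring
  rw [e]
  refine (h0.const_sub (F 1 * H₁ 1 - F₁ 1 * H 1)).congr' ?_
  filter_upwards [self_mem_nhdsWithin] with x hx
  rw [← h.wronskian_sub h' hx one_pos]
  ring

/-- The Plücker relation for the boundary form: its rank is at most two. -/
theorem bform_pluecker {p q s t : L2 × L2} (hp : p ∈ maxGraph β α) (hq : q ∈ maxGraph β α)
    (hs : s ∈ maxGraph β α) (ht : t ∈ maxGraph β α) :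
    bform p q * bform s t - bform p s * bform q t + bform p t * bform q s = 0 := by
  obtain ⟨P, P₁, rp⟩ := exists_isRep hp
  obtain ⟨Q, Q₁, rq⟩ := exists_isRep hq
  obtain ⟨S, S₁, rs⟩ := exists_isRep hs
  obtain ⟨T, T₁, rt⟩ := exists_isRep ht
  have h := (((rp.tendsto_wronskian rq).mul (rs.tendsto_wronskian rt)).sub
    ((rp.tendsto_wronskian rs).mul (rq.tendsto_wronskian rt))).add
    ((rp.tendsto_wronskian rt).mul (rq.tendsto_wronskian rs))
  have h0 := tendsto_nhds_unique (h.congr (f₂ := fun _ => (0 : ℂ)) fun x => by ring)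
    tendsto_const_nhds
  linear_combination h0

theorem bform_swap (p q : L2 × L2) : bform q p = -bform p q := by
  rw [bform, bform, ← integral_neg]
  exact integral_congr_ae (Eventually.of_forall fun x => by simp only; ring)

theorem bform_self (p : L2 × L2) : bform p p = 0 := by
  rw [bform]
  refine integral_eq_zero_of_ae (Eventually.of_forall fun x => ?_)
  simp only [Pi.zero_apply]
  ring

theorem bform_eq_inner (p q : L2 × L2) :
    bform p q = inner ℂ (star q.1) p.2 - inner ℂ (star q.2) p.1 := by
  rw [bform, integral_sub (integrable_mul p.2 q.1) (integrable_mul p.1 q.2), ← bilin_eq_inner,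
    ← bilin_eq_inner]
  rfl

theorem bform_add_left (p q s : L2 × L2) : bform (p + q) s = bform p s + bform q s := by
  simp only [bform_eq_inner, Prod.fst_add, Prod.snd_add, inner_add_right]
  ring

theorem bform_smul_left (c : ℂ) (p s : L2 × L2) : bform (c • p) s = c * bform p s := by
  simp only [bform_eq_inner, Prod.smul_fst, Prod.smul_snd, inner_smul_right]
  ring

/-- The graph of the maximal operator consists of the elements annihilating all test functions in the
boundary form. -/
theorem mem_maxGraph_iff : p ∈ maxGraph β α ↔ ∀ q ∈ testGraph β α, bform p q = 0 := by
  constructor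
  · rintro hp q ⟨φ, hφ, h1, h2⟩
    have h := hp φ hφ
    rw [bform, integral_sub (integrable_mul p.2 q.1) (integrable_mul p.1 q.2)]
    have e1 : ∫ x, p.1 x * q.2 x ∂halfLine = ∫ x, p.1 x * formalOp β α φ x ∂halfLine :=
      integral_congr_ae (by filter_upwards [h2] with x hx; rw [hx])
    have e2 : ∫ x, p.2 x * q.1 x ∂halfLine = ∫ x, p.2 x * φ x ∂halfLine :=
      integral_congr_ae (by filter_upwards [h1] with x hx; rw [hx])
    rw [e1, e2, h, sub_self]
  · intro h φ hφ
    have hq := h (hφ.toL2, (hφ.formalOp β α).toL2)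
      ⟨φ, hφ, hφ.coeFn_toL2, (hφ.formalOp β α).coeFn_toL2⟩
    rw [bform, integral_sub (integrable_mul p.2 _) (integrable_mul p.1 _), sub_eq_zero] at hq
    have e1 : ∫ x, p.1 x * (hφ.formalOp β α).toL2 x ∂halfLine =
        ∫ x, p.1 x * formalOp β α φ x ∂halfLine :=
      integral_congr_ae (by
        filter_upwards [(hφ.formalOp β α).coeFn_toL2] with x hx; rw [hx])
    have e2 : ∫ x, p.2 x * hφ.toL2 x ∂halfLine = ∫ x, p.2 x * φ x ∂halfLine :=
      integral_congr_ae (by filter_upwards [hφ.coeFn_toL2] with x hx; rw [hx])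
    rw [← e1, ← e2]
    exact hq.symm

/-- The graph of the minimal operator. -/
noncomputable def minGraph (β α : ℂ) : Submodule ℂ (L2 × L2) :=
  (testGraph β α).topologicalClosure

theorem minGraph_le_maxGraph (β α : ℂ) : minGraph β α ≤ maxGraph β α :=
  Submodule.topologicalClosure_minimal _ (testGraph_le_maxGraph β α) (isClosed_maxGraph β α)

/-- The graph of the minimal operator is the radical of the boundary form on the graph of the
maximal operator. -/
theorem mem_minGraph_iff :
    p ∈ minGraph β α ↔ p ∈ maxGraph β α ∧ ∀ q ∈ maxGraph β α, bform p q = 0 := by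
  constructor
  · intro hp
    refine ⟨minGraph_le_maxGraph β α hp, fun q hq => ?_⟩
    have hcl : IsClosed {p : L2 × L2 | bform p q = 0} := by
      simp only [bform_eq_inner]
      exact isClosed_eq (by fun_prop) continuous_const
    refine closure_minimal (s := (testGraph β α : Set (L2 × L2))) (fun s hs => ?_) hcl hp
    rw [mem_ofPred_eq, bform_swap, mem_maxGraph_iff.mp hq s hs, neg_zero]
  · rintro ⟨-, hp⟩
    -- an element `w` orthogonal to the graph of test functions gives, after a twist, an element of
    -- the graph of the maximal operator, so `p` is orthogonal to `w`
    set e := WithLp.prodContinuousLinearEquiv 2 ℂ L2 L2 with he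
    set S : Submodule ℂ (WithLp 2 (L2 × L2)) :=
      (testGraph β α).comap (e : WithLp 2 (L2 × L2) →ₗ[ℂ] L2 × L2) with hS
    have hmem : e.symm p ∈ Sᗮᗮ := by
      rw [Submodule.mem_orthogonal]
      intro w hw
      have hq : (star (e w).2, star (-(e w).1)) ∈ maxGraph β α := by
        rw [mem_maxGraph_iff]
        intro s hs
        have h1 := (Submodule.mem_orthogonal' _ _).mp hw (e.symm s) (by simpa [hS] using hs)
        rw [WithLp.prod_inner_apply] at h1
        rw [bform_swap, bform_eq_inner]
        simp only [star_star, inner_neg_left, sub_neg_eq_add, neg_eq_zero]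
        rw [add_comm]
        exact h1
      have h2 := hp _ hq
      rw [bform_eq_inner] at h2
      simp only [star_star, inner_neg_left, sub_neg_eq_add] at h2
      rw [WithLp.prod_inner_apply, ← h2, add_comm]
      rfl
    rw [Submodule.orthogonal_orthogonal_eq_closure, ← SetLike.mem_coe,
      Submodule.topologicalClosure_coe] at hmem
    have := map_mem_closure e.continuous hmem (t := (testGraph β α : Set (L2 × L2)))
      fun x hx => hx
    rw [minGraph, ← SetLike.mem_coe, Submodule.topologicalClosure_coe]
    simpa using this

end

section

variable {β α : ℂ} {p q : L2 × L2} {F F₁ H H₁ : ℝ → ℂ}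

/-! ### Functions in the minimal domain near zero -/

/-- A square-integrable function is not bounded below by a multiple of `x^{-1/2}` near `0`. -/
theorem frequently_lt_div {g : ℝ → ℝ} (hg : Integrable g halfLine) {c : ℝ} (hc : 0 < c) :
    ∃ᶠ x in 𝓝[>] (0 : ℝ), g x < c / x := by
  intro h
  obtain ⟨ε, hε, hs⟩ := mem_nhdsGT_iff_exists_Ioo_subset.mp h
  have hε : 0 < ε := hε
  have h1 : IntegrableOn g (Ioo 0 ε) := IntegrableOn.mono_set hg fun x hx => hx.1
  have h2 : IntegrableOn (fun x : ℝ => c * x⁻¹) (Ioo 0 ε) := by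
    refine Integrable.mono' h1 (by fun_prop) ?_
    filter_upwards [ae_restrict_mem measurableSet_Ioo] with x hx
    have h3 := hs hx
    simp only [mem_ofPred_eq, not_lt] at h3
    rw [Real.norm_of_nonneg (mul_nonneg hc.le (inv_nonneg.mpr hx.1.le)), ← div_eq_mul_inv]
    exact h3
  have h4 : IntegrableOn (fun x : ℝ => x⁻¹) (Ioo 0 ε) := by
    refine (Integrable.const_mul h2 c⁻¹).congr (Eventually.of_forall fun x => ?_)
    simp only
    rw [← mul_assoc, inv_mul_cancel₀ hc.ne', one_mul]
  have h5 : IntervalIntegrable (fun x : ℝ => x⁻¹) volume 0 ε := by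
    rw [intervalIntegrable_iff_integrableOn_Ioo_of_le hε.le]
    exact h4
  rw [intervalIntegrable_inv_iff] at h5
  rcases h5 with h5 | h5
  · exact hε.ne h5
  · exact h5 (by simp)

theorem tendsto_integral_zero {g : ℝ → ℝ} (hg : Integrable g halfLine) :
    Tendsto (fun x => ∫ t in (0 : ℝ)..x, g t) (𝓝[>] 0) (𝓝 0) := by
  have hIoc : IntegrableOn g (Ioc 0 1) := IntegrableOn.mono_set hg fun x hx => hx.1
  have hIcc : IntegrableOn g (uIcc 0 1) := by
    rw [uIcc_of_le zero_le_one]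
    exact (integrableOn_Icc_iff_integrableOn_Ioc).mpr hIoc
  have hcont := intervalIntegral.continuousOn_primitive_interval hIcc
  have h := hcont 0 (by simp)
  rw [ContinuousWithinAt, intervalIntegral.integral_same] at h
  refine h.mono_left ?_
  rw [uIcc_of_le zero_le_one, ← nhdsWithin_Ioo_eq_nhdsGT one_pos]
  exact nhdsWithin_mono _ Ioo_subset_Icc_self

theorem intervalIntegrable_norm_of_memLp {g : ℝ → ℂ} (hg : MemLp g 2 halfLine) {x : ℝ}
    (hx : 0 ≤ x) : IntervalIntegrable (fun t => ‖g t‖) volume 0 x := by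
  rw [intervalIntegrable_iff_integrableOn_Ioc_of_le hx]
  have h1 : MemLp g 2 (volume.restrict (Ioc 0 x)) :=
    hg.mono_measure (Measure.restrict_mono (fun t ht => ht.1) le_rfl)
  exact (h1.integrable (by norm_num)).norm

/-- The Cauchy–Schwarz bound `∫₀ˣ |g| = o(x^{1/2})` for a square-integrable function. -/
theorem eventually_integral_norm_le {g : ℝ → ℂ} (hg : MemLp g 2 halfLine) {δ : ℝ} (hδ : 0 < δ) :
    ∀ᶠ x in 𝓝[>] (0 : ℝ), ∫ t in (0 : ℝ)..x, ‖g t‖ ≤ δ * √x := by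
  have hsq : Integrable (fun x => ‖g x‖ ^ 2) halfLine :=
    (memLp_two_iff_integrable_sq_norm hg.1).mp hg
  have hev := (tendsto_integral_zero hsq).eventually_le_const (sq_pos_of_pos hδ)
  filter_upwards [hev, self_mem_nhdsWithin] with x hx hx0
  have hx0 : 0 < x := hx0
  have hs : 0 < √x := Real.sqrt_pos.mpr hx0
  have hsi : IntervalIntegrable (fun t => ‖g t‖ ^ 2) volume 0 x := by
    rw [intervalIntegrable_iff_integrableOn_Ioc_of_le hx0.le]
    exact IntegrableOn.mono_set hsq fun x hx => hx.1
  calc ∫ t in (0 : ℝ)..x, ‖g t‖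
      ≤ ∫ t in (0 : ℝ)..x, (δ / (2 * √x) + √x / (2 * δ) * ‖g t‖ ^ 2) := by
        refine intervalIntegral.integral_mono_on hx0.le
          (intervalIntegrable_norm_of_memLp hg hx0.le)
          (intervalIntegrable_const.add (hsi.const_mul _)) fun t _ => ?_
        have : δ / (2 * √x) + √x / (2 * δ) * ‖g t‖ ^ 2 - ‖g t‖ =
            (δ - √x * ‖g t‖) ^ 2 / (2 * δ * √x) := by
          field_simp
          ring
        have h2 : 0 ≤ (δ - √x * ‖g t‖) ^ 2 / (2 * δ * √x) := by positivity
        linarith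
    _ = δ * √x / 2 + √x / (2 * δ) * ∫ t in (0 : ℝ)..x, ‖g t‖ ^ 2 := by
        rw [intervalIntegral.integral_add intervalIntegrable_const (hsi.const_mul _),
          intervalIntegral.integral_const, intervalIntegral.integral_const_mul, smul_eq_mul]
        congr 1
        have : x = √x * √x := (Real.mul_self_sqrt hx0.le).symm
        field_simp
        nlinarith
    _ ≤ δ * √x / 2 + √x / (2 * δ) * δ ^ 2 := by gcongr
    _ = δ * √x := by
        field_simp
        ring

theorem IsRep.memLp (h : IsRep β α p F F₁) : MemLp F 2 halfLine :=
  (memLp_congr_ae h.ae_eq).mp (Lp.memLp p.1)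

/-- An element of the graph of the maximal operator whose first component vanishes near `0`
belongs to the graph of the minimal operator. -/
theorem mem_minGraph_of_eventually_eq_zero (hp : p ∈ maxGraph β α) {ε : ℝ} (hε : 0 < ε)
    (h0 : ∀ᵐ x ∂halfLine, x < ε → p.1 x = 0) : p ∈ minGraph β α := by
  rw [mem_minGraph_iff]
  refine ⟨hp, fun q hq => ?_⟩
  obtain ⟨F, F₁, h⟩ := exists_isRep hp
  obtain ⟨H, H₁, h'⟩ := exists_isRep hq
  have hz : ∀ x ∈ Ioo 0 ε, F x = 0 := by
    have h1 : F =ᵐ[volume.restrict (Ioo 0 ε)] fun _ => 0 := by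
      rw [EventuallyEq, ae_restrict_iff' measurableSet_Ioo]
      filter_upwards [(ae_restrict_iff' measurableSet_Ioi).mp h0,
        (ae_restrict_iff' measurableSet_Ioi).mp h.ae_eq] with x hx hx' hxε
      rw [← hx' hxε.1, hx hxε.1 hxε.2]
    exact Measure.eqOn_of_ae_eq h1 (h.continuousOn.mono fun x hx => hx.1) continuousOn_const
      (by rw [interior_Ioo]; exact subset_closure)
  have hz' : ∀ x ∈ Ioo 0 ε, F₁ x = 0 := by
    intro x hx
    have h1 : HasDerivAt F 0 x := (hasDerivAt_const x (0 : ℂ)).congr_of_eventuallyEq (by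
      filter_upwards [Ioo_mem_nhds hx.1 hx.2] with y hy using hz y hy)
    exact (h.hasDerivAt x hx.1).unique h1
  have h2 := (h.tendsto_wronskian h').congr' (f₂ := fun _ => (0 : ℂ)) (by
    filter_upwards [Ioo_mem_nhdsGT hε] with x hx
    rw [hz x hx, hz' x hx]
    ring)
  exact neg_eq_zero.mp (tendsto_nhds_unique h2 tendsto_const_nhds)

/-- Decay of order `x^{3/2}` at `0`, together with decay of order `x^{1/2}` of the derivative, puts
an element of the maximal domain into the minimal domain. -/
theorem mem_minGraph_of_isBigO (hq : q ∈ maxGraph β α) (h' : IsRep β α q H H₁) {C : ℝ}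
    (h1 : ∀ᶠ x in 𝓝[>] (0 : ℝ), ‖H x‖ ≤ C * (x * √x))
    (h2 : ∀ᶠ x in 𝓝[>] (0 : ℝ), ‖H₁ x‖ ≤ C * √x) : q ∈ minGraph β α := by
  rw [mem_minGraph_iff]
  refine ⟨hq, fun p hp => ?_⟩
  obtain ⟨F, F₁, h⟩ := exists_isRep hp
  rw [bform_swap, neg_eq_zero]
  by_contra hne
  set ℓ := -bform p q with hℓ
  have hℓ0 : 0 < ‖ℓ‖ := by rw [hℓ, norm_neg]; exact norm_pos_iff.mpr hne
  have hC : 0 ≤ C := by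
    obtain ⟨x, hx, hx0⟩ := (h2.and self_mem_nhdsWithin).exists
    have hs : 0 < √x := Real.sqrt_pos.mpr hx0
    by_contra hneg
    nlinarith [norm_nonneg (H₁ x)]
  -- with this `δ`, the bound `2 C √x ∫₀ˣ |F| ≤ 2 C δ x` is at most `|ℓ| x / 4`
  set δ : ℝ := ‖ℓ‖ / (8 * (C + 1)) with hδ
  have hδ0 : 0 < δ := by positivity
  have hW : ∀ᶠ x in 𝓝[>] (0 : ℝ), ‖F x * H₁ x - F₁ x * H x - ℓ‖ ≤ ‖ℓ‖ / 4 := by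
    have := ((h.tendsto_wronskian h').sub_const ℓ).norm
    rw [sub_self, norm_zero] at this
    exact this.eventually_le_const (by positivity)
  obtain ⟨ε, hε, hs⟩ := mem_nhdsGT_iff_exists_Ioo_subset.mp
    (h1.and (h2.and (hW.and (eventually_integral_norm_le h.memLp hδ0))))
  have hε : 0 < ε := hε
  -- the function `F H` has derivative `2 F H₁ - W`, where the Wronskian `W` tends to `ℓ`
  have hE : ∀ a b, 0 < a → a < b → b < ε →
      ‖(F b * H b - F a * H a) + ℓ * ((b - a : ℝ) : ℂ)‖ ≤ ‖ℓ‖ * b / 2 := by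
    intro a b ha hab hb
    have hb0 := ha.trans hab
    have hsub := uIcc_subset_Ioi ha hb0
    have c0 := h.continuousOn.mono hsub
    have c1 := h.continuousOn_deriv.mono hsub
    have c2 := h'.continuousOn.mono hsub
    have c3 := h'.continuousOn_deriv.mono hsub
    have hd : ∀ x ∈ uIcc a b, HasDerivAt (fun x => F x * H x + ℓ * (x : ℂ))
        (F₁ x * H x + F x * H₁ x + ℓ) x := by
      intro x hx
      have hxc : HasDerivAt (fun x : ℝ => ℓ * (x : ℂ)) ℓ x := by
        simpa using (Complex.ofRealCLM.hasDerivAt (x := x)).const_mul ℓ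
      exact ((h.hasDerivAt x (hsub hx)).mul (h'.hasDerivAt x (hsub hx))).add hxc
    have hint := intervalIntegral.integral_eq_sub_of_hasDerivAt hd
      (((c1.mul c2).add (c0.mul c3)).add continuousOn_const).intervalIntegrable
    have e : (F b * H b - F a * H a) + ℓ * ((b - a : ℝ) : ℂ) =
        ∫ x in a..b, (F₁ x * H x + F x * H₁ x + ℓ) := by
      rw [hint]
      push_cast
      ring
    have hni := intervalIntegrable_norm_of_memLp h.memLp hb0.le
    have hni' : IntervalIntegrable (fun t => ‖F t‖) volume a b :=
      c0.norm.intervalIntegrable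
    rw [e]
    have hsb : 0 < √b := Real.sqrt_pos.mpr hb0
    calc ‖∫ x in a..b, (F₁ x * H x + F x * H₁ x + ℓ)‖
        ≤ ∫ x in a..b, (‖ℓ‖ / 4 + 2 * C * √b * ‖F x‖) := by
          refine intervalIntegral.norm_integral_le_of_norm_le hab.le
            (Eventually.of_forall fun x hx => ?_)
            (intervalIntegrable_const.add (hni'.const_mul _))
          obtain ⟨-, g2, g3, -⟩ := hs (⟨ha.trans hx.1, hx.2.trans_lt hb⟩ : x ∈ Ioo 0 ε)
          have e2 : F₁ x * H x + F x * H₁ x + ℓ =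
              -(F x * H₁ x - F₁ x * H x - ℓ) + 2 * (F x * H₁ x) := by ring
          have hsx : √x ≤ √b := Real.sqrt_le_sqrt hx.2
          rw [e2]
          refine (norm_add_le _ _).trans ?_
          rw [norm_neg, norm_mul, norm_mul, Complex.norm_two]
          refine add_le_add g3 ?_
          have : ‖H₁ x‖ ≤ C * √b := g2.trans (mul_le_mul_of_nonneg_left hsx hC)
          nlinarith [mul_le_mul_of_nonneg_left this (norm_nonneg (F x))]
      _ = ‖ℓ‖ / 4 * (b - a) + 2 * C * √b * ∫ x in a..b, ‖F x‖ := by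
          rw [intervalIntegral.integral_add intervalIntegrable_const (hni'.const_mul _),
            intervalIntegral.integral_const, intervalIntegral.integral_const_mul, smul_eq_mul]
          ring
      _ ≤ ‖ℓ‖ / 4 * b + 2 * C * √b * (δ * √b) := by
          have hle : ∫ x in a..b, ‖F x‖ ≤ δ * √b :=
            (intervalIntegral.integral_mono_interval ha.le hab.le le_rfl
              (Eventually.of_forall fun x => norm_nonneg _) hni).trans
              (hs (⟨hb0, hb⟩ : b ∈ Ioo 0 ε)).2.2.2
          gcongr
          linarith
      _ ≤ ‖ℓ‖ * b / 2 := by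
          have e3 : 2 * C * √b * (δ * √b) = 2 * C * δ * b := by
            rw [show 2 * C * √b * (δ * √b) = 2 * C * δ * (√b * √b) by ring,
              Real.mul_self_sqrt hb0.le]
          have e4 : 8 * ((C + 1) * δ) = ‖ℓ‖ := by
            rw [hδ]
            field_simp
          rw [e3]
          nlinarith [mul_nonneg hδ0.le hb0.le]
  -- hence `|F H| ≥ |ℓ| x / 4` near `0`, so that `|F| ≥ c x^{-1/2}`
  have hlow : ∀ b ∈ Ioo 0 ε, ‖ℓ‖ * b / 4 ≤ ‖F b * H b‖ := by
    intro b hb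
    have hb0 : 0 < b := hb.1
    -- let `a → 0` along points where `|F a| < a^{-1/2}`, so that `F a * H a = O(a)`
    set η : ℝ := min (b / 8) (‖ℓ‖ * b / (8 * (C + 1))) with hη
    have hη0 : 0 < η := lt_min (by linarith) (by positivity)
    obtain ⟨a, ha1, ha2⟩ := ((frequently_lt_div h.integrable_norm_sq one_pos).and_eventually
      (Ioo_mem_nhdsGT hη0)).exists
    have ha0 : 0 < a := ha2.1
    have ha8 : a < b / 8 := ha2.2.trans_le (min_le_left _ _)
    have haC : a < ‖ℓ‖ * b / (8 * (C + 1)) := ha2.2.trans_le (min_le_right _ _)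
    have hab : a < b := by linarith
    obtain ⟨g1, -, -, -⟩ := hs (⟨ha0, hab.trans hb.2⟩ : a ∈ Ioo 0 ε)
    have hFa : √a * ‖F a‖ ≤ 1 := by
      refine le_of_sq_le_sq ?_ zero_le_one
      rw [mul_pow, Real.sq_sqrt ha0.le, one_pow]
      rw [lt_div_iff₀ ha0] at ha1
      linarith
    have hEa : ‖F a * H a‖ ≤ ‖ℓ‖ * b / 8 := by
      rw [norm_mul]
      have k1 := mul_le_mul_of_nonneg_left g1 (norm_nonneg (F a))
      have k2 : ‖F a‖ * (C * (a * √a)) = C * a * (√a * ‖F a‖) := by ring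
      have k3 : C * a * (√a * ‖F a‖) ≤ C * a * 1 :=
        mul_le_mul_of_nonneg_left hFa (by positivity)
      rw [lt_div_iff₀ (by positivity)] at haC
      nlinarith
    have hab' := hE a b ha0 hab hb.2
    have k4 : ‖ℓ * ((b - a : ℝ) : ℂ)‖ = ‖ℓ‖ * (b - a) := by
      rw [norm_mul, Complex.norm_real, Real.norm_of_nonneg (by linarith)]
    have k5 : ‖ℓ * ((b - a : ℝ) : ℂ)‖ ≤
        ‖(F b * H b - F a * H a) + ℓ * ((b - a : ℝ) : ℂ)‖ + (‖F b * H b‖ + ‖F a * H a‖) := by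
      have e : ℓ * ((b - a : ℝ) : ℂ) = ((F b * H b - F a * H a) + ℓ * ((b - a : ℝ) : ℂ)) -
          (F b * H b - F a * H a) := by ring
      calc ‖ℓ * ((b - a : ℝ) : ℂ)‖
          = ‖((F b * H b - F a * H a) + ℓ * ((b - a : ℝ) : ℂ)) -
              (F b * H b - F a * H a)‖ := by rw [← e]
        _ ≤ _ := (norm_sub_le _ _).trans (by gcongr; exact norm_sub_le _ _)
    rw [k4] at k5
    nlinarith
  obtain ⟨b, hb1, hb2⟩ := ((frequently_lt_div h.integrable_norm_sq
    (c := (‖ℓ‖ / (4 * (C + 1))) ^ 2) (by positivity)).and_eventually (Ioo_mem_nhdsGT hε)).exists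
  have hb0 : 0 < b := hb2.1
  have k1 := hlow b hb2
  obtain ⟨g1, -, -, -⟩ := hs hb2
  rw [lt_div_iff₀ hb0] at hb1
  have k2 : ‖F b‖ * √b < ‖ℓ‖ / (4 * (C + 1)) := by
    refine lt_of_pow_lt_pow_left₀ 2 (by positivity) ?_
    rwa [mul_pow, Real.sq_sqrt hb0.le]
  rw [lt_div_iff₀ (by positivity)] at k2
  rw [norm_mul] at k1
  have k3 : ‖F b‖ * ‖H b‖ ≤ ‖F b‖ * √b * (C + 1) * b := by
    have := mul_le_mul_of_nonneg_left g1 (norm_nonneg (F b))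
    nlinarith [mul_nonneg (mul_nonneg (norm_nonneg (F b)) (Real.sqrt_nonneg b)) hb0.le]
  nlinarith

end

section

variable {β α : ℂ} {p q : L2 × L2} {F F₁ H H₁ : ℝ → ℂ}

/-! ### Elements of the maximal domain given by smooth functions -/

theorem formalOp_eq {w w₁ w₂ : ℝ → ℂ} (h1 : ∀ x, 0 < x → HasDerivAt w (w₁ x) x)
    (h2 : ∀ x, 0 < x → HasDerivAt w₁ (w₂ x) x) {x : ℝ} (hx : 0 < x) :
    formalOp β α w x = -w₂ x + pot β α x * w x := by
  have e : deriv w =ᶠ[𝓝 x] w₁ := by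
    filter_upwards [Ioi_mem_nhds hx] with y hy using (h1 y hy).deriv
  rw [formalOp, e.deriv_eq, (h2 x hx).deriv, pot]

theorem contDiffOn_deriv_Ioi {w : ℝ → ℂ} (hw : ContDiffOn ℝ ∞ w (Ioi 0)) :
    ContDiffOn ℝ ∞ (deriv w) (Ioi 0) :=
  ((contDiffOn_infty_iff_deriv_of_isOpen isOpen_Ioi).mp hw).2

theorem hasDerivAt_of_contDiffOn_Ioi {w : ℝ → ℂ} (hw : ContDiffOn ℝ ∞ w (Ioi 0)) {x : ℝ}
    (hx : 0 < x) : HasDerivAt w (deriv w x) x :=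
  ((hw.contDiffAt (Ioi_mem_nhds hx)).differentiableAt (by simp)).hasDerivAt

/-- For a function that is smooth on the open half-line, the distributional and the classical
action of the Whittaker operator agree. -/
theorem mem_maxGraph_of_contDiffOn {w : ℝ → ℂ} (hw : ContDiffOn ℝ ∞ w (Ioi 0))
    (h1 : p.1 =ᵐ[halfLine] w) (h2 : p.2 =ᵐ[halfLine] formalOp β α w) :
    p ∈ maxGraph β α ∧ IsRep β α p w (deriv w) := by
  have hw' := contDiffOn_deriv_Ioi hw
  have hw'' := contDiffOn_deriv_Ioi hw'
  refine ⟨fun φ hφ => ?_, h1, fun x hx => hasDerivAt_of_contDiffOn_Ioi hw hx, fun x hx => ?_⟩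
  · have hχ : IsTestFun (fun x => deriv w x * φ x + -1 * (w x * deriv φ x)) :=
      (hφ.mul_contDiffOn hw').add ((hφ.deriv.mul_contDiffOn hw).const_mul (-1))
    rw [← sub_eq_zero, ← integral_sub ((hφ.formalOp β α).integrable_mul p.1)
      (hφ.integrable_mul p.2), ← hχ.integral_deriv]
    refine integral_congr_ae ?_
    filter_upwards [h1, h2, ae_restrict_mem measurableSet_Ioi] with x hx1 hx2 hx
    have hd := ((hasDerivAt_of_contDiffOn_Ioi hw' hx).mul (hφ.hasDerivAt x)).add
      (((hasDerivAt_of_contDiffOn_Ioi hw hx).mul (hφ.deriv.hasDerivAt x)).const_mul (-1))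
    have hd' := hd.deriv
    rw [hx1, hx2]
    refine Eq.trans ?_ hd'.symm
    simp only [formalOp]
    ring
  · have hs := uIcc_subset_Ioi one_pos hx
    have e : ∫ t in (1 : ℝ)..x, (pot β α t * w t - p.2 t) =
        ∫ t in (1 : ℝ)..x, deriv (deriv w) t := by
      refine intervalIntegral.integral_congr_ae ?_
      filter_upwards [(ae_restrict_iff' measurableSet_Ioi).mp h2] with t ht ht'
      rw [ht (hs (uIoc_subset_uIcc ht'))]
      simp only [formalOp, pot]
      ring
    rw [e, intervalIntegral.integral_eq_sub_of_hasDerivAt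
      (fun y hy => hasDerivAt_of_contDiffOn_Ioi hw' (hs hy))
      ((hw''.continuousOn.mono hs).intervalIntegrable)]
    ring

/-- A bump function: `1` on `[-1/2, 1/2]` and `0` outside `]-1, 1[`. -/
noncomputable def bump : ContDiffBump (0 : ℝ) := ⟨1 / 2, 1, by norm_num, by norm_num⟩

/-- A fixed real-valued cutoff, equal to `1` on `]0, 1/2]` and to `0` on `[1, ∞[`. -/
noncomputable def cutoff (x : ℝ) : ℂ := (bump x : ℂ)

theorem isCutoff_cutoff : IsCutoff cutoff := by
  refine ⟨Complex.ofRealCLM.contDiff.comp bump.contDiff,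
    bump.hasCompactSupport.comp_left (g := fun r : ℝ => (r : ℂ)) Complex.ofReal_zero, ?_⟩
  filter_upwards [nhdsWithin_le_nhds bump.eventuallyEq_one] with x hx
  simp [cutoff, hx]

theorem cutoff_eq_one {x : ℝ} (h0 : 0 < x) (hx : x ≤ 1 / 2) : cutoff x = 1 := by
  have : bump x = 1 := bump.one_of_mem_closedBall (by
    rw [Metric.mem_closedBall, Real.dist_eq, sub_zero, abs_of_pos h0]
    exact hx)
  simp [cutoff, this]

theorem cutoff_eq_zero {x : ℝ} (hx : 1 ≤ x) : cutoff x = 0 := by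
  have : bump x = 0 := bump.zero_of_le_dist (by
    rw [Real.dist_eq, sub_zero, abs_of_pos (by linarith)]
    exact hx)
  simp [cutoff, this]

theorem norm_cutoff_le (x : ℝ) : ‖cutoff x‖ ≤ 1 := by
  rw [cutoff, Complex.norm_real, Real.norm_of_nonneg bump.nonneg]
  exact bump.le_one

theorem conj_cutoff (x : ℝ) : conj (cutoff x) = cutoff x := Complex.conj_ofReal _

theorem memLp_cutoff_mul {w : ℝ → ℂ} (hw : ContinuousOn w (Ioi 0)) {C s : ℝ} (hs : -1 / 2 < s)
    (h : ∀ x ∈ Ioo (0 : ℝ) 1, ‖w x‖ ≤ C * x ^ s) :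
    MemLp (fun x => cutoff x * w x) 2 halfLine := by
  have hm : AEStronglyMeasurable (fun x => cutoff x * w x) halfLine :=
    (isCutoff_cutoff.smooth.continuous.continuousOn.mul hw).aestronglyMeasurable measurableSet_Ioi
  rw [memLp_two_iff_integrable_sq_norm hm]
  have hi : IntegrableOn (fun x : ℝ => C ^ 2 * x ^ (2 * s)) (Ioc 0 1) :=
    ((intervalIntegral.intervalIntegrable_rpow' (by linarith)).const_mul _).1
  have h1 : IntegrableOn (fun x => ‖cutoff x * w x‖ ^ 2) (Ioc 0 1) := by
    refine Integrable.mono' hi ((hm.mono_measure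
      (Measure.restrict_mono (fun t ht => ht.1) le_rfl)).norm.pow 2) ?_
    filter_upwards [ae_restrict_mem measurableSet_Ioc] with x hx
    rw [Real.norm_of_nonneg (by positivity)]
    rcases hx.2.lt_or_eq with hx1 | hx1
    · have h2 := h x ⟨hx.1, hx1⟩
      have h3 : ‖cutoff x * w x‖ ≤ C * x ^ s := by
        rw [norm_mul]
        nlinarith [norm_cutoff_le x, norm_nonneg (w x)]
      calc ‖cutoff x * w x‖ ^ 2 ≤ (C * x ^ s) ^ 2 := by gcongr
        _ = C ^ 2 * x ^ (2 * s) := by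
          rw [mul_pow, mul_comm 2 s, Real.rpow_mul hx.1.le, Real.rpow_two]
    · rw [cutoff_eq_zero hx1.ge]
      simp only [zero_mul, norm_zero]
      have : (0 : ℝ) ≤ x ^ (2 * s) := Real.rpow_nonneg hx.1.le _
      nlinarith [mul_nonneg (sq_nonneg C) this]
  refine IntegrableOn.of_forall_sdiff_eq_zero h1 measurableSet_Ioi fun x hx => ?_
  rw [cutoff_eq_zero (not_lt.mp fun h => hx.2 ⟨hx.1, h.le⟩)]
  simp

/-- A smooth function `w` on the open half-line such that `w` and `L w` are `O(x^s)` near `0`, with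
`s > -1/2`, belongs to the maximal domain after multiplication by the cutoff. -/
theorem exists_mem_maxGraph {w w₁ w₂ : ℝ → ℂ} (hw : ContDiffOn ℝ ∞ w (Ioi 0))
    (h1 : ∀ x, 0 < x → HasDerivAt w (w₁ x) x) (h2 : ∀ x, 0 < x → HasDerivAt w₁ (w₂ x) x)
    {C D s : ℝ} (hs : -1 / 2 < s) (hC : ∀ x ∈ Ioo (0 : ℝ) 1, ‖w x‖ ≤ C * x ^ s)
    (hD : ∀ x ∈ Ioo (0 : ℝ) 1, ‖-w₂ x + pot β α x * w x‖ ≤ D * x ^ s) :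
    ∃ p ∈ maxGraph β α, ∃ F₁, IsRep β α p (fun x => cutoff x * w x) F₁ ∧
      (∀ x ∈ Ioo (0 : ℝ) (1 / 2), F₁ x = w₁ x) ∧
      ∀ᵐ x ∂halfLine, x < 1 / 2 → p.2 x = -w₂ x + pot β α x * w x := by
  have hζ := isCutoff_cutoff
  have hζw : ContDiffOn ℝ ∞ (fun x => cutoff x * w x) (Ioi 0) := hζ.smooth.contDiffOn.mul hw
  have hw' : ContDiffOn ℝ ∞ (deriv w) (Ioi 0) := contDiffOn_deriv_Ioi hw
  have hLw : ContDiffOn ℝ ∞ (formalOp β α w) (Ioi 0) :=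
    (contDiffOn_deriv_Ioi hw').neg.add ((contDiffOn_potential β α).mul hw)
  obtain ⟨χ, hχ, hχζ⟩ := hζ.exists_deriv
  have hη : IsTestFun (fun x => -2 * (deriv w x * χ x) + -1 * (w x * deriv χ x)) :=
    ((hχ.mul_contDiffOn hw').const_mul (-2)).add ((hχ.deriv.mul_contDiffOn hw).const_mul (-1))
  have hform : ∀ x, 0 < x → formalOp β α (fun x => cutoff x * w x) x =
      cutoff x * formalOp β α w x + (-2 * (deriv w x * χ x) + -1 * (w x * deriv χ x)) := by
    intro x hx
    have hz : ∀ x, HasDerivAt cutoff (deriv cutoff x) x := fun x =>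
      (hζ.smooth.differentiable (by simp)).differentiableAt.hasDerivAt
    have d1 : ∀ y, 0 < y → HasDerivAt (fun x => cutoff x * w x)
        (χ y * w y + cutoff y * deriv w y) y := fun y hy => by
      rw [← hχζ y hy]
      exact (hz y).mul (hasDerivAt_of_contDiffOn_Ioi hw hy)
    have d2 : ∀ y, 0 < y → HasDerivAt (fun y => χ y * w y + cutoff y * deriv w y)
        ((deriv χ y * w y + χ y * deriv w y) + (χ y * deriv w y +
          cutoff y * deriv (deriv w) y)) y := fun y hy => by
      nth_rw 2 [← hχζ y hy]
      exact ((hχ.hasDerivAt y).mul (hasDerivAt_of_contDiffOn_Ioi hw hy)).add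
        ((hz y).mul (hasDerivAt_of_contDiffOn_Ioi hw' hy))
    rw [formalOp_eq d1 d2 hx]
    simp only [formalOp, pot]
    ring
  have m1 : MemLp (fun x => cutoff x * w x) 2 halfLine := memLp_cutoff_mul hw.continuousOn hs hC
  have m2 : MemLp (formalOp β α (fun x => cutoff x * w x)) 2 halfLine := by
    have m3 : MemLp (fun x => cutoff x * formalOp β α w x) 2 halfLine :=
      memLp_cutoff_mul hLw.continuousOn hs fun x hx => by
        rw [formalOp_eq h1 h2 hx.1]
        exact hD x hx
    refine (memLp_congr_ae ?_).mpr (m3.add hη.memLp)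
    filter_upwards [ae_restrict_mem measurableSet_Ioi] with x hx using hform x hx
  obtain ⟨hp, hr⟩ := mem_maxGraph_of_contDiffOn (p := (m1.toLp _, m2.toLp _)) hζw
    m1.coeFn_toLp m2.coeFn_toLp
  have hloc : ∀ x ∈ Ioo (0 : ℝ) (1 / 2), (fun x => cutoff x * w x) =ᶠ[𝓝 x] w := by
    intro x hx
    filter_upwards [Ioo_mem_nhds hx.1 hx.2] with y hy
    rw [cutoff_eq_one hy.1 hy.2.le, one_mul]
  refine ⟨_, hp, _, hr, fun x hx => ?_, ?_⟩
  · rw [(hloc x hx).deriv_eq, (h1 x hx.1).deriv]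
  · filter_upwards [m2.coeFn_toLp, ae_restrict_mem measurableSet_Ioi] with x hx hx0 hxh
    rw [hx, ← formalOp_eq h1 h2 hx0, formalOp, formalOp, (hloc x ⟨hx0, hxh⟩).deriv.deriv_eq,
      (hloc x ⟨hx0, hxh⟩).eq_of_nhds]

end

section

variable {β α : ℂ} {p q : L2 × L2} {F F₁ H H₁ : ℝ → ℂ}

/-! ### Explicit solutions near zero -/

theorem hasDerivAt_ofReal_cpow (a : ℂ) {x : ℝ} (hx : 0 < x) :
    HasDerivAt (fun x : ℝ => (x : ℂ) ^ a) (a / x * (x : ℂ) ^ a) x := by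
  have hs : (x : ℂ) ∈ Complex.slitPlane := Complex.ofReal_mem_slitPlane.mpr hx
  have hx0 : (x : ℂ) ≠ 0 := by exact_mod_cast hx.ne'
  have h := ((hasDerivAt_id (x : ℂ)).cpow_const (c := a) hs).comp_ofReal
  refine h.congr_deriv ?_
  simp only [id, mul_one]
  rw [Complex.cpow_sub _ _ hx0, Complex.cpow_one]
  ring

theorem contDiffOn_ofReal_cpow (a : ℂ) :
    ContDiffOn ℝ ∞ (fun x : ℝ => (x : ℂ) ^ a) (Ioi 0) := by
  have h1 : ContDiffOn ℝ ∞ (fun x : ℝ => Complex.exp ((Real.log x : ℂ) * a)) (Ioi 0) := by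
    refine ContDiffOn.cexp (ContDiffOn.mul ?_ contDiffOn_const)
    refine Complex.ofRealCLM.contDiff.comp_contDiffOn (Real.contDiffOn_log.mono fun x hx => ?_)
    exact (ne_of_gt hx : x ≠ 0)
  refine h1.congr fun x hx => ?_
  have hx : 0 < x := hx
  rw [Complex.cpow_def_of_ne_zero (by exact_mod_cast hx.ne'), Complex.ofReal_log hx.le]

theorem norm_ofReal_cpow (m : ℂ) {x : ℝ} (hx : 0 < x) :
    ‖(x : ℂ) ^ (1 / 2 + m)‖ = x ^ (1 / 2 + m.re) := by
  rw [Complex.norm_cpow_eq_rpow_re_of_pos hx]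
  norm_num

theorem hasDerivAt_cpow_mul {g g₁ : ℝ → ℂ} (a : ℂ) {x : ℝ} (hx : 0 < x)
    (hg : HasDerivAt g (g₁ x) x) :
    HasDerivAt (fun x : ℝ => (x : ℂ) ^ a * g x) ((x : ℂ) ^ a * (g₁ x + a / x * g x)) x := by
  refine ((hasDerivAt_ofReal_cpow a hx).mul hg).congr_deriv ?_
  ring

theorem hasDerivAt_cpow_mul_deriv {g g₁ g₂ : ℝ → ℂ} (a : ℂ) {x : ℝ} (hx : 0 < x)
    (hg : HasDerivAt g (g₁ x) x) (hg₁ : HasDerivAt g₁ (g₂ x) x) :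
    HasDerivAt (fun x : ℝ => (x : ℂ) ^ a * (g₁ x + a / x * g x))
      ((x : ℂ) ^ a * (g₂ x + 2 * a / x * g₁ x + (a ^ 2 - a) / (x : ℂ) ^ 2 * g x)) x := by
  have hx0 : (x : ℂ) ≠ 0 := by exact_mod_cast hx.ne'
  have hinv : HasDerivAt (fun x : ℝ => a / (x : ℂ)) (-a / (x : ℂ) ^ 2) x := by
    have h := ((hasDerivAt_id (x : ℂ)).inv hx0).comp_ofReal.const_mul a
    refine h.congr_deriv ?_
    simp only [id]
    ring
  refine ((hasDerivAt_ofReal_cpow a hx).mul (hg₁.add (hinv.mul hg))).congr_deriv ?_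
  simp only [Pi.add_apply, Pi.mul_apply]
  field_simp
  ring

/-- The action of the Whittaker operator on `x^{1/2+m} g(x)`: the singular term `x⁻²` cancels. -/
theorem formal_cpow_mul {β m : ℂ} {g g₁ g₂ : ℝ → ℂ} {x : ℝ} (hx : 0 < x) :
    -((x : ℂ) ^ (1 / 2 + m) * (g₂ x + 2 * (1 / 2 + m) / x * g₁ x +
        ((1 / 2 + m) ^ 2 - (1 / 2 + m)) / (x : ℂ) ^ 2 * g x)) +
      pot β (m ^ 2) x * ((x : ℂ) ^ (1 / 2 + m) * g x) =
    (x : ℂ) ^ (1 / 2 + m) * (-g₂ x - ((1 + 2 * m) * g₁ x + β * g x) / x) := by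
  have hx0 : (x : ℂ) ≠ 0 := by exact_mod_cast hx.ne'
  rw [pot]
  field_simp
  ring

theorem norm_exp_sub_one_le' (κ : ℂ) {x : ℝ} (hx : x ∈ Ioo (0 : ℝ) 1) :
    ‖Complex.exp (-κ * x) - 1‖ ≤ ‖κ‖ * Real.exp ‖κ‖ * x := by
  have h := Complex.norm_exp_sub_sum_le_norm_mul_exp (-κ * x) 1
  have hn : ‖-κ * (x : ℂ)‖ = ‖κ‖ * x := by
    rw [norm_mul, norm_neg, Complex.norm_real, Real.norm_of_nonneg hx.1.le]
  have he : Real.exp (‖κ‖ * x) ≤ Real.exp ‖κ‖ :=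
    Real.exp_le_exp.mpr (mul_le_of_le_one_right (norm_nonneg _) hx.2.le)
  simp only [Finset.sum_range_one, pow_zero, Nat.factorial_zero, Nat.cast_one, div_one, pow_one,
    hn] at h
  calc _ ≤ _ := h
    _ ≤ ‖κ‖ * x * Real.exp ‖κ‖ :=
      mul_le_mul_of_nonneg_left he (mul_nonneg (norm_nonneg _) hx.1.le)
    _ = _ := by ring

theorem norm_exp_sub_two_le (κ : ℂ) {x : ℝ} (hx : x ∈ Ioo (0 : ℝ) 1) :
    ‖1 - κ * x - Complex.exp (-κ * x)‖ ≤ ‖κ‖ ^ 2 * Real.exp ‖κ‖ * x ^ 2 := by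
  have h := Complex.norm_exp_sub_sum_le_norm_mul_exp (-κ * x) 2
  have hn : ‖-κ * (x : ℂ)‖ = ‖κ‖ * x := by
    rw [norm_mul, norm_neg, Complex.norm_real, Real.norm_of_nonneg hx.1.le]
  have he : Real.exp (‖κ‖ * x) ≤ Real.exp ‖κ‖ :=
    Real.exp_le_exp.mpr (mul_le_of_le_one_right (norm_nonneg _) hx.2.le)
  simp only [Finset.sum_range_succ, Finset.sum_range_zero, pow_zero, Nat.factorial_zero,
    Nat.factorial_one, Nat.cast_one, div_one, pow_one, hn, zero_add] at h
  have e : 1 - κ * x - Complex.exp (-κ * x) = -(Complex.exp (-κ * x) - (1 + -κ * x)) := by ring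
  rw [e, norm_neg]
  calc _ ≤ _ := h
    _ ≤ (‖κ‖ * x) ^ 2 * Real.exp ‖κ‖ := mul_le_mul_of_nonneg_left he (by positivity)
    _ = _ := by ring

theorem norm_exp_le (κ : ℂ) {x : ℝ} (hx : x ∈ Ioo (0 : ℝ) 1) :
    ‖Complex.exp (-κ * x)‖ ≤ Real.exp ‖κ‖ := by
  refine (Complex.norm_exp_le_exp_norm _).trans (Real.exp_le_exp.mpr ?_)
  rw [norm_mul, norm_neg, Complex.norm_real, Real.norm_of_nonneg hx.1.le]
  exact mul_le_of_le_one_right (norm_nonneg _) hx.2.le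

theorem exp_le_norm_exp (κ : ℂ) {x : ℝ} (hx : x ∈ Ioc (0 : ℝ) 1) :
    Real.exp (-‖κ‖) ≤ ‖Complex.exp (-κ * x)‖ := by
  rw [Complex.norm_exp]
  refine Real.exp_le_exp.mpr ?_
  have h1 := (abs_le.mp (Complex.abs_re_le_norm (-κ * x))).1
  rw [norm_mul, norm_neg, Complex.norm_real, Real.norm_of_nonneg hx.1.le] at h1
  have := mul_le_of_le_one_right (norm_nonneg κ) hx.2
  linarith

theorem hasDerivAt_exp_mul (κ : ℂ) (x : ℝ) :
    HasDerivAt (fun x : ℝ => Complex.exp (-κ * x)) (-κ * Complex.exp (-κ * x)) x := by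
  have h := (((hasDerivAt_id (x : ℂ)).const_mul (-κ)).cexp).comp_ofReal
  refine h.congr_deriv ?_
  simp only [id]
  ring

/-- The function `x^{1/2+m} e^{-κx}`. If `(1 + 2m) κ = β`, it is an exact solution of
`L_{β,m²} u = -κ² u` without zeros, and `u(x) = x^{1/2+m} (1 - κx) + O(x^{5/2+Re m})` at `0`. -/
noncomputable def sol (m κ : ℂ) (x : ℝ) : ℂ := (x : ℂ) ^ (1 / 2 + m) * Complex.exp (-κ * x)

/-- The derivative of `sol m κ`. -/
noncomputable def solDeriv (m κ : ℂ) (x : ℝ) : ℂ :=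
  (x : ℂ) ^ (1 / 2 + m) *
    (-κ * Complex.exp (-κ * x) + (1 / 2 + m) / x * Complex.exp (-κ * x))

theorem contDiff_exp_mul (κ : ℂ) : ContDiff ℝ ∞ (fun x : ℝ => Complex.exp (-κ * x)) :=
  (contDiff_const.mul Complex.ofRealCLM.contDiff).cexp

theorem contDiffOn_sol (m κ : ℂ) : ContDiffOn ℝ ∞ (sol m κ) (Ioi 0) :=
  (contDiffOn_ofReal_cpow _).mul (contDiff_exp_mul κ).contDiffOn

theorem hasDerivAt_sol (m κ : ℂ) {x : ℝ} (hx : 0 < x) :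
    HasDerivAt (sol m κ) (solDeriv m κ x) x :=
  hasDerivAt_cpow_mul (g₁ := fun x : ℝ => -κ * Complex.exp (-κ * x)) _ hx
    (hasDerivAt_exp_mul κ x)

theorem hasDerivAt_solDeriv {β m κ : ℂ} (hκ : (1 + 2 * m) * κ = β) {x : ℝ} (hx : 0 < x) :
    HasDerivAt (solDeriv m κ) ((pot β (m ^ 2) x + κ ^ 2) * sol m κ x) x := by
  have h := hasDerivAt_cpow_mul_deriv (g := fun x : ℝ => Complex.exp (-κ * x))
    (g₁ := fun x : ℝ => -κ * Complex.exp (-κ * x))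
    (g₂ := fun x : ℝ => -κ * (-κ * Complex.exp (-κ * x))) (1 / 2 + m) hx
    (hasDerivAt_exp_mul κ x) ((hasDerivAt_exp_mul κ x).const_mul _)
  refine h.congr_deriv ?_
  have e := formal_cpow_mul (β := β) (m := m) (g := fun x : ℝ => Complex.exp (-κ * x))
    (g₁ := fun x : ℝ => -κ * Complex.exp (-κ * x))
    (g₂ := fun x : ℝ => -κ * (-κ * Complex.exp (-κ * x))) hx
  have e2 : ((1 + 2 * m) * (-κ * Complex.exp (-κ * x)) + β * Complex.exp (-κ * x)) /
      (x : ℂ) = 0 := by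
    rw [← hκ]
    ring
  rw [e2] at e
  rw [sol]
  linear_combination -e

theorem sol_ne_zero (m κ : ℂ) {x : ℝ} (hx : 0 < x) : sol m κ x ≠ 0 := by
  refine mul_ne_zero ?_ (Complex.exp_ne_zero _)
  rw [← norm_ne_zero_iff, norm_ofReal_cpow m hx]
  exact (Real.rpow_pos_of_pos hx _).ne'

theorem norm_sol_le (m κ : ℂ) {x : ℝ} (hx : x ∈ Ioo (0 : ℝ) 1) :
    ‖sol m κ x‖ ≤ Real.exp ‖κ‖ * x ^ (1 / 2 + m.re) := by
  rw [sol, norm_mul, norm_ofReal_cpow m hx.1, mul_comm]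
  exact mul_le_mul_of_nonneg_right (norm_exp_le κ hx) (Real.rpow_nonneg hx.1.le _)

theorem le_norm_sol (m κ : ℂ) {x : ℝ} (hx : x ∈ Ioc (0 : ℝ) 1) :
    Real.exp (-‖κ‖) * x ^ (1 / 2 + m.re) ≤ ‖sol m κ x‖ := by
  rw [sol, norm_mul, norm_ofReal_cpow m hx.1, mul_comm]
  exact mul_le_mul_of_nonneg_left (exp_le_norm_exp κ hx) (Real.rpow_nonneg hx.1.le _)

/-- The solution `sol m κ`, cut off near `0`, as an element of the graph of the maximal operator. -/
theorem exists_sol_mem {β m κ : ℂ} (hm : -1 < m.re) (hκ : (1 + 2 * m) * κ = β) :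
    ∃ p ∈ maxGraph β (m ^ 2), ∃ F₁, IsRep β (m ^ 2) p (fun x => cutoff x * sol m κ x) F₁ ∧
      (∀ x ∈ Ioo (0 : ℝ) (1 / 2), F₁ x = solDeriv m κ x) ∧
      ∀ᵐ x ∂halfLine, x < 1 / 2 → p.2 x = -κ ^ 2 * sol m κ x := by
  obtain ⟨p, hp, F₁, h1, h2, h3⟩ := exists_mem_maxGraph (β := β) (α := m ^ 2) (contDiffOn_sol m κ)
    (fun x hx => hasDerivAt_sol m κ hx) (fun x hx => hasDerivAt_solDeriv hκ hx)
    (s := 1 / 2 + m.re) (by linarith) (fun x hx => norm_sol_le m κ hx)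
    (D := ‖κ‖ ^ 2 * Real.exp ‖κ‖) (fun x hx => by
      have e : -((pot β (m ^ 2) x + κ ^ 2) * sol m κ x) + pot β (m ^ 2) x * sol m κ x =
        -κ ^ 2 * sol m κ x := by ring
      rw [e, norm_mul, norm_neg, norm_pow, mul_assoc]
      exact mul_le_mul_of_nonneg_left (norm_sol_le m κ hx) (by positivity))
  refine ⟨p, hp, F₁, h1, h2, ?_⟩
  filter_upwards [h3] with x hx hx'
  rw [hx hx']
  ring

/-- Near `0` the functions `x^{1/2+m} (1 - κx)` and `sol m κ` differ by an element of the minimal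
domain. -/
theorem exists_sub_sol_mem (β κ : ℂ) {m : ℂ} (hm : -1 < m.re) :
    ∃ p ∈ minGraph β (m ^ 2),
      p.1 =ᵐ[halfLine] fun x => cutoff x * ((x : ℂ) ^ (1 / 2 + m) * (1 - κ * x) - sol m κ x) := by
  set g : ℝ → ℂ := fun x => 1 - κ * x - Complex.exp (-κ * x) with hg
  set g₁ : ℝ → ℂ := fun x => -κ + κ * Complex.exp (-κ * x) with hg₁
  set g₂ : ℝ → ℂ := fun x => κ * (-κ * Complex.exp (-κ * x)) with hg₂
  have d0 : ∀ x, HasDerivAt g (g₁ x) x := by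
    intro x
    have hx : HasDerivAt (fun x : ℝ => κ * (x : ℂ)) κ x := by
      simpa using (Complex.ofRealCLM.hasDerivAt (x := x)).const_mul κ
    refine ((hx.const_sub 1).sub (hasDerivAt_exp_mul κ x)).congr_deriv ?_
    simp only [hg₁]
    ring
  have d1 : ∀ x, HasDerivAt g₁ (g₂ x) x := fun x =>
    ((hasDerivAt_exp_mul κ x).const_mul κ).const_add (-κ)
  have hgs : ContDiff ℝ ∞ g :=
    (contDiff_const.sub (contDiff_const.mul Complex.ofRealCLM.contDiff)).sub (contDiff_exp_mul κ)
  set E : ℝ := Real.exp ‖κ‖ with hE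
  have hE0 : 0 ≤ E := (Real.exp_pos _).le
  have b0 : ∀ x ∈ Ioo (0 : ℝ) 1, ‖g x‖ ≤ ‖κ‖ ^ 2 * E * x ^ 2 := fun x hx =>
    norm_exp_sub_two_le κ hx
  have b1 : ∀ x ∈ Ioo (0 : ℝ) 1, ‖g₁ x‖ ≤ ‖κ‖ ^ 2 * E * x := by
    intro x hx
    have e : g₁ x = κ * (Complex.exp (-κ * x) - 1) := by
      simp only [hg₁]
      ring
    rw [e, norm_mul]
    have := mul_le_mul_of_nonneg_left (norm_exp_sub_one_le' κ hx) (norm_nonneg κ)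
    nlinarith
  have b2 : ∀ x ∈ Ioo (0 : ℝ) 1, ‖g₂ x‖ ≤ ‖κ‖ ^ 2 * E := by
    intro x hx
    simp only [hg₂]
    rw [norm_mul, norm_mul, norm_neg]
    have := mul_le_mul_of_nonneg_left (norm_exp_le κ hx)
      (mul_nonneg (norm_nonneg κ) (norm_nonneg κ))
    nlinarith
  have hpow : ∀ x ∈ Ioo (0 : ℝ) 1, x ^ (1 / 2 + m.re) * x ≤ √x := by
    intro x hx
    rw [Real.sqrt_eq_rpow, ← Real.rpow_add_one hx.1.ne']
    exact Real.rpow_le_rpow_of_exponent_ge hx.1 hx.2.le (by linarith)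
  obtain ⟨p, hp, F₁, h1, h2, h3⟩ := exists_mem_maxGraph (β := β) (α := m ^ 2)
    ((contDiffOn_ofReal_cpow (1 / 2 + m)).mul hgs.contDiffOn)
    (fun x hx => hasDerivAt_cpow_mul (1 / 2 + m) hx (d0 x))
    (fun x hx => hasDerivAt_cpow_mul_deriv (1 / 2 + m) hx (d0 x) (d1 x))
    (s := 1 / 2 + m.re) (by linarith) (C := ‖κ‖ ^ 2 * E)
    (D := ‖κ‖ ^ 2 * E * (1 + ‖1 + 2 * m‖ + ‖β‖)) (fun x hx => by
      rw [norm_mul, norm_ofReal_cpow m hx.1, mul_comm]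
      refine mul_le_mul_of_nonneg_right ((b0 x hx).trans ?_) (Real.rpow_nonneg hx.1.le _)
      exact mul_le_of_le_one_right (by positivity) (pow_le_one₀ hx.1.le hx.2.le))
    (fun x hx => by
      rw [formal_cpow_mul hx.1, norm_mul, norm_ofReal_cpow m hx.1, mul_comm]
      refine mul_le_mul_of_nonneg_right ?_ (Real.rpow_nonneg hx.1.le _)
      refine (norm_sub_le _ _).trans ?_
      rw [norm_neg, norm_div, Complex.norm_real, Real.norm_of_nonneg hx.1.le]
      have t1 : ‖(1 + 2 * m) * g₁ x + β * g x‖ ≤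
          ‖1 + 2 * m‖ * (‖κ‖ ^ 2 * E * x) + ‖β‖ * (‖κ‖ ^ 2 * E * x ^ 2) := by
        refine (norm_add_le _ _).trans ?_
        rw [norm_mul, norm_mul]
        exact add_le_add (mul_le_mul_of_nonneg_left (b1 x hx) (norm_nonneg _))
          (mul_le_mul_of_nonneg_left (b0 x hx) (norm_nonneg _))
      have t2 : ‖(1 + 2 * m) * g₁ x + β * g x‖ / x ≤
          ‖κ‖ ^ 2 * E * (‖1 + 2 * m‖ + ‖β‖) := by
        rw [div_le_iff₀ hx.1]
        refine t1.trans ?_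
        have : 0 ≤ ‖β‖ * (‖κ‖ ^ 2 * E) * (x * (1 - x)) :=
          mul_nonneg (by positivity) (mul_nonneg hx.1.le (by linarith [hx.2]))
        nlinarith
      have := b2 x hx
      nlinarith)
  refine ⟨p, ?_, ?_⟩
  · refine mem_minGraph_of_isBigO hp h1 (C := ‖κ‖ ^ 2 * E * (1 + ‖1 / 2 + m‖)) ?_ ?_
    · filter_upwards [Ioo_mem_nhdsGT one_pos] with x hx
      have hx1 := hpow x hx
      rw [norm_mul, norm_mul, norm_ofReal_cpow m hx.1]
      have hr := Real.rpow_nonneg hx.1.le (1 / 2 + m.re)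
      have hK : 0 ≤ ‖κ‖ ^ 2 * E := by positivity
      calc ‖cutoff x‖ * (x ^ (1 / 2 + m.re) * ‖g x‖)
          ≤ 1 * (x ^ (1 / 2 + m.re) * (‖κ‖ ^ 2 * E * x ^ 2)) := by
            gcongr
            · exact norm_cutoff_le x
            · exact b0 x hx
        _ = ‖κ‖ ^ 2 * E * 1 * (x * (x ^ (1 / 2 + m.re) * x)) := by ring
        _ ≤ ‖κ‖ ^ 2 * E * (1 + ‖1 / 2 + m‖) * (x * √x) := by
            have hx0 := hx.1.le
            have : (0 : ℝ) ≤ ‖1 / 2 + m‖ := norm_nonneg _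
            gcongr
            linarith
    · filter_upwards [Ioo_mem_nhdsGT (show (0 : ℝ) < 1 / 2 by norm_num)] with x hx'
      have hx : x ∈ Ioo (0 : ℝ) 1 := ⟨hx'.1, hx'.2.trans (by norm_num)⟩
      rw [h2 x hx', norm_mul, norm_ofReal_cpow m hx.1]
      have hr := Real.rpow_nonneg hx.1.le (1 / 2 + m.re)
      have t1 : ‖g₁ x + (1 / 2 + m) / x * g x‖ ≤ ‖κ‖ ^ 2 * E * (1 + ‖1 / 2 + m‖) * x := by
        refine (norm_add_le _ _).trans ?_
        rw [norm_mul, norm_div, Complex.norm_real, Real.norm_of_nonneg hx.1.le]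
        have t2 : ‖1 / 2 + m‖ / x * ‖g x‖ ≤ ‖1 / 2 + m‖ / x * (‖κ‖ ^ 2 * E * x ^ 2) :=
          mul_le_mul_of_nonneg_left (b0 x hx) (div_nonneg (norm_nonneg _) hx.1.le)
        have t3 : ‖1 / 2 + m‖ / x * (‖κ‖ ^ 2 * E * x ^ 2) = ‖κ‖ ^ 2 * E * ‖1 / 2 + m‖ * x := by
          have := hx.1.ne'
          field_simp
        have := b1 x hx
        nlinarith
      calc x ^ (1 / 2 + m.re) * ‖g₁ x + (1 / 2 + m) / x * g x‖
          ≤ x ^ (1 / 2 + m.re) * (‖κ‖ ^ 2 * E * (1 + ‖1 / 2 + m‖) * x) :=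
            mul_le_mul_of_nonneg_left t1 hr
        _ = ‖κ‖ ^ 2 * E * (1 + ‖1 / 2 + m‖) * (x ^ (1 / 2 + m.re) * x) := by ring
        _ ≤ _ := mul_le_mul_of_nonneg_left (hpow x hx) (by positivity)
  · filter_upwards [h1.ae_eq] with x hx
    rw [hx]
    simp only [hg, sol]
    ring

end

section

variable {β m κ : ℂ} {p q : L2 × L2} {F F₁ H H₁ : ℝ → ℂ}

/-! ### The limit point case -/

theorem norm_solDeriv_le (m κ : ℂ) {x : ℝ} (hx : x ∈ Ioo (0 : ℝ) 1) :
    ‖solDeriv m κ x‖ ≤ (‖κ‖ + ‖1 / 2 + m‖) * Real.exp ‖κ‖ * x ^ (m.re - 1 / 2) := by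
  have hx0 : (x : ℂ) ≠ 0 := by exact_mod_cast hx.1.ne'
  have e : solDeriv m κ x = (-κ * x + (1 / 2 + m)) / x * sol m κ x := by
    rw [solDeriv, sol]
    field_simp
  have hr : x ^ (1 / 2 + m.re) = x * x ^ (m.re - 1 / 2) := by
    rw [mul_comm, ← Real.rpow_add_one hx.1.ne']
    congr 1
    ring
  have h1 := norm_sol_le m κ hx
  rw [hr] at h1
  rw [e, norm_mul, norm_div, Complex.norm_real, Real.norm_of_nonneg hx.1.le]
  have h2 : ‖-κ * x + (1 / 2 + m)‖ ≤ ‖κ‖ + ‖1 / 2 + m‖ := by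
    refine (norm_add_le _ _).trans (add_le_add ?_ le_rfl)
    rw [norm_mul, norm_neg, Complex.norm_real, Real.norm_of_nonneg hx.1.le]
    exact mul_le_of_le_one_right (norm_nonneg _) hx.2.le
  have hx1 := hx.1
  calc ‖-κ * x + (1 / 2 + m)‖ / x * ‖sol m κ x‖
      ≤ (‖κ‖ + ‖1 / 2 + m‖) / x * (Real.exp ‖κ‖ * (x * x ^ (m.re - 1 / 2))) := by gcongr
    _ = _ := by
      have := hx.1.ne'
      field_simp

/-- For `Re m ≥ 1` the solution `sol m κ` belongs to the minimal domain near `0`. -/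
theorem sol_mem_minGraph (hm : 1 ≤ m.re) (hq : q ∈ maxGraph β (m ^ 2))
    (h : IsRep β (m ^ 2) q (fun x => cutoff x * sol m κ x) F₁)
    (h1 : ∀ x ∈ Ioo (0 : ℝ) (1 / 2), F₁ x = solDeriv m κ x) : q ∈ minGraph β (m ^ 2) := by
  have hE := (Real.exp_pos ‖κ‖).le
  have hn : (0 : ℝ) ≤ ‖1 / 2 + m‖ := norm_nonneg _
  have hk := norm_nonneg κ
  refine mem_minGraph_of_isBigO hq h (C := (1 + ‖κ‖ + ‖1 / 2 + m‖) * Real.exp ‖κ‖) ?_ ?_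
  · filter_upwards [Ioo_mem_nhdsGT one_pos] with x hx
    have hp : x ^ (1 / 2 + m.re) ≤ x * √x := by
      rw [Real.sqrt_eq_rpow, mul_comm, ← Real.rpow_add_one hx.1.ne']
      exact Real.rpow_le_rpow_of_exponent_ge hx.1 hx.2.le (by linarith)
    have hs := norm_sol_le m κ hx
    rw [norm_mul]
    calc ‖cutoff x‖ * ‖sol m κ x‖ ≤ 1 * (Real.exp ‖κ‖ * (x * √x)) := by
          gcongr
          · exact norm_cutoff_le x
          · exact hs.trans (mul_le_mul_of_nonneg_left hp hE)
      _ ≤ (1 + ‖κ‖ + ‖1 / 2 + m‖) * Real.exp ‖κ‖ * (x * √x) := by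
          have hx0 := hx.1.le
          rw [mul_assoc]
          gcongr
          linarith
  · filter_upwards [Ioo_mem_nhdsGT (show (0 : ℝ) < 1 / 2 by norm_num)] with x hx'
    have hx : x ∈ Ioo (0 : ℝ) 1 := ⟨hx'.1, hx'.2.trans (by norm_num)⟩
    have hp : x ^ (m.re - 1 / 2) ≤ √x := by
      rw [Real.sqrt_eq_rpow]
      exact Real.rpow_le_rpow_of_exponent_ge hx.1 hx.2.le (by linarith)
    rw [h1 x hx']
    refine (norm_solDeriv_le m κ hx).trans ?_
    have hr := Real.rpow_nonneg hx.1.le (m.re - 1 / 2)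
    gcongr
    linarith

/-- In the limit point case, the Wronskian of an element of the maximal domain with `sol m κ` is
`O(x^{1+Re m})`. -/
theorem exists_norm_wronskian_sol_le (hm : 1 ≤ m.re) (hκ : (1 + 2 * m) * κ = β)
    (hp : p ∈ maxGraph β (m ^ 2)) (h : IsRep β (m ^ 2) p F F₁) :
    ∃ C, 0 < C ∧ ∀ᶠ x in 𝓝[>] (0 : ℝ),
      ‖F x * solDeriv m κ x - F₁ x * sol m κ x‖ ≤ C * (√x * x ^ (1 / 2 + m.re)) := by
  obtain ⟨q, hq, H₁, hr, h1, h2⟩ := exists_sol_mem (β := β) (by linarith : -1 < m.re) hκ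
  have hb : bform p q = 0 := by
    rw [bform_swap, (mem_minGraph_iff.mp (sol_mem_minGraph hm hq hr h1)).2 p hp, neg_zero]
  have hlim := (h.tendsto_wronskian hr).norm
  rw [hb, neg_zero, norm_zero] at hlim
  set E := Real.exp ‖κ‖ with hE
  have hE0 : 0 < E := Real.exp_pos _
  refine ⟨(1 + ‖κ‖ ^ 2) * E, by positivity, ?_⟩
  filter_upwards [Ioo_mem_nhdsGT (show (0 : ℝ) < 1 / 2 by norm_num),
    eventually_integral_norm_le (Lp.memLp p.1) one_pos,
    eventually_integral_norm_le (Lp.memLp p.2) one_pos] with b hb i1 i2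
  have hb0 : 0 < b := hb.1
  have n1 := intervalIntegrable_norm_of_memLp (Lp.memLp p.1) hb0.le
  have n2 := intervalIntegrable_norm_of_memLp (Lp.memLp p.2) hb0.le
  have hrb : 0 ≤ b ^ (1 / 2 + m.re) := Real.rpow_nonneg hb0.le _
  have key : ∀ a ∈ Ioo 0 b, ‖F b * solDeriv m κ b - F₁ b * sol m κ b‖ ≤
      ‖F a * H₁ a - F₁ a * (cutoff a * sol m κ a)‖ +
        (1 + ‖κ‖ ^ 2) * E * (√b * b ^ (1 / 2 + m.re)) := by
    intro a ha
    have hw := h.wronskian_sub hr ha.1 hb0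
    have e1 : F b * solDeriv m κ b - F₁ b * sol m κ b =
        (F a * H₁ a - F₁ a * (cutoff a * sol m κ a)) +
          ∫ x in a..b, (p.2 x * q.1 x - p.1 x * q.2 x) := by
      rw [← hw, h1 b hb, cutoff_eq_one hb0 hb.2.le]
      ring
    rw [e1]
    refine (norm_add_le _ _).trans (add_le_add le_rfl ?_)
    have hsub : Ioc a b ⊆ Ioc 0 b := Ioc_subset_Ioc_left ha.1.le
    have m1 : IntervalIntegrable (fun t => ‖p.1 t‖) volume a b :=
      n1.mono_set (by rw [uIcc_of_le ha.2.le, uIcc_of_le hb0.le]; exact Icc_subset_Icc_left ha.1.le)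
    have m2 : IntervalIntegrable (fun t => ‖p.2 t‖) volume a b :=
      n2.mono_set (by rw [uIcc_of_le ha.2.le, uIcc_of_le hb0.le]; exact Icc_subset_Icc_left ha.1.le)
    have l1 : ∫ t in a..b, ‖p.1 t‖ ≤ √b := by
      refine (intervalIntegral.integral_mono_interval ha.1.le ha.2.le le_rfl
        (Eventually.of_forall fun x => norm_nonneg _) n1).trans ?_
      simpa using i1
    have l2 : ∫ t in a..b, ‖p.2 t‖ ≤ √b := by
      refine (intervalIntegral.integral_mono_interval ha.1.le ha.2.le le_rfl
        (Eventually.of_forall fun x => norm_nonneg _) n2).trans ?_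
      simpa using i2
    set B : ℝ := E * b ^ (1 / 2 + m.re) with hB
    have hB0 : 0 ≤ B := by positivity
    calc ‖∫ x in a..b, (p.2 x * q.1 x - p.1 x * q.2 x)‖
        ≤ ∫ x in a..b, (B * ‖p.2 x‖ + ‖κ‖ ^ 2 * B * ‖p.1 x‖) := by
          refine intervalIntegral.norm_integral_le_of_norm_le ha.2.le ?_
            ((m2.const_mul _).add (m1.const_mul _))
          filter_upwards [(ae_restrict_iff' measurableSet_Ioi).mp h2,
            (ae_restrict_iff' measurableSet_Ioi).mp hr.ae_eq] with x g2 g1 hx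
          have hx0 : 0 < x := ha.1.trans hx.1
          have hx1 : x < 1 / 2 := hx.2.trans_lt hb.2
          rw [g1 hx0, g2 hx0 hx1, cutoff_eq_one hx0 hx1.le, one_mul]
          have hs : ‖sol m κ x‖ ≤ B := by
            refine (norm_sol_le m κ ⟨hx0, hx1.trans (by norm_num)⟩).trans ?_
            exact mul_le_mul_of_nonneg_left
              (Real.rpow_le_rpow hx0.le hx.2 (by linarith)) hE0.le
          refine (norm_sub_le _ _).trans ?_
          simp only [norm_mul, norm_neg, norm_pow]
          have t1 := mul_le_mul_of_nonneg_left hs (norm_nonneg (p.2 x))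
          have t2 := mul_le_mul_of_nonneg_left hs
            (mul_nonneg (norm_nonneg (p.1 x)) (sq_nonneg ‖κ‖))
          nlinarith
      _ = B * (∫ x in a..b, ‖p.2 x‖) + ‖κ‖ ^ 2 * B * ∫ x in a..b, ‖p.1 x‖ := by
          rw [intervalIntegral.integral_add (m2.const_mul _) (m1.const_mul _),
            intervalIntegral.integral_const_mul, intervalIntegral.integral_const_mul]
      _ ≤ B * √b + ‖κ‖ ^ 2 * B * √b := by gcongr
      _ = _ := by
          rw [hB]
          ring
  have hlim' := hlim.add_const ((1 + ‖κ‖ ^ 2) * E * (√b * b ^ (1 / 2 + m.re)))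
  rw [zero_add] at hlim'
  refine ge_of_tendsto hlim' ?_
  filter_upwards [Ioo_mem_nhdsGT hb0] with a ha using key a ha

/-- For `Re m ≥ 1` the boundary form vanishes identically. -/
theorem bform_eq_zero_of_one_le_re (hm : 1 ≤ m.re) (hκ : (1 + 2 * m) * κ = β)
    (hp : p ∈ maxGraph β (m ^ 2)) (hq : q ∈ maxGraph β (m ^ 2)) : bform p q = 0 := by
  by_contra hne
  obtain ⟨F, F₁, h⟩ := exists_isRep hp
  obtain ⟨H, H₁, h'⟩ := exists_isRep hq
  obtain ⟨C, hC, hF⟩ := exists_norm_wronskian_sol_le hm hκ hp h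
  obtain ⟨D, hD, hH⟩ := exists_norm_wronskian_sol_le hm hκ hq h'
  set ℓ : ℝ := ‖bform p q‖ / 2 with hℓ
  have hn : 0 < ‖bform p q‖ := norm_pos_iff.mpr hne
  have hW : ∀ᶠ x in 𝓝[>] (0 : ℝ), ℓ ≤ ‖F x * H₁ x - F₁ x * H x‖ := by
    have := (h.tendsto_wronskian h').norm
    rw [norm_neg] at this
    exact (this.eventually_const_lt (by rw [hℓ]; linarith)).mono fun _ hx => hx.le
  set e : ℝ := Real.exp (-‖κ‖) with he
  have he0 : 0 < e := Real.exp_pos _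
  -- Cramer's rule below yields `c ≤ (|F| + |H|) x^{1/2}` near `0` for this `c`
  set c : ℝ := e * ℓ / (C + D) with hc
  have hc0 : 0 < c := by positivity
  obtain ⟨x, hx, hW, hF, hH, hx1⟩ := ((frequently_lt_div
    (h.integrable_norm_sq.add h'.integrable_norm_sq) (c := c ^ 2 / 2)
    (by positivity)).and_eventually
    (hW.and (hF.and (hH.and (Ioo_mem_nhdsGT one_pos))))).exists
  have hx0 : 0 < x := hx1.1
  set u := sol m κ x with hu
  set u₁ := solDeriv m κ x
  -- Cramer's rule
  have hcr : u * (F x * H₁ x - F₁ x * H x) =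
      H x * (F x * u₁ - F₁ x * u) - F x * (H x * u₁ - H₁ x * u) := by ring
  have hrp : 0 < x ^ (1 / 2 + m.re) := Real.rpow_pos_of_pos hx0 _
  set r := x ^ (1 / 2 + m.re)
  have hul : e * r ≤ ‖u‖ := le_norm_sol m κ ⟨hx0, hx1.2.le⟩
  have h1 : e * r * ℓ ≤ (‖F x‖ + ‖H x‖) * ((C + D) * (√x * r)) := by
    calc e * r * ℓ ≤ ‖u‖ * ‖F x * H₁ x - F₁ x * H x‖ := by gcongr
      _ = ‖H x * (F x * u₁ - F₁ x * u) - F x * (H x * u₁ - H₁ x * u)‖ := by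
        rw [← norm_mul, hcr]
      _ ≤ ‖H x‖ * (C * (√x * r)) + ‖F x‖ * (D * (√x * r)) := by
        refine (norm_sub_le _ _).trans ?_
        rw [norm_mul, norm_mul]
        gcongr
      _ ≤ _ := by
        have s1 : 0 ≤ √x * r := by positivity
        nlinarith [mul_nonneg (mul_nonneg (norm_nonneg (F x)) hC.le) s1,
          mul_nonneg (mul_nonneg (norm_nonneg (H x)) hD.le) s1]
  have h2 : c ≤ (‖F x‖ + ‖H x‖) * √x := by
    rw [hc, div_le_iff₀ (by positivity)]
    have : e * ℓ * r ≤ (‖F x‖ + ‖H x‖) * √x * (C + D) * r := by linarith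
    exact le_of_mul_le_mul_right this hrp
  have h3 : c ^ 2 ≤ (‖F x‖ + ‖H x‖) ^ 2 * x := by
    have := pow_le_pow_left₀ hc0.le h2 2
    rwa [mul_pow, Real.sq_sqrt hx0.le] at this
  rw [lt_div_iff₀ hx0] at hx
  simp only [Pi.add_apply] at hx
  nlinarith [sq_nonneg (‖F x‖ - ‖H x‖)]

/-! ### The limit circle case -/

/-- Reduction of order: for `-1 < Re m < 1` the boundary form does not vanish at `sol m κ`. -/
theorem exists_bform_sol_eq_one (hm : -1 < m.re) (hm1 : m.re < 1) (hκ : (1 + 2 * m) * κ = β)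
    (h : IsRep β (m ^ 2) p (fun x => cutoff x * sol m κ x) F₁)
    (h1 : ∀ x ∈ Ioo (0 : ℝ) (1 / 2), F₁ x = solDeriv m κ x) :
    ∃ q ∈ maxGraph β (m ^ 2), bform p q = 1 := by
  -- the second solution `sol * J`, where `J' = -1 / sol²`, is `O(x^{1/2 + Re m - s})`
  -- and is square-integrable near `0` because of `s < 1 + Re m`
  obtain ⟨s, hs0, hs1, hs2⟩ : ∃ s : ℝ, 0 ≤ s ∧ 2 * m.re < s ∧ s < 1 + m.re := by
    obtain ⟨s, h1, h2⟩ := exists_between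
      (max_lt (by linarith) (by linarith) : max 0 (2 * m.re) < 1 + m.re)
    exact ⟨s, (le_max_left _ _).trans h1.le, (le_max_right _ _).trans_lt h1, h2⟩
  set k : ℝ → ℂ := fun x => -(sol m κ x ^ 2)⁻¹ with hk
  have hks : ContDiffOn ℝ ∞ k (Ioi 0) :=
    (((contDiffOn_sol m κ).pow 2).inv fun x hx => pow_ne_zero 2 (sol_ne_zero m κ hx)).neg
  have hkl := LocInt.of_continuousOn hks.continuousOn
  set J : ℝ → ℂ := fun x => ∫ t in (1 : ℝ)..x, k t with hJ
  have hJd : ∀ x, 0 < x → HasDerivAt J (k x) x := fun x hx =>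
    intervalIntegral.integral_hasDerivAt_right (hkl 1 x one_pos hx)
      (hks.continuousOn.stronglyMeasurableAtFilter isOpen_Ioi x hx)
      (hks.continuousOn.continuousAt (Ioi_mem_nhds hx))
  have hJs : ContDiffOn ℝ ∞ J (Ioi 0) := by
    rw [contDiffOn_infty_iff_deriv_of_isOpen isOpen_Ioi]
    exact ⟨fun x hx => (hJd x hx).differentiableAt.differentiableWithinAt,
      hks.congr fun x hx => (hJd x hx).deriv⟩
  set E : ℝ := Real.exp ‖κ‖ with hE
  have hE0 : 0 < E := Real.exp_pos _
  have hσ : 0 < s - 2 * m.re := by linarith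
  have hJb : ∀ x ∈ Ioo (0 : ℝ) 1, ‖J x‖ ≤ E ^ 2 / (s - 2 * m.re) * x ^ (-s) := by
    intro x hx
    have hx0 : 0 < x := hx.1
    have hsub : uIcc x 1 ⊆ Ioi 0 := uIcc_subset_Ioi hx0 one_pos
    have hii : IntervalIntegrable (fun t : ℝ => t ^ (s - 2 * m.re - 1)) volume x 1 :=
      intervalIntegral.intervalIntegrable_rpow' (by linarith)
    have e1 : J x = -∫ t in x..(1 : ℝ), k t := intervalIntegral.integral_symm _ _
    rw [e1, norm_neg]
    have hxs : 0 ≤ x ^ (-s) := Real.rpow_nonneg hx0.le _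
    calc ‖∫ t in x..(1 : ℝ), k t‖
        ≤ ∫ t in x..(1 : ℝ), E ^ 2 * x ^ (-s) * t ^ (s - 2 * m.re - 1) := by
          refine intervalIntegral.norm_integral_le_of_norm_le hx.2.le
            (Eventually.of_forall fun t ht => ?_) (hii.const_mul _)
          have ht0 : 0 < t := hx0.trans ht.1
          have hu := le_norm_sol m κ ⟨ht0, ht.2⟩
          have hpos : 0 < Real.exp (-‖κ‖) * t ^ (1 / 2 + m.re) := by positivity
          have hts : t ^ (-s) ≤ x ^ (-s) :=
            Real.rpow_le_rpow_of_nonpos hx0 ht.1.le (by linarith)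
          have e2 : ((Real.exp (-‖κ‖) * t ^ (1 / 2 + m.re)) ^ 2)⁻¹ =
              E ^ 2 * (t ^ (-s) * t ^ (s - 2 * m.re - 1)) := by
            rw [mul_pow, mul_inv, Real.exp_neg, inv_pow, inv_inv, ← Real.rpow_add ht0,
              ← Real.rpow_natCast (t ^ (1 / 2 + m.re)), ← Real.rpow_mul ht0.le,
              ← Real.rpow_neg ht0.le]
            congr 2
            push_cast
            ring
          simp only [hk]
          rw [norm_neg, norm_inv, norm_pow]
          calc (‖sol m κ t‖ ^ 2)⁻¹ ≤ ((Real.exp (-‖κ‖) * t ^ (1 / 2 + m.re)) ^ 2)⁻¹ := by gcongr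
            _ = E ^ 2 * (t ^ (-s) * t ^ (s - 2 * m.re - 1)) := e2
            _ ≤ E ^ 2 * (x ^ (-s) * t ^ (s - 2 * m.re - 1)) := by gcongr
            _ = _ := by ring
      _ = E ^ 2 * x ^ (-s) * ((1 - x ^ (s - 2 * m.re)) / (s - 2 * m.re)) := by
          rw [intervalIntegral.integral_const_mul, integral_rpow (Or.inl (by linarith))]
          simp
      _ ≤ E ^ 2 * x ^ (-s) * (1 / (s - 2 * m.re)) := by
          have := Real.rpow_nonneg hx0.le (s - 2 * m.re)
          gcongr
          linarith
      _ = _ := by ring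
  have hv : ∀ x ∈ Ioo (0 : ℝ) 1, ‖sol m κ x * J x‖ ≤
      E ^ 3 / (s - 2 * m.re) * x ^ (1 / 2 + m.re - s) := by
    intro x hx
    have hx0 : 0 < x := hx.1
    have h3 := hJb x hx
    have h4 := norm_sol_le m κ hx
    have hr : 0 ≤ x ^ (1 / 2 + m.re) := Real.rpow_nonneg hx0.le _
    rw [norm_mul]
    calc ‖sol m κ x‖ * ‖J x‖
        ≤ (E * x ^ (1 / 2 + m.re)) * (E ^ 2 / (s - 2 * m.re) * x ^ (-s)) := by gcongr
      _ = _ := by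
        rw [sub_eq_add_neg (1 / 2 + m.re) s, Real.rpow_add hx0 (1 / 2 + m.re) (-s)]
        ring
  have d1 : ∀ x, 0 < x → HasDerivAt (fun x => sol m κ x * J x)
      (solDeriv m κ x * J x - (sol m κ x)⁻¹) x := by
    intro x hx
    refine ((hasDerivAt_sol m κ hx).mul (hJd x hx)).congr_deriv ?_
    have := sol_ne_zero m κ hx
    simp only [hk]
    field_simp
    ring
  have d2 : ∀ x, 0 < x → HasDerivAt (fun x => solDeriv m κ x * J x - (sol m κ x)⁻¹)
      ((pot β (m ^ 2) x + κ ^ 2) * (sol m κ x * J x)) x := by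
    intro x hx
    have h0 := sol_ne_zero m κ hx
    refine (((hasDerivAt_solDeriv hκ hx).mul (hJd x hx)).sub
      ((hasDerivAt_sol m κ hx).inv h0)).congr_deriv ?_
    simp only [hk]
    field_simp
    ring
  obtain ⟨q, hq, H₁, hr, g1, -⟩ := exists_mem_maxGraph (β := β) (α := m ^ 2)
    ((contDiffOn_sol m κ).mul hJs) d1 d2 (s := 1 / 2 + m.re - s) (by linarith) hv
    (D := ‖κ‖ ^ 2 * (E ^ 3 / (s - 2 * m.re))) (fun x hx => by
      have e : -((pot β (m ^ 2) x + κ ^ 2) * (sol m κ x * J x)) +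
        pot β (m ^ 2) x * (sol m κ x * J x) = -κ ^ 2 * (sol m κ x * J x) := by ring
      rw [e, norm_mul, norm_neg, norm_pow, mul_assoc]
      exact mul_le_mul_of_nonneg_left (hv x hx) (by positivity))
  -- near `0` the Wronskian of `u` and `u J` is `u² J' = -1`
  refine ⟨q, hq, ?_⟩
  have hlim := (h.tendsto_wronskian hr).congr' (f₂ := fun _ => (-1 : ℂ)) (by
    filter_upwards [Ioo_mem_nhdsGT (show (0 : ℝ) < 1 / 2 by norm_num)] with x hx
    have h0 := sol_ne_zero m κ hx.1
    rw [h1 x hx, g1 x hx, cutoff_eq_one hx.1 hx.2.le]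
    field_simp
    ring)
  exact neg_injective (tendsto_nhds_unique hlim tendsto_const_nhds)

end

section

variable {β α m : ℂ} {p q U : L2 × L2}

/-! ### The graph of the Whittaker operator -/

theorem mem_graph_Lmin : p ∈ (Lmin β α).graph ↔ p ∈ minGraph β α := by
  rw [graph_Lmin, minGraph]

theorem mem_graph_Hreg : p ∈ (Hreg β m).graph ↔
    p ∈ maxGraph β (m ^ 2) ∧
      ∃ c : ℂ, MemLminNearZero β (m ^ 2) (fun x => p.1 x - c * boundaryFun β m x) := by
  rw [← graph_Lmax]
  constructor
  · intro h
    obtain ⟨x, hx1, hx2⟩ := (LinearPMap.mem_graph_iff _).mp h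
    have hxd : (x : L2) ∈ boundaryDomain β m ⊓ (Lmax β (m ^ 2)).domain := x.2
    refine ⟨LinearPMap.le_graph_of_le LinearPMap.domRestrict_le h, ?_⟩
    rw [← hx1]
    exact hxd.1.2
  · rintro ⟨h, hc⟩
    obtain ⟨x, hx1, hx2⟩ := (LinearPMap.mem_graph_iff _).mp h
    have hmem : p.1 ∈ boundaryDomain β m ⊓ (Lmax β (m ^ 2)).domain := by
      rw [← hx1]
      refine ⟨⟨x.2, ?_⟩, x.2⟩
      rw [hx1]
      exact hc
    rw [LinearPMap.mem_graph_iff]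
    refine ⟨⟨p.1, hmem⟩, rfl, ?_⟩
    rw [← hx2]
    exact LinearPMap.domRestrict_apply (by simp [hx1])

/-- A cutoff whose support lies where `cutoff` equals `1`. -/
theorem exists_isCutoff_mul_cutoff :
    ∃ ζ, IsCutoff ζ ∧ ∀ x, 0 < x → ζ x * cutoff x = ζ x := by
  obtain ⟨f, hf⟩ : ∃ f : ContDiffBump (0 : ℝ), f.rOut = 1 / 2 :=
    ⟨⟨1 / 4, 1 / 2, by norm_num, by norm_num⟩, rfl⟩
  refine ⟨fun x => (f x : ℂ), ⟨Complex.ofRealCLM.contDiff.comp f.contDiff,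
    f.hasCompactSupport.comp_left (g := fun r : ℝ => (r : ℂ)) Complex.ofReal_zero, ?_⟩,
    fun x hx => ?_⟩
  · filter_upwards [nhdsWithin_le_nhds f.eventuallyEq_one] with x hx
    simp [hx]
  · rcases le_total x (1 / 2) with h | h
    · rw [cutoff_eq_one hx h, mul_one]
    · have : f x = 0 := f.zero_of_le_dist (by
        rw [Real.dist_eq, sub_zero, abs_of_pos hx, hf]
        exact h)
      simp [this]

/-- The boundary condition defining `H_{β,m}` says that `p` is a multiple of the element `U` given by
the explicit solution, up to the minimal domain. -/
theorem mem_graph_Hreg_iff_exists (hm : -1 < m.re) (hU : U ∈ maxGraph β (m ^ 2))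
    (hU1 : U.1 =ᵐ[halfLine] fun x => cutoff x * sol m (β / (1 + 2 * m)) x) :
    p ∈ (Hreg β m).graph ↔ p ∈ maxGraph β (m ^ 2) ∧ ∃ c : ℂ, p - c • U ∈ minGraph β (m ^ 2) := by
  obtain ⟨D, hD, hD1⟩ := exists_sub_sol_mem β (β / (1 + 2 * m)) hm
  have hDmax := minGraph_le_maxGraph _ _ hD
  have hB1 : (U + D).1 =ᵐ[halfLine] fun x => cutoff x * boundaryFun β m x := by
    filter_upwards [hU1, hD1, Lp.coeFn_add U.1 D.1] with x h1 h2 h3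
    rw [Prod.fst_add, h3, Pi.add_apply, h1, h2, boundaryFun]
    ring
  have hsub : ∀ c : ℂ, (p - c • (U + D)).1 =ᵐ[halfLine]
      fun x => p.1 x - c * (cutoff x * boundaryFun β m x) := fun c => by
    filter_upwards [hB1, Lp.coeFn_sub p.1 (c • (U + D)).1, Lp.coeFn_smul c (U + D).1]
      with x h1 h2 h3
    rw [Prod.fst_sub, h2, Pi.sub_apply, Prod.smul_fst, h3, Pi.smul_apply, h1, smul_eq_mul]
  rw [mem_graph_Hreg]
  refine and_congr_right fun hp => exists_congr fun c => ⟨?_, fun h => ?_⟩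
  -- the difference of the two cut-off functions vanishes near `0`, so it is in the minimal domain
  · rintro ⟨ζ, hζ, f, hf, hf1⟩
    obtain ⟨g, hg⟩ := LinearPMap.mem_domain_iff.mp hf
    rw [mem_graph_Lmin] at hg
    obtain ⟨ε, hε, hone⟩ := mem_nhdsGE_iff_exists_Ico_subset.mp hζ.eq_one
    have hε : 0 < ε := hε
    have h1 : p - c • (U + D) - (f, g) ∈ maxGraph β (m ^ 2) :=
      Submodule.sub_mem _ (Submodule.sub_mem _ hp (Submodule.smul_mem _ c
        (Submodule.add_mem _ hU hDmax))) (minGraph_le_maxGraph _ _ hg)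
    have h2 : p - c • (U + D) - (f, g) ∈ minGraph β (m ^ 2) := by
      refine mem_minGraph_of_eventually_eq_zero h1 (ε := min ε (1 / 2))
        (lt_min hε (by norm_num)) ?_
      filter_upwards [hf1, hsub c, Lp.coeFn_sub (p - c • (U + D)).1 f,
        ae_restrict_mem measurableSet_Ioi] with x k1 k2 k3 hx hxε
      have hx : 0 < x := hx
      have hz : ζ x = 1 := hone ⟨hx.le, hxε.trans_le (min_le_left _ _)⟩
      rw [Prod.fst_sub, k3, Pi.sub_apply, k1, k2, hz,
        cutoff_eq_one hx (hxε.trans_le (min_le_right _ _)).le]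
      ring
    have e : p - c • U = (p - c • (U + D) - (f, g)) + (f, g) + c • D := by
      rw [smul_add]
      abel
    rw [e]
    exact Submodule.add_mem _ (Submodule.add_mem _ h2 hg) (Submodule.smul_mem _ c hD)
  · obtain ⟨ζ, hζ, hζc⟩ := exists_isCutoff_mul_cutoff
    have h1 : p - c • (U + D) ∈ minGraph β (m ^ 2) := by
      have e : p - c • (U + D) = (p - c • U) - c • D := by
        rw [smul_add]
        abel
      rw [e]
      exact Submodule.sub_mem _ h (Submodule.smul_mem _ c hD)
    obtain ⟨f, hf, hf1⟩ := hζ.mul_mem_Lmin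
      (LinearPMap.mem_domain_of_mem_graph (mem_graph_Lmin.mpr h1))
    refine ⟨ζ, hζ, f, hf, ?_⟩
    filter_upwards [hf1, hsub c, ae_restrict_mem measurableSet_Ioi] with x k1 k2 hx
    rw [Prod.fst_sub] at k2
    rw [k1, k2]
    linear_combination -c * boundaryFun β m x * hζc x hx

/-- Plücker's relation in the form used for operators: if `bform p U = 0` for an element `U` at which
the boundary form does not vanish, then `p` is a multiple of `U` up to the minimal domain. -/
theorem sub_smul_mem_minGraph {V : L2 × L2} (hp : p ∈ maxGraph β α) (hU : U ∈ maxGraph β α)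
    (hV : V ∈ maxGraph β α) (hUV : bform U V = 1) (h : bform p U = 0) :
    p - bform p V • U ∈ minGraph β α := by
  rw [mem_minGraph_iff]
  refine ⟨Submodule.sub_mem _ hp (Submodule.smul_mem _ _ hU), fun t ht => ?_⟩
  have h1 := bform_pluecker hp ht hU hV
  have h2 : bform (p - bform p V • U) t = bform p t - bform p V * bform U t := by
    rw [sub_eq_add_neg, bform_add_left, ← neg_smul, bform_smul_left]
    ring
  rw [h2]
  rw [hUV, h, bform_swap U t] at h1
  linear_combination h1

/-- The domain of `H_{β,m}` is the annihilator of the explicit solution in the boundary form. -/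
theorem mem_graph_Hreg_iff (hm : -1 < m.re) (hκ : (1 + 2 * m) * (β / (1 + 2 * m)) = β)
    (hU : U ∈ maxGraph β (m ^ 2))
    (hU1 : U.1 =ᵐ[halfLine] fun x => cutoff x * sol m (β / (1 + 2 * m)) x) :
    p ∈ (Hreg β m).graph ↔ p ∈ maxGraph β (m ^ 2) ∧ bform p U = 0 := by
  rw [mem_graph_Hreg_iff_exists hm hU hU1]
  refine and_congr_right fun hp => ⟨?_, fun h => ?_⟩
  · rintro ⟨c, hc⟩
    have h1 := (mem_minGraph_iff.mp hc).2 U hU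
    rw [sub_eq_add_neg, bform_add_left, ← neg_smul, bform_smul_left, bform_self, mul_zero,
      add_zero] at h1
    exact h1
  · rcases lt_or_ge m.re 1 with hm1 | hm1
    · obtain ⟨p₀, hp₀, F₁, hr, h1, -⟩ := exists_sol_mem hm hκ
      obtain ⟨V, hV, hUV⟩ := exists_bform_sol_eq_one hm hm1 hκ hr h1
      have e1 : p₀.1 = U.1 := Lp.ext (hr.ae_eq.trans hU1.symm)
      have e2 : p₀ = U := by
        rw [← graph_Lmax] at hp₀ hU
        exact Prod.ext e1 ((Lmax β (m ^ 2)).mem_graph_snd_inj' hp₀ hU e1)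
      rw [e2] at hUV
      exact ⟨_, sub_smul_mem_minGraph hp hU hV hUV h⟩
    · refine ⟨0, ?_⟩
      rw [zero_smul, sub_zero, mem_minGraph_iff]
      exact ⟨hp, fun q hq => bform_eq_zero_of_one_le_re hm1 hκ hp hq⟩

/-! ### Complex conjugation -/

theorem conj_two : conj (2 : ℂ) = 2 := map_ofNat _ 2

theorem formalOp_conj {φ : ℝ → ℂ} (hφ : IsTestFun φ) (β α : ℂ) (x : ℝ) :
    formalOp β α (fun x => conj (φ x)) x = conj (formalOp (conj β) (conj α) φ x) := by
  have h1 : deriv (fun x => conj (φ x)) = fun x => conj (deriv φ x) :=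
    funext fun x => (hφ.hasDerivAt x).star.deriv
  have h2 : deriv (fun x => conj (deriv φ x)) x = conj (deriv (deriv φ) x) :=
    (hφ.deriv.hasDerivAt x).star.deriv
  simp only [formalOp, h1, h2, map_add, map_neg, map_mul, map_sub, map_div₀, map_pow,
    Complex.conj_conj, Complex.conj_ofReal, map_one, map_ofNat]

/-- Componentwise complex conjugation on `L² × L²`. -/
noncomputable def conjPair (p : L2 × L2) : L2 × L2 := (star p.1, star p.2)

theorem conjPair_conjPair (p : L2 × L2) : conjPair (conjPair p) = p := by
  simp [conjPair]

theorem conjPair_fst (p : L2 × L2) : (conjPair p).1 =ᵐ[halfLine] fun x => conj (p.1 x) := by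
  filter_upwards [Lp.coeFn_star p.1] with x hx
  simp only [conjPair]
  rw [hx]
  simp

theorem conjPair_snd (p : L2 × L2) : (conjPair p).2 =ᵐ[halfLine] fun x => conj (p.2 x) := by
  filter_upwards [Lp.coeFn_star p.2] with x hx
  simp only [conjPair]
  rw [hx]
  simp

theorem bform_conjPair (p q : L2 × L2) : bform (conjPair p) (conjPair q) = conj (bform p q) := by
  rw [bform, bform, ← integral_conj]
  refine integral_congr_ae ?_
  filter_upwards [conjPair_fst p, conjPair_snd p, conjPair_fst q, conjPair_snd q] with x h1 h2 h3 h4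
  rw [h1, h2, h3, h4]
  simp

theorem conjPair_mem_maxGraph (hp : p ∈ maxGraph β α) :
    conjPair p ∈ maxGraph (conj β) (conj α) := by
  intro φ hφ
  have h := congrArg conj (hp _ hφ.conj)
  rw [← integral_conj, ← integral_conj] at h
  calc ∫ x, (conjPair p).1 x * formalOp (conj β) (conj α) φ x ∂halfLine
      = ∫ x, conj (p.1 x * formalOp β α (fun x => conj (φ x)) x) ∂halfLine := by
        refine integral_congr_ae ?_
        filter_upwards [conjPair_fst p] with x hx
        rw [hx, formalOp_conj hφ]
        simp
    _ = ∫ x, conj (p.2 x * conj (φ x)) ∂halfLine := h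
    _ = ∫ x, (conjPair p).2 x * φ x ∂halfLine := by
        refine integral_congr_ae ?_
        filter_upwards [conjPair_snd p] with x hx
        rw [hx]
        simp

theorem conj_sol (m κ : ℂ) {x : ℝ} (hx : 0 < x) :
    conj (sol m κ x) = sol (conj m) (conj κ) x := by
  have harg : (x : ℂ).arg ≠ Real.pi := by
    rw [Complex.arg_ofReal_of_nonneg hx.le]
    exact Real.pi_pos.ne
  have h := Complex.cpow_conj (x : ℂ) (1 / 2 + m) harg
  rw [Complex.conj_ofReal] at h
  rw [sol, sol, map_mul, ← h, ← Complex.exp_conj]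
  simp [conj_two]

theorem conjPair_mem_graph_Hreg (hm : -1 < m.re) (hκ : (1 + 2 * m) * (β / (1 + 2 * m)) = β)
    (hp : p ∈ (Hreg β m).graph) : conjPair p ∈ (Hreg (conj β) (conj m)).graph := by
  obtain ⟨U, hU, F₁, hr, -⟩ := exists_sol_mem hm hκ
  have hκ' : (1 + 2 * conj m) * (conj β / (1 + 2 * conj m)) = conj β := by
    simpa [conj_two] using congrArg conj hκ
  have hsq : (conj m) ^ 2 = conj (m ^ 2) := (map_pow _ _ _).symm
  have hU' := conjPair_mem_maxGraph hU
  obtain ⟨h1, h2⟩ := (mem_graph_Hreg_iff hm hκ hU hr.ae_eq).mp hp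
  refine (mem_graph_Hreg_iff (U := conjPair U) (by simpa using hm) hκ' (hsq ▸ hU') ?_).mpr
    ⟨hsq ▸ conjPair_mem_maxGraph h1, by rw [bform_conjPair, h2, map_zero]⟩
  filter_upwards [conjPair_fst U, hr.ae_eq, ae_restrict_mem measurableSet_Ioi] with x k1 k2 hx
  rw [k1, k2, map_mul, conj_cutoff, conj_sol _ _ hx]
  simp [conj_two]

/-! ### Transposes, adjoints and codimensions -/

theorem mem_transposeGraph_iff {A : L2 →ₗ.[ℂ] L2} :
    p ∈ transposeGraph A ↔ ∀ q ∈ A.graph, bform p q = 0 := by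
  have e : ∀ q : L2 × L2, bform p q = bilin p.2 q.1 - bilin p.1 q.2 := fun q =>
    integral_sub (integrable_mul p.2 q.1) (integrable_mul p.1 q.2)
  constructor
  · intro h q hq
    obtain ⟨x, hx1, hx2⟩ := (LinearPMap.mem_graph_iff _).mp hq
    rw [e, ← hx1, ← hx2, h x, sub_self]
  · intro h x
    have := h _ (A.mem_graph x)
    rw [e] at this
    exact (sub_eq_zero.mp this).symm

theorem mem_graph_adjoint_iff {A : L2 →ₗ.[ℂ] L2} (hA : Dense (A.domain : Set L2)) :
    p ∈ A.adjoint.graph ↔ conjPair p ∈ transposeGraph A := by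
  rw [LinearPMap.adjoint_graph_eq_graph_adjoint hA, Submodule.mem_adjoint_iff,
    mem_transposeGraph_iff]
  have e : ∀ q : L2 × L2, bform (conjPair p) q =
      -conj (inner ℂ q.2 p.1 - inner ℂ q.1 p.2) := by
    intro q
    rw [bform_swap, bform_eq_inner]
    simp [conjPair]
  simp only [e, neg_eq_zero, map_eq_zero]
  exact ⟨fun h q hq => h q.1 q.2 hq, fun h a b hab => h (a, b) hab⟩

theorem Lmin_le_Hreg (hm : -1 < m.re) (hκ : (1 + 2 * m) * (β / (1 + 2 * m)) = β) :
    Lmin β (m ^ 2) ≤ Hreg β m := by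
  refine LinearPMap.le_of_le_graph fun p hp => ?_
  obtain ⟨U, hU, F₁, hr, -⟩ := exists_sol_mem hm hκ
  obtain ⟨h1, h2⟩ := mem_minGraph_iff.mp (mem_graph_Lmin.mp hp)
  exact (mem_graph_Hreg_iff hm hκ hU hr.ae_eq).mpr ⟨h1, h2 U hU⟩

theorem Hreg_le_Lmax (β m : ℂ) : Hreg β m ≤ Lmax β (m ^ 2) := LinearPMap.domRestrict_le

theorem testGraph_le_graph_Lmin (β α : ℂ) : testGraph β α ≤ (Lmin β α).graph := fun _ hp =>
  mem_graph_Lmin.mpr (Submodule.le_topologicalClosure _ hp)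

theorem dense_domain_Lmin (β α : ℂ) : Dense ((Lmin β α).domain : Set L2) := by
  rw [Submodule.dense_iff_topologicalClosure_eq_top, Submodule.topologicalClosure_eq_top_iff,
    Submodule.eq_bot_iff]
  intro f hf
  refine eq_zero_of_forall_test f fun φ hφ => ?_
  rw [hφ.integral_mul_eq_inner]
  refine (Submodule.mem_orthogonal _ _).mp hf _ (LinearPMap.mem_domain_of_mem_graph
    (y := (hφ.conj.formalOp β α).toL2) (testGraph_le_graph_Lmin β α ?_))
  exact ⟨_, hφ.conj, hφ.conj.coeFn_toL2, (hφ.conj.formalOp β α).coeFn_toL2⟩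

theorem dense_domain_Hreg (hm : -1 < m.re) (hκ : (1 + 2 * m) * (β / (1 + 2 * m)) = β) :
    Dense ((Hreg β m).domain : Set L2) :=
  (dense_domain_Lmin β (m ^ 2)).mono (Lmin_le_Hreg hm hκ).1

/-- The domain of `H_{β,m}` is a maximal isotropic subspace for the boundary form. -/
theorem transposeGraph_Hreg (hm : -1 < m.re) (hκ : (1 + 2 * m) * (β / (1 + 2 * m)) = β) :
    transposeGraph (Hreg β m) = (Hreg β m).graph := by
  obtain ⟨U, hU, F₁, hr, -⟩ := exists_sol_mem hm hκ
  ext p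
  rw [mem_transposeGraph_iff]
  constructor
  · intro h
    refine (mem_graph_Hreg_iff hm hκ hU hr.ae_eq).mpr
      ⟨mem_maxGraph_iff.mpr fun q hq => h q ?_, h U ?_⟩
    · exact LinearPMap.le_graph_of_le (Lmin_le_Hreg hm hκ) (testGraph_le_graph_Lmin _ _ hq)
    · exact (mem_graph_Hreg_iff hm hκ hU hr.ae_eq).mpr ⟨hU, bform_self U⟩
  · intro h q hq
    obtain ⟨-, c, hc⟩ := (mem_graph_Hreg_iff_exists hm hU hr.ae_eq).mp h
    obtain ⟨hq, hqU⟩ := (mem_graph_Hreg_iff hm hκ hU hr.ae_eq).mp hq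
    have h1 := (mem_minGraph_iff.mp hc).2 q hq
    rw [sub_eq_add_neg, bform_add_left, ← neg_smul, bform_smul_left, bform_swap q U, hqU, neg_zero,
      mul_zero, add_zero] at h1
    exact h1

theorem transpose_Hreg (hm : -1 < m.re) (hκ : (1 + 2 * m) * (β / (1 + 2 * m)) = β) :
    transpose (Hreg β m) = Hreg β m :=
  LinearPMap.eq_of_eq_graph
    ((graph_transpose (dense_domain_Hreg hm hκ)).trans (transposeGraph_Hreg hm hκ))

theorem adjoint_Hreg (hm : -1 < m.re) (hκ : (1 + 2 * m) * (β / (1 + 2 * m)) = β) :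
    (Hreg β m).adjoint = Hreg (conj β) (conj m) := by
  refine LinearPMap.eq_of_eq_graph ?_
  ext p
  rw [mem_graph_adjoint_iff (dense_domain_Hreg hm hκ), transposeGraph_Hreg hm hκ]
  constructor
  · intro h
    have := conjPair_mem_graph_Hreg hm hκ h
    rwa [conjPair_conjPair] at this
  · intro h
    have hκ' : (1 + 2 * conj m) * (conj β / (1 + 2 * conj m)) = conj β := by
      simpa [conj_two] using congrArg conj hκ
    have := conjPair_mem_graph_Hreg (by simpa using hm) hκ' h
    rwa [Complex.conj_conj, Complex.conj_conj] at this

theorem Lmin_eq_Lmax (hm : 1 ≤ m.re) (hκ : (1 + 2 * m) * (β / (1 + 2 * m)) = β) :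
    Lmin β (m ^ 2) = Lmax β (m ^ 2) := by
  refine LinearPMap.eq_of_eq_graph ?_
  ext p
  rw [mem_graph_Lmin, mem_minGraph_iff, graph_Lmax]
  exact ⟨fun h => h.1, fun h => ⟨h, fun q hq => bform_eq_zero_of_one_le_re hm hκ h hq⟩⟩

/-- A restriction of an operator has codimension one if the larger graph is spanned by the smaller
one and a further element. -/
theorem finrank_quotient_eq_one {A B : L2 →ₗ.[ℂ] L2} (hAB : A ≤ B) {v : L2 × L2}
    (hv : v ∈ B.graph) (hvA : v ∉ A.graph)
    (h : ∀ p ∈ B.graph, ∃ c : ℂ, p - c • v ∈ A.graph) :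
    Module.finrank ℂ (B.domain ⧸ A.domain.submoduleOf B.domain) = 1 := by
  have hvd : v.1 ∈ B.domain := LinearPMap.mem_domain_of_mem_graph (y := v.2) hv
  have hne : (A.domain.submoduleOf B.domain).mkQ ⟨v.1, hvd⟩ ≠ 0 := by
    rw [Submodule.mkQ_apply, Ne, Submodule.Quotient.mk_eq_zero]
    intro hmem
    have hmem : v.1 ∈ A.domain := hmem
    obtain ⟨y, hy⟩ := LinearPMap.mem_domain_iff.mp hmem
    have := B.mem_graph_snd_inj hv (LinearPMap.le_graph_of_le hAB hy) rfl
    exact hvA (by rwa [← this] at hy)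
  rw [finrank_eq_one_iff_of_nonzero' _ hne]
  intro w
  obtain ⟨x, rfl⟩ := Submodule.mkQ_surjective _ w
  obtain ⟨c, hc⟩ := h _ (B.mem_graph x)
  refine ⟨c, ?_⟩
  rw [← map_smul, ← sub_eq_zero, ← map_sub, Submodule.mkQ_apply, Submodule.Quotient.mk_eq_zero,
    ← Submodule.neg_mem_iff, neg_sub]
  exact LinearPMap.mem_domain_of_mem_graph (y := (((x : L2), B x) - c • v).2) hc

/-- In the limit circle case both inclusions `L^min ⊂ H ⊂ L^max` have codimension one. -/
theorem limit_circle (hm : -1 < m.re) (hm1 : m.re < 1)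
    (hκ : (1 + 2 * m) * (β / (1 + 2 * m)) = β) :
    Lmin β (m ^ 2) < Hreg β m ∧ Hreg β m < Lmax β (m ^ 2) ∧
    Module.finrank ℂ ((Hreg β m).domain ⧸
      (Lmin β (m ^ 2)).domain.submoduleOf (Hreg β m).domain) = 1 ∧
    Module.finrank ℂ ((Lmax β (m ^ 2)).domain ⧸
      (Hreg β m).domain.submoduleOf (Lmax β (m ^ 2)).domain) = 1 := by
  obtain ⟨U, hU, F₁, hr, h1, -⟩ := exists_sol_mem hm hκ
  obtain ⟨V, hV, hUV⟩ := exists_bform_sol_eq_one hm hm1 hκ hr h1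
  have hgr : ∀ p, p ∈ (Hreg β m).graph ↔ p ∈ maxGraph β (m ^ 2) ∧ bform p U = 0 := fun p =>
    mem_graph_Hreg_iff hm hκ hU hr.ae_eq
  have hUH : U ∈ (Hreg β m).graph := (hgr U).mpr ⟨hU, bform_self U⟩
  have hUmin : U ∉ (Lmin β (m ^ 2)).graph := fun h => by
    have := (mem_minGraph_iff.mp (mem_graph_Lmin.mp h)).2 V hV
    rw [hUV] at this
    exact one_ne_zero this
  have hVU : bform V U = -1 := by rw [bform_swap, hUV]
  have hVH : V ∉ (Hreg β m).graph := fun h => by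
    have := ((hgr V).mp h).2
    rw [hVU] at this
    exact neg_ne_zero.mpr one_ne_zero this
  have hVmax : V ∈ (Lmax β (m ^ 2)).graph := by rwa [graph_Lmax]
  refine ⟨lt_of_le_of_ne (Lmin_le_Hreg hm hκ) fun h => hUmin (h ▸ hUH),
    lt_of_le_of_ne (Hreg_le_Lmax β m) fun h => hVH (h ▸ hVmax),
    finrank_quotient_eq_one (Lmin_le_Hreg hm hκ) hUH hUmin fun p hp => ?_,
    finrank_quotient_eq_one (Hreg_le_Lmax β m) hVmax hVH fun p hp => ?_⟩
  · obtain ⟨hp, hpU⟩ := (hgr p).mp hp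
    exact ⟨bform p V, mem_graph_Lmin.mpr (sub_smul_mem_minGraph hp hU hV hUV hpU)⟩
  · rw [graph_Lmax] at hp
    refine ⟨-bform p U, (hgr _).mpr
      ⟨Submodule.sub_mem _ hp (Submodule.smul_mem _ _ hV), ?_⟩⟩
    rw [sub_eq_add_neg, bform_add_left, ← neg_smul, bform_smul_left, hVU]
    ring

/-- Every `H_{β,m}`, including the exceptional ones, is of the form `Hreg β m'` for a parameter `m'`
with `m'² = m²` for which the quotient `β / (1 + 2m')` is meaningful. -/
theorem exists_H_eq_Hreg (β : ℂ) {m : ℂ} (hm : -1 < m.re) :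
    ∃ m' : ℂ, -1 < m'.re ∧ (1 + 2 * m') * (β / (1 + 2 * m')) = β ∧ m' ^ 2 = m ^ 2 ∧
      H β m = Hreg β m' ∧ H (conj β) (conj m) = Hreg (conj β) (conj m') ∧
      (1 ≤ m.re → 1 ≤ m'.re) ∧ (m.re < 1 → m'.re < 1) := by
  have hconj : conj m = -1 / 2 ↔ m = -1 / 2 := by
    constructor <;> intro h
    · simpa [conj_two] using congrArg conj h
    · simp [h, conj_two]
  by_cases h : m = -1 / 2 ∧ β ≠ 0
  · refine ⟨1 / 2, by norm_num, by ring, by rw [h.1]; norm_num, by rw [H, if_pos h], ?_,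
      fun h1 => ?_, fun _ => by norm_num⟩
    · rw [H, if_pos ⟨hconj.mpr h.1, by simpa using h.2⟩]
      simp [conj_two]
    · rw [h.1] at h1
      norm_num at h1
  · refine ⟨m, hm, ?_, rfl, by rw [H, if_neg h], ?_, id, id⟩
    · rcases eq_or_ne β 0 with h0 | h0
      · simp [h0]
      · refine mul_div_cancel₀ β fun hz => h ⟨?_, h0⟩
        linear_combination hz / 2
    · rw [H, if_neg]
      simpa [hconj] using h

end

end Whittaker


theorem mainTheorem4 :
    (∀ β m : ℂ, -1 < m.re →
      Dense ((Whittaker.H β m).domain : Set Whittaker.L2) ∧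
      (Whittaker.H β m).adjoint = Whittaker.H (conj β) (conj m) ∧
      Whittaker.transpose (Whittaker.H β m) = Whittaker.H β m) ∧
    (∀ β m : ℝ, -1 < m → IsSelfAdjoint (Whittaker.H (β : ℂ) (m : ℂ))) ∧
    (∀ β m : ℂ, 1 ≤ m.re →
      Whittaker.Lmin β (m ^ 2) = Whittaker.H β m ∧
      Whittaker.H β m = Whittaker.Lmax β (m ^ 2)) ∧
    (∀ β m : ℂ, -1 < m.re → m.re < 1 →
      Whittaker.Lmin β (m ^ 2) < Whittaker.H β m ∧
      Whittaker.H β m < Whittaker.Lmax β (m ^ 2) ∧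
      Module.finrank ℂ ((Whittaker.H β m).domain ⧸
        (Whittaker.Lmin β (m ^ 2)).domain.submoduleOf (Whittaker.H β m).domain) = 1 ∧
      Module.finrank ℂ ((Whittaker.Lmax β (m ^ 2)).domain ⧸
        (Whittaker.H β m).domain.submoduleOf (Whittaker.Lmax β (m ^ 2)).domain) = 1) := by
  have adj : ∀ β m : ℂ, -1 < m.re →
      (Whittaker.H β m).adjoint = Whittaker.H (conj β) (conj m) := by
    intro β m hm
    obtain ⟨m', hm', hκ, -, e1, e2, -⟩ := Whittaker.exists_H_eq_Hreg β hm
    rw [e1, e2, Whittaker.adjoint_Hreg hm' hκ]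
  refine ⟨fun β m hm => ?_, fun β m hm => ?_, fun β m hm => ?_, fun β m hm hm1 => ?_⟩
  · obtain ⟨m', hm', hκ, -, e1, -⟩ := Whittaker.exists_H_eq_Hreg β hm
    refine ⟨?_, adj β m hm, ?_⟩
    · rw [e1]
      exact Whittaker.dense_domain_Hreg hm' hκ
    · rw [e1, Whittaker.transpose_Hreg hm' hκ]
  · rw [LinearPMap.isSelfAdjoint_def, adj β m (by simpa using hm), Complex.conj_ofReal,
      Complex.conj_ofReal]
  · obtain ⟨m', hm', hκ, e, e1, -, h1, -⟩ :=
      Whittaker.exists_H_eq_Hreg β (by linarith : -1 < m.re)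
    have hmm := Whittaker.Lmin_eq_Lmax (h1 hm) hκ
    have l1 := Whittaker.Lmin_le_Hreg hm' hκ
    have l2 := Whittaker.Hreg_le_Lmax β m'
    rw [e1, ← e]
    exact ⟨le_antisymm l1 (hmm ▸ l2), le_antisymm l2 (hmm ▸ l1)⟩
  · obtain ⟨m', hm', hκ, e, e1, -, -, h1⟩ := Whittaker.exists_H_eq_Hreg β hm
    rw [e1, ← e]
    exact Whittaker.limit_circle hm' (h1 hm1) hκ
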